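/- **Continuum problem.** Let $\sigma$ be a measurable conductivity on $(0,1]$, positive and bounded in the sense that $0<c\le\sigma\le C<\infty$ almost everywhere. Put $$z(r)=\int_r^1\frac{dt}{t\,\sigma(t)},\qquad \hat z(r)=\int_r^1\frac{\sigma(t)}{t}\,dt ,$$ so that $z$ maps $(0,1]$ onto $[0,\infty)$. For $\lambda\in\mathbb C\setminus(-\infty,0]$ let $f^\dagger(\lambda)=v(0)/\varphi$, where $v=v(z)$ is a solution of $\frac{d}{d\hat z}\frac{dv}{dz}=\lambda v$ on $(0,\infty)$ with $-\frac{dv}{dz}(0)=\varphi\neq0$ and $\lim_{z\to\infty}v(z)=0$. The operator $d_{\hat z}d_z$ in $L^2(d\hat z)$, with homogeneous Neumann condition $\frac{dv}{dz}(0)=0$ and the condition $\lim_{z\to\infty}v=0$, has a unique spectral measure on $(-\infty,0]$. This is a positive, locally finite measure $\mu$ such that the transform $h\mapsto\int h(z)\,\phi_t(z)\,d\hat z(z)$ ($h\in L^2(d\hat z)$ of compact support, $\frac{d}{d\hat z}\frac{d\phi_t}{dz}=t\phi_t$, $\phi_t(0)=1$, $\frac{d\phi_t}{dz}(0)=0$)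 extends to a unitary map of $L^2(d\hat z)$ onto $L^2(\mu)$ that carries the operator to multiplication by $t$. For every $\lambda\in\mathbb C\setminus(-\infty,0]$ the value $f^\dagger(\lambda)$ is well defined (such a $v$ exists, and the ratio does not depend on its choice), and $$f^\dagger(\lambda)=\int_{-\infty}^0\frac{d\mu(t)}{\lambda-t},$$ the integral being absolutely convergent. **Discrete problem.** Let $\ell\ge1$, $\alpha_0,\dots,\alpha_\ell>0$ and $\hat\alpha_1,\dots,\hat\alpha_\ell>0$. For $\lambda\in\mathbb C\setminus(-\infty,0]$ let $F^\dagger(\lambda)=V_1/\Phi$, where $(V_0,\dots,V_{\ell+1})$ satisfies $$\frac1{\hat\alpha_j}\Big(\frac{V_{j+1}-V_j}{\alpha_j}-\frac{V_j-V_{j-1}}{\alpha_{j-1}}\Big)-\lambda V_j=0\quad(1\le j\le\ell),\qquad -\frac{V_1-V_0}{\alpha_0}=\Phi\ne0,\qquad V_{\ell+1}=0 .$$ The difference operator $V\mapsto\frac1{\hat\alpha_j}\big(\frac{V_{j+1}-V_j}{\alpha_j}-\frac{V_j-V_{j-1}}{\alpha_{j-1}}\big)$, with $V_0=V_1$ and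 $V_{\ell+1}=0$, on $\mathbb C^\ell$ with inner product $\langle a,b\rangle=\sum_{j}\hat\alpha_j a_j\overline{b_j}$, has a unique spectral measure $\mu^F$ on $(-\infty,0]$ (defined as above, with $\phi_t$ now the solution of the difference equation with $\lambda=t$ and $V_0=V_1=1$, and $\int\cdot\,d\hat z$ replaced by $\sum_j\hat\alpha_j\,\cdot$). The value $F^\dagger(\lambda)$ is well defined and $$F^\dagger(\lambda)=\int_{-\infty}^0\frac{d\mu^F(t)}{\lambda-t}.$$ Moreover, let $A$ be the $\ell\times\ell$ tridiagonal matrix whose nonzero entries are $A_{11}=-\frac1{\hat\alpha_1\alpha_1}$, $A_{ii}=-\frac1{\hat\alpha_i}\big(\frac1{\alpha_i}+\frac1{\alpha_{i-1}}\big)$ for $i>1$, $A_{i,i+1}=\frac1{\hat\alpha_i\alpha_i}$ and $A_{i,i-1}=\frac1{\hat\alpha_i\alpha_{i-1}}$. Its eigenvalues are simple and negative, $-\delta_1^2,\dots,-\delta_\ell^2$ with $0<\delta_1<\dots<\delta_\ell$. It has real eigenvectors $Y_j=(Y_{1,j},\dots,Y_{\ell,j})^T$ with $AY_j=-\delta_j^2Y_j$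 and $\sum_p\hat\alpha_pY_{p,i}Y_{p,j}=\delta_{ij}$ (Kronecker symbol), and for any such eigenvectors $$\mu^F=\sum_{j=1}^\ell Y_{1,j}^2\,\delta_{\{-\delta_j^2\}}\ \text{(a sum of point masses)},\qquad F^\dagger(\lambda)=\sum_{j=1}^\ell\frac{Y_{1,j}^2}{\lambda+\delta_j^2}.$$ -/

import Mathlib

open scoped ENNReal

noncomputable section

/-! ### Spectral measures of second order operators -/

/-- Let `m` be a mass measure on `X`, let `graph` be the graph of an operator in `L²(m)`, let `𝒦` be
the family of "compact" subsets of `X`, and let `IsFund t φ` say that `φ` is the solution of the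
eigenvalue equation with parameter `t` normalized at the left end (`φ = 1`, `φ' = 0`).

`μ` is the spectral measure of the operator on `(-∞, 0]` when the generalized Fourier transform
`h ↦ ∫ h φ_t dm`, defined on functions supported in a member of `𝒦`, extends to a unitary map
of `L²(m)` onto `L²(μ)` that carries the operator to multiplication by the variable `t`
(with its maximal domain). -/
structure IsSpectralMeasure {X : Type*} [MeasurableSpace X] (m : MeasureTheory.Measure X)
    (graph : Set (MeasureTheory.Lp ℂ 2 m × MeasureTheory.Lp ℂ 2 m)) (𝒦 : Set (Set X))
    (IsFund : ℝ → (X → ℂ) → Prop) (μ : MeasureTheory.Measure ℝ) : Prop where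
  locallyFinite : MeasureTheory.IsLocallyFiniteMeasure μ
  nonpos : μ (Set.Ioi 0) = 0
  unitary : ∃ (Φ : ℝ → X → ℂ) (U : MeasureTheory.Lp ℂ 2 m ≃ₗᵢ[ℂ] MeasureTheory.Lp ℂ 2 μ),
    (∀ t, IsFund t (Φ t)) ∧
    (∀ K ∈ 𝒦, ∀ h : MeasureTheory.Lp ℂ 2 m, (∀ᵐ x ∂m, x ∉ K → h x = 0) →
      (U h : ℝ → ℂ) =ᵐ[μ] fun t => ∫ x, h x * Φ t x ∂m) ∧
    (∀ v g : MeasureTheory.Lp ℂ 2 m, (v, g) ∈ graph ↔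
      (U g : ℝ → ℂ) =ᵐ[μ] fun t => (t : ℂ) * U v t)

/-! ### The continuum problem

Functions of `z ∈ [0, ∞)` are written as functions of the radius `r ∈ (0, 1]`; `z = 0` is `r = 1`,
and `z → ∞` is `r → 0+`. -/

/-- The measure `dz` on `(0, 1]`, where `z(r) = ∫_r^1 dt / (t σ(t))`. -/
def dzMeasure (σ : ℝ → ℝ) : MeasureTheory.Measure ℝ :=
  (MeasureTheory.volume.restrict (Set.Ioc 0 1)).withDensity
    fun t => ENNReal.ofReal (1 / (t * σ t))

/-- The measure `dẑ` on `(0, 1]`, where `ẑ(r) = ∫_r^1 σ(t) / t dt`. -/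
def dzhatMeasure (σ : ℝ → ℝ) : MeasureTheory.Measure ℝ :=
  (MeasureTheory.volume.restrict (Set.Ioc 0 1)).withDensity
    fun t => ENNReal.ofReal (σ t / t)

/-- `F` is locally absolutely continuous with respect to the coordinate `y(r) = ν((r, 1])`
and `dF/dy = G`. -/
def HasCoordDeriv (ν : MeasureTheory.Measure ℝ) (F G : ℝ → ℂ) : Prop :=
  ∀ r ∈ Set.Ioc (0 : ℝ) 1, MeasureTheory.IntegrableOn G (Set.Ioc r 1) ν ∧
    F r = F 1 + ∫ t in Set.Ioc r 1, G t ∂ν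

/-- `d/dẑ (dv/dz) = lam * v`, with `w = dv/dz`. -/
def IsStringSolution (σ : ℝ → ℝ) (lam : ℂ) (v w : ℝ → ℂ) : Prop :=
  HasCoordDeriv (dzMeasure σ) v w ∧ HasCoordDeriv (dzhatMeasure σ) w (fun r => lam * v r)

/-- `f` is a value of the continuum Neumann-to-Dirichlet function at `lam`: `f = v(0) / φ` for a
solution `v` with `-dv/dz(0) = φ ≠ 0` and `v → 0` as `z → ∞`. -/
def IsNtDValue (σ : ℝ → ℝ) (lam f : ℂ) : Prop :=
  ∃ (v w : ℝ → ℂ) (φ : ℂ), IsStringSolution σ lam v w ∧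
    Filter.Tendsto v (nhdsWithin 0 (Set.Ioi 0)) (nhds 0) ∧
    -w 1 = φ ∧ φ ≠ 0 ∧ f = v 1 / φ

/-- The graph of `d_ẑ d_z` in `L²(dẑ)`, with the homogeneous Neumann condition at `z = 0` and the
condition `v → 0` as `z → ∞`. -/
def stringGraph (σ : ℝ → ℝ) :
    Set (MeasureTheory.Lp ℂ 2 (dzhatMeasure σ) × MeasureTheory.Lp ℂ 2 (dzhatMeasure σ)) :=
  {p | ∃ V W : ℝ → ℂ, (p.1 : ℝ → ℂ) =ᵐ[dzhatMeasure σ] V ∧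
    HasCoordDeriv (dzMeasure σ) V W ∧ HasCoordDeriv (dzhatMeasure σ) W p.2 ∧
    W 1 = 0 ∧ Filter.Tendsto V (nhdsWithin 0 (Set.Ioi 0)) (nhds 0)}

/-- `φ` solves `d_ẑ d_z φ = t φ` with `φ(0) = 1` and `dφ/dz(0) = 0`. -/
def IsStringFund (σ : ℝ → ℝ) (t : ℝ) (φ : ℝ → ℂ) : Prop :=
  ∃ w : ℝ → ℂ, IsStringSolution σ (t : ℂ) φ w ∧ φ 1 = 1 ∧ w 1 = 0

/-- `μ` is the spectral measure of `d_ẑ d_z`. -/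
def IsStringSpectralMeasure (σ : ℝ → ℝ) (μ : MeasureTheory.Measure ℝ) : Prop :=
  IsSpectralMeasure (dzhatMeasure σ) (stringGraph σ)
    {K | ∃ r : ℝ, 0 < r ∧ r < 1 ∧ K = Set.Ioc r 1} (IsStringFund σ) μ

/-! ### The discrete problem

The nodes are `0, 1, …, ℓ + 1`; the unknown at node `p + 1` has the index `p : Fin ℓ`. -/

/-- The difference operator at the node `j ≥ 1`. -/
def diffOp (α αh : ℕ → ℝ) (V : ℕ → ℂ) (j : ℕ) : ℂ :=
  1 / (αh j : ℂ) * ((V (j + 1) - V j) / (α j : ℂ) - (V j - V (j - 1)) / (α (j - 1) : ℂ))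

/-- `F` is a value of the discrete Neumann-to-Dirichlet function at `lam`: `F = V₁ / Φ` for a
solution `V` of the difference equation with `-(V₁ - V₀) / α₀ = Φ ≠ 0` and `V_{ℓ+1} = 0`. -/
def IsDiscreteNtDValue (ℓ : ℕ) (α αh : ℕ → ℝ) (lam F : ℂ) : Prop :=
  ∃ (V : ℕ → ℂ) (Φ : ℂ),
    (∀ j, 1 ≤ j → j ≤ ℓ → diffOp α αh V j - lam * V j = 0) ∧
    -((V 1 - V 0) / (α 0 : ℂ)) = Φ ∧ V (ℓ + 1) = 0 ∧ Φ ≠ 0 ∧ F = V 1 / Φ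

/-- The measure on the nodes whose `L²` inner product is `∑ α̂_j a_j b̄_j`. -/
def nodeMeasure (ℓ : ℕ) (αh : ℕ → ℝ) : MeasureTheory.Measure (Fin ℓ) :=
  MeasureTheory.Measure.sum fun p : Fin ℓ =>
    ENNReal.ofReal (αh (p + 1)) • MeasureTheory.Measure.dirac p

/-- The graph of the difference operator with the homogeneous boundary conditions `V₀ = V₁` and
`V_{ℓ+1} = 0`. -/
def diffGraph (ℓ : ℕ) (α αh : ℕ → ℝ) :
    Set (MeasureTheory.Lp ℂ 2 (nodeMeasure ℓ αh) × MeasureTheory.Lp ℂ 2 (nodeMeasure ℓ αh)) :=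
  {q | ∃ V : ℕ → ℂ, V 0 = V 1 ∧ V (ℓ + 1) = 0 ∧
    ∀ p : Fin ℓ, q.1 p = V (p + 1) ∧ q.2 p = diffOp α αh V (p + 1)}

/-- `φ` solves the difference equation with `lam = t`, `φ₁ = 1` and `φ₁ - φ₀ = 0`. -/
def IsDiffFund (ℓ : ℕ) (α αh : ℕ → ℝ) (t : ℝ) (φ : Fin ℓ → ℂ) : Prop :=
  ∃ V : ℕ → ℂ, V 0 = 1 ∧ V 1 = 1 ∧
    (∀ j, 1 ≤ j → j ≤ ℓ → diffOp α αh V j = (t : ℂ) * V j) ∧ ∀ p : Fin ℓ, φ p = V (p + 1)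

/-- `μ` is the spectral measure of the difference operator. -/
def IsDiffSpectralMeasure (ℓ : ℕ) (α αh : ℕ → ℝ) (μ : MeasureTheory.Measure ℝ) : Prop :=
  IsSpectralMeasure (nodeMeasure ℓ αh) (diffGraph ℓ α αh) {Set.univ} (IsDiffFund ℓ α αh) μ

/-- The weighted Jacobi matrix `A`. -/
def jacobiA (ℓ : ℕ) (α αh : ℕ → ℝ) : Matrix (Fin ℓ) (Fin ℓ) ℝ :=
  Matrix.of fun p q =>
    let i : ℕ := p + 1
    let j : ℕ := q + 1
    if i = 1 then
      -(1 / (αh 1 * α 1)) * (if j = 1 then 1 else 0) + 1 / (αh 1 * α 1) * (if j = 2 then 1 else 0)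
    else
      -(1 / αh i * (1 / α i + 1 / α (i - 1))) * (if j = i then 1 else 0)
        + 1 / (αh i * α (i - 1)) * (if j = i - 1 then 1 else 0)
        + 1 / (αh i * α i) * (if j = i + 1 then 1 else 0)

/-- The columns of `Y` are eigenvectors of `A` with eigenvalues `-δ_j²`, orthonormal for the
weighted inner product `⟨a, b⟩ = ∑ α̂_p a_p b_p`. -/
def IsWeightedEigenbasis (ℓ : ℕ) (α αh : ℕ → ℝ) (δ : Fin ℓ → ℝ)
    (Y : Matrix (Fin ℓ) (Fin ℓ) ℝ) : Prop :=
  (∀ j, (jacobiA ℓ α αh).mulVec (fun p => Y p j) = (-((δ j) ^ 2)) • fun p => Y p j) ∧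
  ∀ i j, ∑ p : Fin ℓ, αh (p + 1) * Y p i * Y p j = if i = j then 1 else 0

/-- The discrete measure `∑ Y_{1,j}² dirac(-δ_j²)`. -/
def discreteMeasure (ℓ : ℕ) (hℓ : 0 < ℓ) (δ : Fin ℓ → ℝ) (Y : Matrix (Fin ℓ) (Fin ℓ) ℝ) :
    MeasureTheory.Measure ℝ :=
  MeasureTheory.Measure.sum fun j : Fin ℓ =>
    ENNReal.ofReal ((Y ⟨0, hℓ⟩ j) ^ 2) • MeasureTheory.Measure.dirac (-((δ j) ^ 2))

end

/-! Write `m` for `dẑ` and `n` for `dz`. Both have a density comparable to `1 / t`, and the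
continuum argument uses only the consequences of this recorded in `IsRadial`: domination by Lebesgue
measure away from `0`, positive mass on every interval, and comparable masses of dyadic windows.

On pairs `(v, dv/dn)` the form `‖v‖² + ‖dv/dn‖²` is closed, so Riesz representation yields `T = (1 -
d_m d_n)⁻¹` with the Neumann condition, a positive injective contraction. The condition at infinity
comes for free: finite energy forces `v → 0` (`formSpace.tendsto_rep`), and conversely an energy
identity (`eq_zero_of_neumann_of_tendsto`) shows that a decaying Neumann solution off the half line
vanishes. Evaluation at the end `1` is bounded for this form. Its representer `ψ` (`endVec`) is the
decaying solution for `λ = 1` with unit flux.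

The vector `ψ` is cyclic for `T`. If `h` is orthogonal to all vectors obtained from `ψ` by spectral
cutoffs, then a spectrally localized part of `h` and all its images under the operator have end
value and end derivative `0`. Each image is thus the twofold primitive of the next, they grow only
geometrically, and iterated primitives gain a factorial, so all vanish
(`eq_zero_of_volterra_chain`). The functional calculus and the Riesz–Markov theorem then produce `μ`
and a unitary `U` that turns `T` into multiplication by `1 / (1 - t)` and `ψ` into `1 / (1 - t)`
(`exists_isSpectralRep`). The same Volterra argument identifies `U⁻¹` on compactly supported
functions with integration against `φ_t`, hence `U` with the transform. Conversely every spectral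
measure in the sense of the statement carries such a representation (`isSpectralRep_of_transform`),
and a separating algebra of functions of `T` determines the measure
(`IsSpectralRep.measure_unique`).

For the Neumann-to-Dirichlet function, the resolvent equation gives `f(λ) = ψ(1) + (1 - λ) ∫ dμ /
((1 - t)(λ - t))`. By partial fractions this is the Stieltjes transform once `ψ(1) = ∫ dμ / (1 -
t)`. That last equality comes from letting `λ → +∞`: an energy estimate gives `f(λ) → 0`, and
monotone convergence handles the integral.

The discrete problem is linear algebra. The matrix `A` is symmetric for the weights `α̂`, and the
three-term recurrence makes every eigenvector a multiple of the fundamental solution. Hence first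
entries do not vanish and eigenvalues are simple; they are negative because the fundamental solution
is at least `1` when `t ≥ 0`. Expansion in eigenvectors gives the remaining formulas. -/

section

open scoped ComplexConjugate InnerProductSpace CompactlySupported ComplexOrder

noncomputable section

open MeasureTheory Set Filter Topology

/-! ### Measures with density comparable to `1 / t`. -/

section

/-- A measure on `(0, 1]` which is dominated by Lebesgue measure away from `0`, charges every
interval, and gives comparable masses to the dyadic windows `(r / 2, r]`. -/
structure IsRadial (ν : Measure ℝ) : Prop where
  null : ν (Ioc 0 1)ᶜ = 0
  le : ∀ a, 0 < a → ∃ K : NNReal, ν.restrict (Ioc a 1) ≤ K • volume.restrict (Ioc a 1)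
  window : ∃ lo hi : ℝ, 0 < lo ∧ ∀ r, 0 < r → r ≤ 1 →
    lo ≤ ν.real (Ioc (r / 2) r) ∧ ν.real (Ioc (r / 2) r) ≤ hi
  pos : ∀ a b, 0 ≤ a → a < b → b ≤ 1 → ν (Ioc a b) ≠ 0

/-- The density `1 / t` is scale invariant. On `(r / 2, r]` it lies between `1 / r` and `2 / r`
while the length is `r / 2`, so the window mass is between `k / 2` and `K` for every `r`. -/
theorem isRadial_withDensity {d : ℝ → ℝ} {k K : ℝ} (hk : 0 < k)
    (hd : ∀ᵐ t ∂(volume.restrict (Ioc (0 : ℝ) 1)), k / t ≤ d t ∧ d t ≤ K / t) :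
    IsRadial ((volume.restrict (Ioc (0 : ℝ) 1)).withDensity fun t => ENNReal.ofReal (d t)) := by
  -- The two-sided bound holds at some actual point because the interval has positive length; there
  -- `k ≤ K`.
  have hK : 0 < K := by
    have : (volume.restrict (Ioc (0 : ℝ) 1)) ≠ 0 := by simp
    have := ae_neBot.2 this
    obtain ⟨t, ⟨h1, h2⟩, ht⟩ := (hd.and (ae_restrict_mem measurableSet_Ioc)).exists
    have : k / t ≤ K / t := h1.trans h2
    have := (div_le_div_iff_of_pos_right ht.1).1 this
    linarith
  have key : ∀ a b, 0 ≤ a → b ≤ 1 → ((volume.restrict (Ioc (0 : ℝ) 1)).withDensity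
      fun t => ENNReal.ofReal (d t)) (Ioc a b) = ∫⁻ t in Ioc a b, ENNReal.ofReal (d t) := by
    intro a b ha hb
    rw [withDensity_apply _ measurableSet_Ioc, Measure.restrict_restrict measurableSet_Ioc,
      inter_eq_self_of_subset_left (Ioc_subset_Ioc ha hb)]
  have hd' : ∀ a b, 0 ≤ a → b ≤ 1 → ∀ᵐ t ∂(volume.restrict (Ioc a b)),
      (k / t ≤ d t ∧ d t ≤ K / t) ∧ t ∈ Ioc a b := fun a b ha hb =>
    (ae_restrict_of_ae_restrict_of_subset (Ioc_subset_Ioc ha hb) hd).and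
      (ae_restrict_mem measurableSet_Ioc)
  have low : ∀ a b, 0 ≤ a → a < b → b ≤ 1 →
      ENNReal.ofReal (k / b * (b - a)) ≤ ∫⁻ t in Ioc a b, ENNReal.ofReal (d t) := by
    intro a b ha hab hb
    have hb0 : 0 < b := ha.trans_lt hab
    calc ENNReal.ofReal (k / b * (b - a)) = ∫⁻ t in Ioc a b, ENNReal.ofReal (k / b) := by
          rw [setLIntegral_const, Real.volume_Ioc, ENNReal.ofReal_mul (by positivity)]
      _ ≤ _ := by
          apply lintegral_mono_ae
          filter_upwards [hd' a b ha hb] with t ht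
          apply ENNReal.ofReal_le_ofReal
          refine le_trans ?_ ht.1.1
          exact div_le_div_of_nonneg_left hk.le (ha.trans_lt ht.2.1) ht.2.2
  have upp : ∀ a b, 0 < a → b ≤ 1 → a ≤ b →
      ∫⁻ t in Ioc a b, ENNReal.ofReal (d t) ≤ ENNReal.ofReal (K / a * (b - a)) := by
    intro a b ha hb hab
    calc ∫⁻ t in Ioc a b, ENNReal.ofReal (d t) ≤ ∫⁻ t in Ioc a b, ENNReal.ofReal (K / a) := by
          apply lintegral_mono_ae
          filter_upwards [hd' a b ha.le hb] with t ht
          apply ENNReal.ofReal_le_ofReal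
          refine ht.1.2.trans ?_
          exact div_le_div_of_nonneg_left hK.le ha ht.2.1.le
      _ = _ := by rw [setLIntegral_const, Real.volume_Ioc, ENNReal.ofReal_mul (by positivity)]
  refine ⟨?_, ?_, ⟨k / 2, K, by positivity, ?_⟩, ?_⟩
  · apply withDensity_absolutelyContinuous
    rw [Measure.restrict_apply measurableSet_Ioc.compl]; simp
  · intro a ha
    refine ⟨(K / a).toNNReal, ?_⟩
    refine Measure.le_iff.2 fun s hs => ?_
    rw [Measure.restrict_apply hs, withDensity_apply _ (hs.inter measurableSet_Ioc),
      Measure.restrict_restrict (hs.inter measurableSet_Ioc), inter_assoc,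
      inter_eq_self_of_subset_left (Ioc_subset_Ioc_left ha.le)]
    calc _ ≤ ∫⁻ t in s ∩ Ioc a 1, ENNReal.ofReal (K / a) := by
          apply lintegral_mono_ae
          filter_upwards [ae_restrict_of_ae_restrict_of_subset inter_subset_right
            (hd' a 1 ha.le le_rfl)] with t ht
          apply ENNReal.ofReal_le_ofReal
          refine ht.1.2.trans ?_
          exact div_le_div_of_nonneg_left hK.le ha ht.2.1.le
      _ = _ := by
          rw [setLIntegral_const, Measure.smul_apply, Measure.restrict_apply hs]; rfl
  · intro r hr hr1
    have e := key (r / 2) r (by positivity) hr1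
    have l := low (r / 2) r (by positivity) (by linarith) hr1
    have u := upp (r / 2) r (by positivity) hr1 (by linarith)
    rw [← e] at l u
    have e1 : k / r * (r - r / 2) = k / 2 := by field_simp; ring
    have e2 : K / (r / 2) * (r - r / 2) = K := by field_simp; ring
    rw [e1] at l
    rw [e2] at u
    constructor
    · exact (ENNReal.ofReal_le_iff_le_toReal (ne_top_of_le_ne_top ENNReal.ofReal_ne_top u)).1 l
    · exact ENNReal.toReal_le_of_le_ofReal hK.le u
  · intro a b ha hab hb
    rw [key a b ha hb]
    have l := low a b ha hab hb
    have : 0 < k / b * (b - a) := mul_pos (div_pos hk (ha.trans_lt hab)) (by linarith)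
    exact (lt_of_lt_of_le (ENNReal.ofReal_pos.2 this) l).ne'

section Coefficient

variable {σ : ℝ → ℝ} {c C : ℝ}

theorem isRadial_dzMeasure (hc : 0 < c)
    (hσ : ∀ᵐ r ∂(volume.restrict (Ioc (0 : ℝ) 1)), c ≤ σ r ∧ σ r ≤ C) :
    IsRadial (dzMeasure σ) := by
  have hC : 0 < C := by
    have : (volume.restrict (Ioc (0 : ℝ) 1)) ≠ 0 := by simp
    have := ae_neBot.2 this
    obtain ⟨t, h1, h2⟩ := hσ.exists
    linarith
  refine isRadial_withDensity (k := 1 / C) (K := 1 / c) (by positivity) ?_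
  filter_upwards [hσ, ae_restrict_mem measurableSet_Ioc] with t ht h0
  have := h0.1
  have h2 : 0 < σ t := by linarith
  rw [div_div, div_div]
  exact ⟨one_div_le_one_div_of_le (by positivity) (by nlinarith),
    one_div_le_one_div_of_le (by positivity) (by nlinarith)⟩

theorem isRadial_dzhatMeasure (hc : 0 < c)
    (hσ : ∀ᵐ r ∂(volume.restrict (Ioc (0 : ℝ) 1)), c ≤ σ r ∧ σ r ≤ C) :
    IsRadial (dzhatMeasure σ) := by
  refine isRadial_withDensity (k := c) (K := C) hc ?_
  filter_upwards [hσ, ae_restrict_mem measurableSet_Ioc] with t ht h0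
  exact ⟨div_le_div_of_nonneg_right ht.1 h0.1.le, div_le_div_of_nonneg_right ht.2 h0.1.le⟩

instance sigmaFinite_dzMeasure : SigmaFinite (dzMeasure σ) := by
  unfold dzMeasure; infer_instance

instance sigmaFinite_dzhatMeasure : SigmaFinite (dzhatMeasure σ) := by
  unfold dzhatMeasure; infer_instance

end Coefficient

namespace IsRadial

variable {ν : Measure ℝ} (hν : IsRadial ν)
include hν

theorem measure_Ioc_lt_top {a : ℝ} (ha : 0 < a) (b : ℝ) : ν (Ioc a b) < ∞ := by
  obtain ⟨K, hK⟩ := hν.le a ha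
  have h1 : ν (Ioc a 1) < ∞ := by
    have := hK (Ioc a 1)
    rw [Measure.restrict_apply_self] at this
    refine this.trans_lt ?_
    rw [Measure.smul_apply, Measure.restrict_apply_self, Real.volume_Ioc]
    exact ENNReal.mul_lt_top ENNReal.coe_lt_top ENNReal.ofReal_lt_top
  refine lt_of_le_of_lt ?_ h1
  calc ν (Ioc a b) ≤ ν (Ioc a 1 ∪ (Ioc 0 1)ᶜ) := by
        apply measure_mono
        intro x hx
        by_cases h : x ≤ 1
        · exact Or.inl ⟨hx.1, h⟩
        · exact Or.inr fun h' => h h'.2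
    _ ≤ ν (Ioc a 1) + ν (Ioc 0 1)ᶜ := measure_union_le _ _
    _ = ν (Ioc a 1) := by rw [hν.null, add_zero]

theorem noAtoms : NullSingletonClass ν := by
  refine ⟨fun x => ?_⟩
  by_cases hx : x ∈ Ioc (0 : ℝ) 1
  · obtain ⟨K, hK⟩ := hν.le (x / 2) (by linarith [hx.1])
    have := hK {x}
    rw [Measure.restrict_apply (measurableSet_singleton x), Measure.smul_apply,
      Measure.restrict_apply (measurableSet_singleton x), inter_eq_self_of_subset_left] at this
    · simpa using this
    · simp only [singleton_subset_iff]; exact ⟨by linarith [hx.1], hx.2⟩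
  · exact measure_mono_null (singleton_subset_iff.2 hx) hν.null

theorem ae_mem : ∀ᵐ t ∂ν, t ∈ Ioc (0 : ℝ) 1 := by
  rw [ae_iff]; exact hν.null

theorem integrableOn_of_memLp {E : Type*} [NormedAddCommGroup E] {f : ℝ → E} {p : ℝ≥0∞}
    (hp : 1 ≤ p) (hf : MemLp f p ν) {a : ℝ} (ha : 0 < a) (b : ℝ) : IntegrableOn f (Ioc a b) ν := by
  have : IsFiniteMeasure (ν.restrict (Ioc a b)) := ⟨by
    rw [Measure.restrict_apply_univ]; exact hν.measure_Ioc_lt_top ha b⟩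
  exact (hf.restrict _).integrable hp

theorem integrableOn_of_continuousOn {f : ℝ → ℂ} (hf : ContinuousOn f (Ioc 0 1)) {a : ℝ}
    (ha : 0 < a) : IntegrableOn f (Ioc a 1) ν := by
  have hc : ContinuousOn f (Icc a 1) := hf.mono fun x hx => ⟨ha.trans_le hx.1, hx.2⟩
  obtain ⟨B, hB⟩ := isCompact_Icc.exists_bound_of_continuousOn hc
  refine IntegrableOn.of_bound (hν.measure_Ioc_lt_top ha 1)
    ((hc.mono Ioc_subset_Icc_self).aestronglyMeasurable measurableSet_Ioc) B ?_
  filter_upwards [ae_restrict_mem measurableSet_Ioc] with x hx using hB x (Ioc_subset_Icc_self hx)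

/-- Absence of atoms gives continuity; near a given `r` it is enough to work on `[r / 2, 1]`, where
the total mass is finite. -/
theorem continuousOn_primitive {G : ℝ → ℂ} (hG : ∀ r ∈ Ioc (0 : ℝ) 1, IntegrableOn G (Ioc r 1) ν) :
    ContinuousOn (fun r => ∫ t in Ioc r 1, G t ∂ν) (Ioc 0 1) := by
  have := hν.noAtoms
  intro r hr
  have ha : 0 < r / 2 := by linarith [hr.1]
  have h1 : IntegrableOn G (uIcc (r / 2) 1) ν := by
    rw [uIcc_of_le (by linarith [hr.2]), integrableOn_Icc_iff_integrableOn_Ioc]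
    exact hG _ ⟨ha, by linarith [hr.2]⟩
  have h2 := intervalIntegral.continuousOn_primitive_interval_left h1
  rw [uIcc_of_le (by linarith [hr.2])] at h2
  have h3 : ContinuousOn (fun r => ∫ t in Ioc r 1, G t ∂ν) (Icc (r / 2) 1) := by
    refine h2.congr fun x hx => ?_
    simp only [intervalIntegral.integral_of_le hx.2]
  refine (h3 r ⟨by linarith [hr.1], hr.2⟩).mono_of_mem_nhdsWithin ?_
  refine mem_nhdsWithin.2 ⟨Ioi (r / 2), isOpen_Ioi, by simp; linarith [hr.1], ?_⟩
  intro x hx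
  exact ⟨le_of_lt hx.1, hx.2.2⟩

theorem hasCoordDeriv_continuousOn {F G : ℝ → ℂ} (h : HasCoordDeriv ν F G) :
    ContinuousOn F (Ioc 0 1) :=
  ((hν.continuousOn_primitive fun r hr => (h r hr).1).const_add (F 1)).congr fun r hr => (h r hr).2

omit hν in
theorem _root_.hasCoordDeriv_primitive {G : ℝ → ℂ} (hG : ∀ r ∈ Ioc (0 : ℝ) 1, IntegrableOn G (Ioc r 1) ν)
    (k : ℂ) : HasCoordDeriv ν (fun r => k + ∫ t in Ioc r 1, G t ∂ν) G := by
  intro r hr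
  exact ⟨hG r hr, by simp⟩

/-- Domination by Lebesgue measure preserves the gain `1 / (j + 1)` of the elementary integral. This
is the source of the factorials in all Volterra estimates. -/
theorem integral_pow_le (a : ℝ) (ha : 0 < a) : ∃ K : ℝ, 0 ≤ K ∧ ∀ r ∈ Ioc a 1, ∀ j : ℕ,
    IntegrableOn (fun y => (1 - y) ^ j) (Ioc r 1) ν ∧
    ∫ y in Ioc r 1, (1 - y) ^ j ∂ν ≤ K * ((1 - r) ^ (j + 1) / (j + 1)) := by
  obtain ⟨K, hK⟩ := hν.le a ha
  refine ⟨K, K.2, fun r hr j => ?_⟩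
  have hle : ν.restrict (Ioc r 1) ≤ K • volume.restrict (Ioc r 1) := by
    have := Measure.restrict_mono_measure hK (Ioc r 1)
    rwa [Measure.restrict_smul, Measure.restrict_restrict measurableSet_Ioc,
      Measure.restrict_restrict measurableSet_Ioc,
      inter_eq_self_of_subset_left (Ioc_subset_Ioc_left hr.1.le)] at this
  have hi : IntegrableOn (fun y : ℝ => (1 - y) ^ j) (Ioc r 1) volume :=
    (by fun_prop : Continuous fun y : ℝ => (1 - y) ^ j).integrableOn_Ioc
  have hi' : Integrable (fun y : ℝ => (1 - y) ^ j) (K • volume.restrict (Ioc r 1)) :=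
    hi.smul_measure_nnreal
  refine ⟨hi'.mono_measure hle, ?_⟩
  have h0 : ∀ᵐ y ∂(K • volume.restrict (Ioc r 1)), 0 ≤ (1 - y) ^ j := by
    apply Measure.ae_smul_measure
    filter_upwards [ae_restrict_mem measurableSet_Ioc] with y hy
    exact pow_nonneg (by linarith [hy.2]) _
  refine (integral_mono_measure hle h0 hi').trans_eq ?_
  rw [integral_smul_nnreal_measure]
  congr 1
  rw [← intervalIntegral.integral_of_le hr.2,
    intervalIntegral.integral_comp_sub_left (fun y => y ^ j) 1, integral_pow]
  simp

end IsRadial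

end

section

/-! ### Volterra iteration -/

section Volterra

variable {m n : Measure ℝ}

/-- Only the outer integration is used to raise the power and the factorial. The inner one is
estimated by the sup norm times the mass of `(a, 1]`. -/
theorem norm_volterra_le (hm : IsRadial m) (hn : IsRadial n) {a : ℝ} (ha : 0 < a) :
    ∃ K : ℝ, 0 ≤ K ∧ ∀ (f : ℝ → ℂ) (B : ℝ) (j : ℕ), 0 ≤ B →
      (∀ r ∈ Ioc a 1, ‖f r‖ ≤ B * ((1 - r) ^ j / j.factorial)) → ∀ r ∈ Ioc a 1,
      ‖∫ y in Ioc r 1, ∫ s in Ioc y 1, f s ∂m ∂n‖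
        ≤ B * K * ((1 - r) ^ (j + 1) / (j + 1).factorial) := by
  obtain ⟨K, hK, h⟩ := hn.integral_pow_le a ha
  refine ⟨m.real (Ioc a 1) * K, by positivity, fun f B j hB hf r hr => ?_⟩
  obtain ⟨h1, h2⟩ := h r hr j
  set Q : ℝ := B / j.factorial * m.real (Ioc a 1) with hQ
  have hQ0 : 0 ≤ Q := by positivity
  have inner : ∀ y ∈ Ioc r 1, ‖∫ s in Ioc y 1, f s ∂m‖ ≤ Q * (1 - y) ^ j := by
    intro y hy
    have hay : a < y := hr.1.trans hy.1
    have := norm_setIntegral_le_of_norm_le_const (μ := m) (s := Ioc y 1) (f := f)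
      (C := B * ((1 - y) ^ j / j.factorial)) (hm.measure_Ioc_lt_top (ha.trans hay) 1) (by
        intro s hs
        refine (hf s ⟨hay.trans hs.1, hs.2⟩).trans ?_
        have : 0 ≤ 1 - s := by linarith [hs.2]
        gcongr
        exact hs.1.le)
    refine this.trans ?_
    have hle : m.real (Ioc y 1) ≤ m.real (Ioc a 1) :=
      measureReal_mono (Ioc_subset_Ioc_left hay.le) (hm.measure_Ioc_lt_top ha 1).ne
    have : 0 ≤ 1 - y := by linarith [hy.2]
    calc B * ((1 - y) ^ j / j.factorial) * m.real (Ioc y 1)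
        ≤ B * ((1 - y) ^ j / j.factorial) * m.real (Ioc a 1) := by gcongr
      _ = _ := by rw [hQ]; ring
  have outer := norm_integral_le_of_norm_le (μ := n.restrict (Ioc r 1))
    (f := fun y => ∫ s in Ioc y 1, f s ∂m) (h1.const_mul Q) (by
      filter_upwards [ae_restrict_mem measurableSet_Ioc] with y hy using inner y hy)
  refine outer.trans ?_
  rw [integral_const_mul]
  calc Q * ∫ y in Ioc r 1, (1 - y) ^ j ∂n ≤ Q * (K * ((1 - r) ^ (j + 1) / (j + 1))) := by gcongr
    _ = _ := by rw [hQ, Nat.factorial_succ]; push_cast; field_simp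

/-- A sequence of functions of at most geometric growth, each of which is the twofold primitive of
the next one, vanishes. -/
theorem eq_zero_of_volterra_chain (hm : IsRadial m) (hn : IsRadial n) {a : ℝ} (ha : 0 < a)
    {d : ℕ → ℝ → ℂ} {B M : ℝ} (hB : ∀ k, ∀ r ∈ Ioc a 1, ‖d k r‖ ≤ B * M ^ k)
    (hd : ∀ k, ∀ r ∈ Ioc a 1, d k r = ∫ y in Ioc r 1, ∫ s in Ioc y 1, d (k + 1) s ∂m ∂n) :
    ∀ r ∈ Ioc a 1, d 0 r = 0 := by
  obtain ⟨K, hK, h⟩ := norm_volterra_le hm hn ha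
  intro r hr
  have hB0 : ∀ k, 0 ≤ B * M ^ k := fun k => (norm_nonneg _).trans (hB k r hr)
  -- Going `j` steps down the chain writes `d k` as a `j`-fold iterate applied to `d (k + j)`. The
  -- loss `M ^ j` is geometric and the gain is `1 / j!`.
  have key : ∀ j k, ∀ r ∈ Ioc a 1,
      ‖d k r‖ ≤ B * M ^ (k + j) * K ^ j * ((1 - r) ^ j / j.factorial) := by
    intro j
    induction j with
    | zero => intro k r hr; simpa using hB k r hr
    | succ j ih =>
      intro k r hr
      rw [hd k r hr]
      refine (h _ (B * M ^ (k + 1 + j) * K ^ j) j (mul_nonneg (hB0 _) (by positivity))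
        (ih (k + 1)) r hr).trans_eq ?_
      rw [show k + 1 + j = k + (j + 1) by ring]; ring
  have hlim : Tendsto (fun j : ℕ => B * ((M * K * (1 - r)) ^ j / j.factorial)) atTop (𝓝 0) := by
    have := (FloorSemiring.tendsto_pow_div_factorial_atTop (M * K * (1 - r))).const_mul B
    simpa using this
  have : ‖d 0 r‖ ≤ 0 := ge_of_tendsto' hlim fun j => by
    refine (key j 0 r hr).trans_eq ?_
    rw [mul_pow, mul_pow]; ring
  simpa using this

/-- The iterated twofold primitives of `1`. -/
def volterraIter (m n : Measure ℝ) : ℕ → ℝ → ℂ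
  | 0 => fun _ => 1
  -- The cutoff makes the iterate measurable on the whole line, which joint measurability of the
  -- series needs later.
  | k + 1 => (Ioc (0 : ℝ) 1).indicator
      fun r => ∫ y in Ioc r 1, ∫ s in Ioc y 1, volterraIter m n k s ∂m ∂n

theorem volterraIter_succ_apply (k : ℕ) {r : ℝ} (hr : r ∈ Ioc (0 : ℝ) 1) :
    volterraIter m n (k + 1) r = ∫ y in Ioc r 1, ∫ s in Ioc y 1, volterraIter m n k s ∂m ∂n :=
  indicator_of_mem hr _

theorem continuousOn_volterraIter (hm : IsRadial m) (hn : IsRadial n) (k : ℕ) :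
    ContinuousOn (volterraIter m n k) (Ioc 0 1) := by
  induction k with
  | zero => exact continuousOn_const
  | succ k ih =>
    have h1 : ContinuousOn (fun y => ∫ s in Ioc y 1, volterraIter m n k s ∂m) (Ioc 0 1) :=
      hm.continuousOn_primitive fun r hr => hm.integrableOn_of_continuousOn ih hr.1
    have h2 := hn.continuousOn_primitive fun r hr => hn.integrableOn_of_continuousOn h1 hr.1
    exact h2.congr fun r hr => volterraIter_succ_apply k hr

theorem measurable_volterraIter (hm : IsRadial m) (hn : IsRadial n) (k : ℕ) :
    Measurable (volterraIter m n k) := by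
  cases k with
  | zero => exact measurable_const
  | succ k =>
    have h := continuousOn_volterraIter hm hn (k + 1)
    have : volterraIter m n (k + 1) = (Ioc (0 : ℝ) 1).piecewise (volterraIter m n (k + 1)) 0 := by
      ext r
      by_cases hr : r ∈ Ioc (0 : ℝ) 1
      · simp [piecewise, hr]
      · simp only [piecewise, hr, if_false, volterraIter, Pi.zero_apply]
        exact indicator_of_notMem hr _
    rw [this]
    exact h.measurable_piecewise continuousOn_const measurableSet_Ioc

theorem norm_volterraIter_le (hm : IsRadial m) (hn : IsRadial n) {a : ℝ} (ha : 0 < a) :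
    ∃ K : ℝ, 0 ≤ K ∧ ∀ k, ∀ r ∈ Ioc a 1, ‖volterraIter m n k r‖ ≤ K ^ k / k.factorial := by
  obtain ⟨K, hK, h⟩ := norm_volterra_le hm hn ha
  refine ⟨K, hK, ?_⟩
  have key : ∀ k, ∀ r ∈ Ioc a 1,
      ‖volterraIter m n k r‖ ≤ K ^ k * ((1 - r) ^ k / k.factorial) := by
    intro k
    induction k with
    | zero => intro r hr; simp [volterraIter]
    | succ k ih =>
      intro r hr
      rw [volterraIter_succ_apply k ⟨ha.trans hr.1, hr.2⟩, pow_succ]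
      exact h _ _ k (by positivity) ih r hr
  intro k r hr
  refine (key k r hr).trans ?_
  have h1 : (1 - r) ^ k ≤ 1 := pow_le_one₀ (by linarith [hr.2]) (by linarith [ha.trans hr.1])
  rw [← mul_div_assoc]
  gcongr
  exact mul_le_of_le_one_right (by positivity) h1

/-- The solution of `d_m d_n φ = t φ` with `φ = 1` and `d_n φ = 0` at the end `1`. -/
def fundSol (m n : Measure ℝ) (t : ℝ) (r : ℝ) : ℂ := ∑' k, (t : ℂ) ^ k * volterraIter m n k r

theorem summable_pow_mul_volterraIter (hm : IsRadial m) (hn : IsRadial n) (t r : ℝ) :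
    Summable fun k => (t : ℂ) ^ k * volterraIter m n k r := by
  by_cases hr : r ∈ Ioc (0 : ℝ) 1
  · obtain ⟨K, hK, h⟩ := norm_volterraIter_le hm hn (a := r / 2) (by linarith [hr.1])
    refine Summable.of_norm_bounded (Real.summable_pow_div_factorial (|t| * K)) fun k => ?_
    rw [norm_mul, norm_pow, Complex.norm_real, Real.norm_eq_abs, mul_pow, mul_div_assoc]
    gcongr
    exact h k r ⟨by linarith [hr.1], hr.2⟩
  -- Outside `(0, 1]` the cutoff leaves only the term `k = 0`.
  · refine summable_of_ne_finset_zero (s := {0}) fun k hk => ?_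
    obtain ⟨k, rfl⟩ := Nat.exists_eq_succ_of_ne_zero (by simpa using hk)
    rw [volterraIter, indicator_of_notMem hr, mul_zero]

/-- Local boundedness jointly in the spectral parameter and the position supplies the integrability
for every exchange of integrals over `t` and `r`. -/
theorem norm_fundSol_le (hm : IsRadial m) (hn : IsRadial n) {a : ℝ} (ha : 0 < a) (R : ℝ) :
    ∃ B : ℝ, 0 ≤ B ∧ ∀ t, |t| ≤ R → ∀ r ∈ Ioc a 1, ‖fundSol m n t r‖ ≤ B := by
  obtain ⟨K, hK, h⟩ := norm_volterraIter_le hm hn ha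
  refine ⟨∑' k : ℕ, (|R| * K) ^ k / k.factorial, tsum_nonneg fun k => by positivity,
    fun t ht r hr => ?_⟩
  refine tsum_of_norm_bounded (Real.summable_pow_div_factorial (|R| * K)).hasSum fun k => ?_
  rw [norm_mul, norm_pow, Complex.norm_real, Real.norm_eq_abs, mul_pow, mul_div_assoc]
  have := ht.trans (le_abs_self R)
  gcongr
  exact h k r hr

theorem measurable_fundSol (hm : IsRadial m) (hn : IsRadial n) :
    Measurable fun p : ℝ × ℝ => fundSol m n p.1 p.2 := by
  refine measurable_of_tendsto_metrizable (f := fun N (p : ℝ × ℝ) =>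
    ∑ k ∈ Finset.range N, (p.1 : ℂ) ^ k * volterraIter m n k p.2) (fun N => ?_) ?_
  · refine Finset.measurable_sum _ fun k _ => ?_
    exact ((Complex.measurable_ofReal.comp measurable_fst).pow_const k).mul
      ((measurable_volterraIter hm hn k).comp measurable_snd)
  · refine tendsto_pi_nhds.2 fun p => ?_
    exact (summable_pow_mul_volterraIter hm hn p.1 p.2).hasSum.tendsto_sum_nat

theorem IsRadial.hasSum_integral {ν : Measure ℝ} (hν : IsRadial ν) {f : ℕ → ℝ → ℂ}
    (hf : ∀ k, ContinuousOn (f k) (Ioc 0 1)) {u : ℕ → ℝ} (hu : Summable u) {r : ℝ} (hr : 0 < r)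
    (hb : ∀ k, ∀ x ∈ Ioc r 1, ‖f k x‖ ≤ u k) :
    HasSum (fun k => ∫ x in Ioc r 1, f k x ∂ν) (∫ x in Ioc r 1, ∑' k, f k x ∂ν) := by
  refine hasSum_integral_of_summable_integral_norm
    (fun k => hν.integrableOn_of_continuousOn (hf k) hr) ?_
  have hfin := hν.measure_Ioc_lt_top hr 1
  refine Summable.of_nonneg_of_le (fun k => integral_nonneg fun x => norm_nonneg _) (fun k => ?_)
    (hu.mul_right (ν.real (Ioc r 1)))
  calc ∫ x in Ioc r 1, ‖f k x‖ ∂ν ≤ ∫ x in Ioc r 1, u k ∂ν := by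
        refine setIntegral_mono_on (hν.integrableOn_of_continuousOn (hf k) hr).norm ?_
          measurableSet_Ioc (hb k)
        exact integrableOn_const hfin.ne
    _ = _ := by rw [setIntegral_const, smul_eq_mul, mul_comm]

theorem fundSol_one (t : ℝ) : fundSol m n t 1 = 1 := by
  rw [fundSol, tsum_eq_single 0]
  · simp [volterraIter]
  · intro k hk
    obtain ⟨k, rfl⟩ := Nat.exists_eq_succ_of_ne_zero hk
    rw [volterraIter_succ_apply k (by simp)]
    simp

theorem integral_fundSol (hm : IsRadial m) (hn : IsRadial n) (t : ℝ) {y : ℝ}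
    (hy : y ∈ Ioc (0 : ℝ) 1) : HasSum (fun k => (t : ℂ) ^ k * ∫ s in Ioc y 1, volterraIter m n k s ∂m)
      (∫ s in Ioc y 1, fundSol m n t s ∂m) := by
  obtain ⟨K, hK, h⟩ := norm_volterraIter_le hm hn hy.1
  have := hm.hasSum_integral (f := fun k x => (t : ℂ) ^ k * volterraIter m n k x)
    (fun k => (continuousOn_volterraIter hm hn k).const_mul _)
    (Real.summable_pow_div_factorial (|t| * K)) hy.1 (fun k x hx => by
      rw [norm_mul, norm_pow, Complex.norm_real, Real.norm_eq_abs, mul_pow, mul_div_assoc]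
      gcongr
      exact h k x hx)
  simp only [integral_const_mul] at this
  exact this

/-- Two termwise integrations shift the power series in `t` by one index; the term `k = 0` is the
constant `1`. -/
theorem fundSol_eq (hm : IsRadial m) (hn : IsRadial n) (t : ℝ) {r : ℝ} (hr : r ∈ Ioc (0 : ℝ) 1) :
    fundSol m n t r
      = 1 + ∫ y in Ioc r 1, (∫ s in Ioc y 1, (t : ℂ) * fundSol m n t s ∂m) ∂n := by
  obtain ⟨K, hK, h⟩ := norm_volterraIter_le hm hn hr.1
  have hc : ∀ k, ContinuousOn (fun y => ∫ s in Ioc y 1, volterraIter m n k s ∂m) (Ioc 0 1) :=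
    fun k => hm.continuousOn_primitive fun r hr =>
      hm.integrableOn_of_continuousOn (continuousOn_volterraIter hm hn k) hr.1
  have := hn.hasSum_integral
    (f := fun k y => (t : ℂ) ^ (k + 1) * ∫ s in Ioc y 1, volterraIter m n k s ∂m)
    (fun k => (hc k).const_mul _)
    (((Real.summable_pow_div_factorial (|t| * K)).mul_left |t|).mul_right (m.real (Ioc r 1)))
    hr.1 (fun k y hy => by
      have h1 := norm_setIntegral_le_of_norm_le_const (μ := m) (s := Ioc y 1)
        (f := volterraIter m n k) (C := K ^ k / k.factorial)
        (hm.measure_Ioc_lt_top (hr.1.trans hy.1) 1) (fun s hs => h k s ⟨hy.1.trans hs.1, hs.2⟩)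
      have hle : m.real (Ioc y 1) ≤ m.real (Ioc r 1) :=
        measureReal_mono (Ioc_subset_Ioc_left hy.1.le) (hm.measure_Ioc_lt_top hr.1 1).ne
      rw [norm_mul, norm_pow, Complex.norm_real, Real.norm_eq_abs]
      calc |t| ^ (k + 1) * ‖∫ s in Ioc y 1, volterraIter m n k s ∂m‖
          ≤ |t| ^ (k + 1) * (K ^ k / k.factorial * m.real (Ioc r 1)) := by
            refine mul_le_mul_of_nonneg_left (h1.trans ?_) (by positivity)
            gcongr
        _ = _ := by rw [mul_pow]; ring)
  have e1 : ∀ k, ∫ y in Ioc r 1, (t : ℂ) ^ (k + 1) * ∫ s in Ioc y 1, volterraIter m n k s ∂m ∂n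
      = (t : ℂ) ^ (k + 1) * volterraIter m n (k + 1) r := by
    intro k
    rw [integral_const_mul, volterraIter_succ_apply k hr]
  have e2 : ∫ y in Ioc r 1, (∑' k, (t : ℂ) ^ (k + 1) * ∫ s in Ioc y 1, volterraIter m n k s ∂m) ∂n
      = ∫ y in Ioc r 1, (∫ s in Ioc y 1, (t : ℂ) * fundSol m n t s ∂m) ∂n := by
    refine setIntegral_congr_fun measurableSet_Ioc fun y hy => ?_
    have hy' : y ∈ Ioc (0 : ℝ) 1 := ⟨hr.1.trans hy.1, hy.2⟩
    have h3 := (integral_fundSol hm hn t hy').mul_left (t : ℂ)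
    simp only [integral_const_mul]
    rw [← h3.tsum_eq]
    simp only [pow_succ']
    congr 1; ext k; ring
  simp only [e1] at this
  rw [e2] at this
  rw [← this.tsum_eq, fundSol, (summable_pow_mul_volterraIter hm hn t r).tsum_eq_zero_add]
  simp [volterraIter]

theorem continuousOn_fundSol (hm : IsRadial m) (hn : IsRadial n) (t : ℝ) :
    ContinuousOn (fundSol m n t) (Ioc 0 1) ∧
    HasCoordDeriv n (fundSol m n t) (fun y => ∫ s in Ioc y 1, (t : ℂ) * fundSol m n t s ∂m) ∧
    HasCoordDeriv m (fun y => ∫ s in Ioc y 1, (t : ℂ) * fundSol m n t s ∂m)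
      (fun r => (t : ℂ) * fundSol m n t r) := by
  have hint : ∀ r ∈ Ioc (0 : ℝ) 1, IntegrableOn (fun s => (t : ℂ) * fundSol m n t s) (Ioc r 1) m := by
    intro r hr
    obtain ⟨B, hB, h⟩ := norm_fundSol_le hm hn hr.1 |t|
    refine IntegrableOn.of_bound (hm.measure_Ioc_lt_top hr.1 1) (Measurable.aestronglyMeasurable
      (((measurable_fundSol hm hn).comp measurable_prodMk_left).const_mul _)) (|t| * B) ?_
    filter_upwards [ae_restrict_mem measurableSet_Ioc] with x hx
    rw [norm_mul, Complex.norm_real, Real.norm_eq_abs]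
    gcongr
    exact h t le_rfl x hx
  have hc := hm.continuousOn_primitive hint
  have hd : HasCoordDeriv n (fundSol m n t)
      (fun y => ∫ s in Ioc y 1, (t : ℂ) * fundSol m n t s ∂m) := by
    intro r hr
    refine ⟨hn.integrableOn_of_continuousOn hc hr.1, ?_⟩
    rw [fundSol_one]
    exact fundSol_eq hm hn t hr
  refine ⟨hn.hasCoordDeriv_continuousOn hd, hd, fun r hr => ⟨hint r hr, ?_⟩⟩
  simp

theorem eq_fundSol (hm : IsRadial m) (hn : IsRadial n) {t : ℝ} {v w : ℝ → ℂ}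
    (hv : HasCoordDeriv n v w) (hw : HasCoordDeriv m w fun r => (t : ℂ) * v r)
    (hv1 : v 1 = 1) (hw1 : w 1 = 0) : ∀ r ∈ Ioc (0 : ℝ) 1, v r = fundSol m n t r := by
  intro r hr
  obtain ⟨hc, hd1, hd2⟩ := continuousOn_fundSol hm hn t
  have hvc := hn.hasCoordDeriv_continuousOn hv
  have ha : 0 < r / 2 := by linarith [hr.1]
  obtain ⟨B, hB⟩ := isCompact_Icc.exists_bound_of_continuousOn ((hvc.sub hc).mono
    fun x (hx : x ∈ Icc (r / 2) 1) => ⟨ha.trans_le hx.1, hx.2⟩)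
  -- If `D` is the difference of two solutions with the same initial data, then `t ^ k * D` is a
  -- chain of growth `|t| ^ k`, since the twofold primitive of `t * D` is `D`.
  have := eq_zero_of_volterra_chain hm hn ha (B := B) (M := |t|)
    (d := fun k r => (t : ℂ) ^ k * (v r - fundSol m n t r)) (fun k x hx => by
      rw [norm_mul, norm_pow, Complex.norm_real, Real.norm_eq_abs, mul_comm]
      gcongr
      exact hB x (Ioc_subset_Icc_self hx)) (fun k x hx => by
      have hx0 : x ∈ Ioc (0 : ℝ) 1 := ⟨ha.trans hx.1, hx.2⟩
      have e : v x - fundSol m n t x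
          = ∫ y in Ioc x 1, ∫ s in Ioc y 1, (t : ℂ) * (v s - fundSol m n t s) ∂m ∂n := by
        rw [(hv x hx0).2, fundSol_eq hm hn t hx0, hv1, add_sub_add_left_eq_sub,
          ← integral_sub (hv x hx0).1 (hd1 x hx0).1]
        refine setIntegral_congr_fun measurableSet_Ioc fun y hy => ?_
        have hy0 : y ∈ Ioc (0 : ℝ) 1 := ⟨hx0.1.trans hy.1, hy.2⟩
        rw [(hw y hy0).2, hw1, zero_add, ← integral_sub (hw y hy0).1 (hd2 y hy0).1]
        simp only [mul_sub]
      rw [e, ← integral_const_mul]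
      congr 1; ext y
      rw [← integral_const_mul]
      congr 1; ext s
      ring) r ⟨by linarith [hr.1], hr.2⟩
  simpa [sub_eq_zero] using this

end Volterra

end

/-! ### Integration by parts, energy identity and uniqueness of decaying solutions. -/

section

section Energy

variable {m n : Measure ℝ}

/-- Fubini on the triangle `s < t`. The diagonal contributes nothing since `m` has no atoms, which
turns the strict inequality into the half-open interval on the right. -/
theorem integral_primitive_mul_swap [SFinite m] [SFinite n] (hm : IsRadial m) {f g : ℝ → ℂ} {r : ℝ}
    (hf : IntegrableOn f (Ioc r 1) n) (hg : IntegrableOn g (Ioc r 1) m) :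
    ∫ s in Ioc r 1, (∫ t in Ioc s 1, f t ∂n) * g s ∂m
      = ∫ t in Ioc r 1, f t * ∫ s in Ioc r t, g s ∂m ∂n := by
  have := hm.noAtoms
  have hmeas : MeasurableSet {p : ℝ × ℝ | p.1 < p.2} := measurableSet_lt measurable_fst measurable_snd
  have hint : Integrable (fun p : ℝ × ℝ => {p : ℝ × ℝ | p.1 < p.2}.indicator
      (fun p => f p.2 * g p.1) p) ((m.restrict (Ioc r 1)).prod (n.restrict (Ioc r 1))) := by
    refine Integrable.indicator ?_ hmeas
    simpa only [mul_comm] using Integrable.mul_prod hg hf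
  have h := integral_integral_swap (f := fun s t => {p : ℝ × ℝ | p.1 < p.2}.indicator
      (fun p => f p.2 * g p.1) (s, t)) hint
  have e1 : ∀ s ∈ Ioc r 1, (∫ t in Ioc s 1, f t ∂n) * g s = ∫ t in Ioc r 1,
      {p : ℝ × ℝ | p.1 < p.2}.indicator (fun p => f p.2 * g p.1) (s, t) ∂n := by
    intro s hs
    have : (fun t => {p : ℝ × ℝ | p.1 < p.2}.indicator (fun p => f p.2 * g p.1) (s, t))
        = (Ioi s).indicator fun t => f t * g s := by
      ext t; by_cases h : s < t <;> simp [indicator, h]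
    rw [this, setIntegral_indicator measurableSet_Ioi, ← integral_mul_const]
    congr 2
    ext x; simp only [mem_inter_iff, mem_Ioc, mem_Ioi]
    constructor
    · intro hx; exact ⟨⟨hs.1.trans hx.1, hx.2⟩, hx.1⟩
    · intro hx; exact ⟨hx.2, hx.1.2⟩
  have e2 : ∀ t ∈ Ioc r 1, f t * ∫ s in Ioc r t, g s ∂m = ∫ s in Ioc r 1,
      {p : ℝ × ℝ | p.1 < p.2}.indicator (fun p => f p.2 * g p.1) (s, t) ∂m := by
    intro t ht
    have : (fun s => {p : ℝ × ℝ | p.1 < p.2}.indicator (fun p => f p.2 * g p.1) (s, t))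
        = (Iio t).indicator fun s => f t * g s := by
      ext s; by_cases h : s < t <;> simp [indicator, h]
    rw [this, setIntegral_indicator measurableSet_Iio, ← integral_const_mul,
      integral_Ioc_eq_integral_Ioo]
    congr 2
    ext x; simp only [mem_inter_iff, mem_Ioc, mem_Iio, mem_Ioo]
    constructor
    · intro hx; exact ⟨⟨hx.1, hx.2.le.trans ht.2⟩, hx.2⟩
    · intro hx; exact ⟨hx.1.1, hx.2⟩
  rw [setIntegral_congr_fun measurableSet_Ioc e1, setIntegral_congr_fun measurableSet_Ioc e2]
  exact h

theorem HasCoordDeriv.star {F G : ℝ → ℂ} (h : HasCoordDeriv n F G) :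
    HasCoordDeriv n (fun r => conj (F r)) (fun r => conj (G r)) := by
  intro r hr
  refine ⟨?_, ?_⟩
  · have := (h r hr).1.norm
    exact (Complex.conjLIE.toContinuousLinearEquiv : ℂ →L[ℝ] ℂ).integrable_comp (h r hr).1
  · rw [integral_conj, ← map_add, ← (h r hr).2]

/-- Integration by parts for functions differentiated with respect to different coordinates. -/
theorem HasCoordDeriv.mul_sub_mul [SFinite m] [SFinite n] (hm : IsRadial m) (hn : IsRadial n)
    {F f G g : ℝ → ℂ} (hF : HasCoordDeriv n F f) (hG : HasCoordDeriv m G g) {r : ℝ}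
    (hr : r ∈ Ioc (0 : ℝ) 1) :
    F r * G r - F 1 * G 1
      = ∫ t in Ioc r 1, f t * G t ∂n + ∫ s in Ioc r 1, F s * g s ∂m := by
  have hf := (hF r hr).1
  have hg := (hG r hr).1
  have hr0 : ∀ s ∈ Ioc r 1, s ∈ Ioc (0 : ℝ) 1 := fun s hs => ⟨hr.1.trans hs.1, hs.2⟩
  have hA : IntegrableOn (fun s => (∫ t in Ioc s 1, f t ∂n) * g s) (Ioc r 1) m := by
    have hc : ContinuousOn (fun s => ∫ t in Ioc s 1, f t ∂n) (Icc r 1) :=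
      (hn.continuousOn_primitive fun r hr => (hF r hr).1).mono fun x hx => ⟨hr.1.trans_le hx.1, hx.2⟩
    exact IntegrableOn.continuousOn_mul_of_subset hc hg isCompact_Icc measurableSet_Ioc Ioc_subset_Icc_self
  have hB : IntegrableOn (fun t => f t * (∫ s in Ioc t 1, g s ∂m)) (Ioc r 1) n := by
    have hc : ContinuousOn (fun s => ∫ t in Ioc s 1, g t ∂m) (Icc r 1) :=
      (hm.continuousOn_primitive fun r hr => (hG r hr).1).mono fun x hx => ⟨hr.1.trans_le hx.1, hx.2⟩
    exact (hf.mul_continuousOn_of_subset hc measurableSet_Ioc isCompact_Icc Ioc_subset_Icc_self)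
  have i1 : ∫ t in Ioc r 1, f t * G t ∂n
      = (∫ t in Ioc r 1, f t ∂n) * G 1 + ∫ t in Ioc r 1, f t * ∫ s in Ioc t 1, g s ∂m ∂n := by
    rw [← integral_mul_const, ← integral_add (hf.mul_const _) hB]
    refine setIntegral_congr_fun measurableSet_Ioc fun t ht => ?_
    simp only [(hG t (hr0 t ht)).2]; ring
  have i2 : ∫ s in Ioc r 1, F s * g s ∂m
      = F 1 * (∫ s in Ioc r 1, g s ∂m) + ∫ s in Ioc r 1, (∫ t in Ioc s 1, f t ∂n) * g s ∂m := by
    rw [← integral_const_mul, ← integral_add (hg.const_mul _) hA]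
    refine setIntegral_congr_fun measurableSet_Ioc fun t ht => ?_
    simp only [(hF t (hr0 t ht)).2]; ring
  -- The two triangles `s > t` and `s ≤ t` fill the square, whose integral is a product.
  have i3 : ∫ t in Ioc r 1, f t * ∫ s in Ioc t 1, g s ∂m ∂n
      + ∫ t in Ioc r 1, f t * ∫ s in Ioc r t, g s ∂m ∂n
      = (∫ t in Ioc r 1, f t ∂n) * ∫ s in Ioc r 1, g s ∂m := by
    have e : ∀ t ∈ Ioc r 1, f t * ∫ s in Ioc r t, g s ∂m
        = f t * (∫ s in Ioc r 1, g s ∂m) - f t * ∫ s in Ioc t 1, g s ∂m := by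
      intro t ht
      rw [← mul_sub]; congr 1
      rw [← Ioc_union_Ioc_eq_Ioc ht.1.le ht.2, setIntegral_union (Ioc_disjoint_Ioc_of_le le_rfl)
        measurableSet_Ioc (hg.mono_set (Ioc_subset_Ioc_right ht.2))
        (hg.mono_set (Ioc_subset_Ioc_left ht.1.le))]
      ring
    rw [setIntegral_congr_fun measurableSet_Ioc e, integral_sub (hf.mul_const _) hB,
      integral_mul_const]
    ring
  rw [i1, i2, integral_primitive_mul_swap hm hf hg, (hF r hr).2, (hG r hr).2]
  linear_combination -i3

/-- The quasiderivative of a solution which tends to zero tends to zero. -/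
theorem tendsto_quasideriv_zero (hm : IsRadial m) (hn : IsRadial n) {lam : ℂ} {v w : ℝ → ℂ}
    (hv : HasCoordDeriv n v w) (hw : HasCoordDeriv m w fun r => lam * v r)
    (h0 : Tendsto v (𝓝[>] 0) (𝓝 0)) : Tendsto w (𝓝[>] 0) (𝓝 0) := by
  obtain ⟨lo, hi, hlo, hwin⟩ := hn.window
  obtain ⟨lo', hi', hlo', hwin'⟩ := hm.window
  have hhi : 0 ≤ hi := measureReal_nonneg.trans (hwin 1 one_pos le_rfl).2
  have hhi' : 0 ≤ hi' := measureReal_nonneg.trans (hwin' 1 one_pos le_rfl).2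
  rw [Metric.tendsto_nhdsWithin_nhds] at h0 ⊢
  intro ε hε
  -- If `‖v‖ ≤ η` on `(0, r]`, the estimate below reads `‖w r‖ ≤ η * κ`; the choice `η = ε / (2 κ)`
  -- then gives `ε / 2`.
  set κ : ℝ := (2 + ‖lam‖ * hi' * hi) / lo with hκ
  have hκ0 : 0 < κ := by positivity
  obtain ⟨δ, hδ, h⟩ := h0 (ε / (2 * κ)) (by positivity)
  refine ⟨min δ 1, by positivity, fun {r} hr hrd => ?_⟩
  rw [mem_Ioi] at hr
  rw [dist_zero_right, Real.norm_eq_abs, abs_of_pos hr] at hrd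
  set η := ε / (2 * κ) with hη
  have hη0 : 0 < η := by positivity
  have hr1 : r ≤ 1 := (hrd.trans_le (min_le_right _ _)).le
  have hsm : ∀ s, 0 < s → s ≤ r → ‖v s‖ ≤ η := by
    intro s hs hsr
    have := h (x := s) hs (by
      rw [dist_zero_right, Real.norm_eq_abs, abs_of_pos hs]
      exact (hsr.trans_lt hrd).trans_le (min_le_left _ _))
    rw [dist_zero_right] at this
    exact this.le
  have hr2 : 0 < r / 2 := by positivity
  have hI := hn.measure_Ioc_lt_top hr2 r
  have diff : ∀ {ν : Measure ℝ} {F G : ℝ → ℂ}, HasCoordDeriv ν F G → ∀ s, 0 < s → s ≤ r →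
      F s - F r = ∫ t in Ioc s r, G t ∂ν := by
    intro ν F G hFG s hs hsr
    have h1 := hFG s ⟨hs, hsr.trans hr1⟩
    rw [h1.2, (hFG r ⟨hr, hr1⟩).2, ← Ioc_union_Ioc_eq_Ioc hsr hr1,
      setIntegral_union (Ioc_disjoint_Ioc_of_le le_rfl) measurableSet_Ioc
        (h1.1.mono_set (Ioc_subset_Ioc_right hr1)) (h1.1.mono_set (Ioc_subset_Ioc_left hsr))]
    ring
  have hws : ∀ s ∈ Ioc (r / 2) r, ‖w s - w r‖ ≤ ‖lam‖ * η * hi' := by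
    intro s hs
    have hs0 := hr2.trans hs.1
    rw [diff hw s hs0 hs.2]
    refine (norm_setIntegral_le_of_norm_le_const (C := ‖lam‖ * η) (hm.measure_Ioc_lt_top hs0 r)
      fun x hx => ?_).trans ?_
    · rw [norm_mul]; gcongr; exact hsm x (hs0.trans hx.1) hx.2
    · gcongr
      exact (measureReal_mono (Ioc_subset_Ioc_left hs.1.le)
        (hm.measure_Ioc_lt_top hr2 r).ne).trans (hwin' r hr hr1).2
  have e1 := diff hv (r / 2) hr2 (by linarith)
  have hwi : IntegrableOn w (Ioc (r / 2) r) n :=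
    (hv (r / 2) ⟨hr2, by linarith⟩).1.mono_set (Ioc_subset_Ioc_right hr1)
  -- Over one dyadic window the increment of `v` is `w r` times the window mass, up to the
  -- oscillation of `w`. Both the increment and the oscillation are controlled by the size of `v`.
  have e2 : (n.real (Ioc (r / 2) r) : ℂ) * w r
      = (v (r / 2) - v r) - ∫ s in Ioc (r / 2) r, (w s - w r) ∂n := by
    rw [integral_sub hwi (integrableOn_const hI.ne), e1, setIntegral_const, Complex.real_smul]
    ring
  have e3 : ‖∫ s in Ioc (r / 2) r, (w s - w r) ∂n‖ ≤ ‖lam‖ * η * hi' * hi := by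
    refine (norm_setIntegral_le_of_norm_le_const hI hws).trans ?_
    gcongr
    exact (hwin r hr hr1).2
  have e4 : lo * ‖w r‖ ≤ η * (2 + ‖lam‖ * hi' * hi) := by
    calc lo * ‖w r‖ ≤ n.real (Ioc (r / 2) r) * ‖w r‖ := by gcongr; exact (hwin r hr hr1).1
      _ = ‖(n.real (Ioc (r / 2) r) : ℂ) * w r‖ := by
          rw [norm_mul, Complex.norm_real, Real.norm_eq_abs, abs_of_nonneg measureReal_nonneg]
      _ ≤ (η + η) + ‖lam‖ * η * hi' * hi := by
          rw [e2]
          refine (norm_sub_le _ _).trans (add_le_add ((norm_sub_le _ _).trans (add_le_add ?_ ?_)) e3)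
          · exact hsm _ hr2 (by linarith)
          · exact hsm _ hr le_rfl
      _ = _ := by ring
  rw [dist_zero_right]
  have e5 : ‖w r‖ ≤ η * κ := by
    rw [hκ, ← mul_div_assoc, le_div_iff₀ hlo]; linarith
  have e6 : η * κ = ε / 2 := by rw [hη]; field_simp
  linarith

/-- For `lam` off the half line `(-∞, 0]`, a solution which tends to zero and satisfies the
homogeneous Neumann condition vanishes. -/
theorem eq_zero_of_neumann_of_tendsto [SFinite m] [SFinite n] (hm : IsRadial m) (hn : IsRadial n)
    {lam : ℂ} (hlam : lam ∈ Complex.slitPlane) {v w : ℝ → ℂ} (hv : HasCoordDeriv n v w)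
    (hw : HasCoordDeriv m w fun r => lam * v r) (h0 : Tendsto v (𝓝[>] 0) (𝓝 0)) (hw1 : w 1 = 0) :
    ∀ r ∈ Ioc (0 : ℝ) 1, v r = 0 := by
  have hw0 := tendsto_quasideriv_zero hm hn hv hw h0
  have hvc := hn.hasCoordDeriv_continuousOn hv
  set E : ℝ → ℝ := fun r => ∫ t in Ioc r 1, ‖w t‖ ^ 2 ∂n
  set Q : ℝ → ℝ := fun r => ∫ t in Ioc r 1, ‖v t‖ ^ 2 ∂m
  have hE : ∀ r, 0 ≤ E r := fun r => integral_nonneg fun t => by positivity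
  have hQ : ∀ r, 0 ≤ Q r := fun r => integral_nonneg fun t => by positivity
  have hQi : ∀ r, 0 < r → IntegrableOn (fun t => ‖v t‖ ^ 2) (Ioc r 1) m := by
    intro r hr
    have := (hm.integrableOn_of_continuousOn (f := fun t => ((‖v t‖ ^ 2 : ℝ) : ℂ))
      (Complex.continuous_ofReal.comp_continuousOn (hvc.norm.pow 2)) hr).re
    simp only [RCLike.re_to_complex, Complex.ofReal_re] at this
    exact this
  -- Integration by parts of `conj v` against `w`; the boundary term at `1` drops by the Neumann
  -- condition.
  have id : ∀ r ∈ Ioc (0 : ℝ) 1, conj (v r) * w r = E r + lam * Q r := by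
    intro r hr
    have := hv.star.mul_sub_mul hm hn hw hr
    rw [hw1, mul_zero, sub_zero] at this
    rw [this]
    congr 1
    · rw [← integral_complex_ofReal]
      congr 1; ext t
      rw [← Complex.normSq_eq_norm_sq, Complex.normSq_eq_conj_mul_self]
    · rw [← integral_complex_ofReal, ← integral_const_mul]
      congr 1; ext t
      rw [← Complex.normSq_eq_norm_sq, Complex.normSq_eq_conj_mul_self]; ring
  have hlim : Tendsto (fun r => conj (v r) * w r) (𝓝[>] 0) (𝓝 0) := by
    have := ((Complex.continuous_conj.tendsto 0).comp h0).mul hw0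
    simpa using this
  -- Off `(-∞, 0]` the real part (for `lam > 0`) or the imaginary part of the energy dominates a
  -- multiple of `Q`.
  obtain ⟨κ, hκ, hκb⟩ : ∃ κ : ℝ, 0 < κ ∧ ∀ r, κ * Q r ≤ ‖(E r + lam * Q r : ℂ)‖ := by
    by_cases him : lam.im = 0
    · have hre : 0 < lam.re := by
        rcases hlam with h | h
        · exact h
        · exact absurd him h
      refine ⟨lam.re, hre, fun r => le_trans ?_ (Complex.re_le_norm _)⟩
      simp only [Complex.add_re, Complex.ofReal_re, Complex.mul_re, Complex.ofReal_im]
      have := hE r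
      linarith
    · refine ⟨|lam.im|, abs_pos.2 him, fun r => le_trans ?_ (Complex.abs_im_le_norm _)⟩
      simp only [Complex.add_im, Complex.ofReal_im, Complex.mul_im, Complex.ofReal_re]
      rw [mul_zero, zero_add, zero_add, abs_mul, abs_of_nonneg (hQ r)]
  -- `Q` increases as `r` decreases and is nonnegative, while the bound on it tends to `0` at the
  -- far end.
  have hQ0 : ∀ r ∈ Ioc (0 : ℝ) 1, Q r = 0 := by
    intro r hr
    refine le_antisymm ?_ (hQ r)
    have : κ * Q r ≤ 0 := by
      have hl := hlim.norm
      rw [norm_zero] at hl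
      refine ge_of_tendsto hl ?_
      filter_upwards [Ioc_mem_nhdsGT hr.1] with s hs
      rw [id s ⟨hs.1, hs.2.trans hr.2⟩]
      refine le_trans ?_ (hκb s)
      refine mul_le_mul_of_nonneg_left ?_ hκ.le
      exact setIntegral_mono_set (hQi s hs.1) (ae_of_all _ fun t => by positivity)
        (Ioc_subset_Ioc_left hs.2).eventuallyLE
    by_contra hne
    push Not at hne
    nlinarith
  have hw2 : ∀ r ∈ Ioc (0 : ℝ) 1, w r = 0 := by
    intro r hr
    have h1 := (integral_eq_zero_iff_of_nonneg (fun t => by positivity) (hQi r hr.1)).1 (hQ0 r hr)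
    rw [(hw r hr).2, hw1, zero_add]
    refine integral_eq_zero_of_ae ?_
    filter_upwards [h1] with t ht
    simp only [Pi.zero_apply, pow_eq_zero_iff, ne_eq, OfNat.ofNat_ne_zero, not_false_eq_true,
      norm_eq_zero] at ht ⊢
    rw [ht, mul_zero]
  have hv2 : ∀ r ∈ Ioc (0 : ℝ) 1, v r = v 1 := by
    intro r hr
    rw [(hv r hr).2, setIntegral_eq_zero_of_forall_eq_zero, add_zero]
    intro t ht
    exact hw2 t ⟨hr.1.trans ht.1, ht.2⟩
  have : v 1 = 0 := by
    refine tendsto_nhds_unique (tendsto_const_nhds.congr' ?_) h0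
    filter_upwards [Ioc_mem_nhdsGT one_pos] with r hr using (hv2 r hr).symm
  intro r hr
  rw [hv2 r hr, this]

end Energy

end

section

/-! ### The form domain -/

section CauchySchwarz

variable {ν : Measure ℝ}

theorem norm_setIntegral_le_sqrt_mul_sqrt (f : Lp ℂ 2 ν) {s : Set ℝ} (hs : ν s ≠ ∞) :
    ‖∫ x in s, f x ∂ν‖ ≤ √(ν.real s) * √(∫ x in s, ‖f x‖ ^ 2 ∂ν) := by
  have : IsFiniteMeasure (ν.restrict s) := ⟨by
    rw [Measure.restrict_apply_univ]; exact hs.lt_top⟩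
  have h2 : ENNReal.ofReal 2 = 2 := by simp
  have h := integral_mul_norm_le_Lp_mul_Lq (μ := ν.restrict s) (f := fun _ => (1 : ℂ)) (g := f)
    (p := 2) (q := 2) Real.HolderConjugate.two_two (by rw [h2]; exact memLp_const _)
    (by rw [h2]; exact (Lp.memLp f).restrict _)
  simp only [norm_one, one_mul, integral_const, smul_eq_mul, one_pow, mul_one,
    measureReal_restrict_apply_univ, Real.rpow_ofNat, ← Real.sqrt_eq_rpow] at h
  exact (norm_integral_le_integral_norm _).trans h

theorem integrable_norm_sq (f : Lp ℂ 2 ν) : Integrable (fun x => ‖f x‖ ^ 2) ν :=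
  (memLp_two_iff_integrable_sq_norm (Lp.aestronglyMeasurable f)).1 (Lp.memLp f)

theorem integral_norm_sq (f : Lp ℂ 2 ν) : ∫ x, ‖f x‖ ^ 2 ∂ν = ‖f‖ ^ 2 := by
  have h := inner_self_eq_norm_sq_to_K (𝕜 := ℂ) f
  rw [L2.inner_def] at h
  have e : ∀ x, ⟪f x, f x⟫_ℂ = ((‖f x‖ ^ 2 : ℝ) : ℂ) := fun x => by
    rw [inner_self_eq_norm_sq_to_K]; simp
  simp only [e, integral_complex_ofReal] at h
  exact Complex.ofReal_injective (by rw [h]; simp)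

theorem setIntegral_norm_sq_le (f : Lp ℂ 2 ν) (s : Set ℝ) :
    ∫ x in s, ‖f x‖ ^ 2 ∂ν ≤ ‖f‖ ^ 2 := by
  rw [← integral_norm_sq]
  exact setIntegral_le_integral (integrable_norm_sq f) (ae_of_all _ fun x => by positivity)

theorem tendsto_setIntegral_norm_sq_zero (f : Lp ℂ 2 ν) :
    Tendsto (fun r : ℝ => ∫ x in Ioc 0 r, ‖f x‖ ^ 2 ∂ν) (𝓝[>] 0) (𝓝 0) := by
  have h := tendsto_integral_filter_of_dominated_convergence (μ := ν) (l := 𝓝[>] (0 : ℝ))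
    (F := fun r => (Ioc 0 r).indicator fun x => ‖f x‖ ^ 2) (f := fun _ => 0)
    (fun x => ‖f x‖ ^ 2) (Eventually.of_forall fun r =>
      ((integrable_norm_sq f).indicator measurableSet_Ioc).aestronglyMeasurable)
    (Eventually.of_forall fun r => ae_of_all _ fun x => by
      rw [Real.norm_eq_abs, abs_of_nonneg (indicator_nonneg (fun x _ => by positivity) x)]
      exact indicator_le_self' (fun x _ => by positivity) x)
    (integrable_norm_sq f) (ae_of_all _ fun x => by
      refine tendsto_const_nhds.congr' ?_
      rcases le_or_gt x 0 with hx | hx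
      · exact Eventually.of_forall fun r => (indicator_of_notMem (fun h => hx.not_gt h.1) _).symm
      · filter_upwards [Ioo_mem_nhdsGT hx] with r hr
        exact (indicator_of_notMem (fun h => hr.2.not_ge h.2) _).symm)
  simpa [integral_indicator measurableSet_Ioc] using h

end CauchySchwarz

variable {m n : Measure ℝ}

/-- Pairs of a square integrable function and a candidate derivative. -/
abbrev L2Pair (m n : Measure ℝ) := WithLp 2 (Lp ℂ 2 m × Lp ℂ 2 n)

theorem IsRadial.integrableOn_lp {ν : Measure ℝ} (hν : IsRadial ν) (f : Lp ℂ 2 ν) {r : ℝ}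
    (hr : 0 < r) (s : ℝ) : IntegrableOn f (Ioc r s) ν :=
  hν.integrableOn_of_memLp (by norm_num) (Lp.memLp f) hr s

/-- The pairs `(v, w)` such that `v` is locally absolutely continuous with derivative `w`. -/
def formSpace (hm : IsRadial m) (hn : IsRadial n) : Submodule ℂ (L2Pair m n) where
  carrier := {p | ∃ k : ℂ, p.fst =ᵐ[m] fun r => k + ∫ t in Ioc r 1, p.snd t ∂n}
  add_mem' := by
    rintro p q ⟨k, hk⟩ ⟨l, hl⟩
    refine ⟨k + l, ?_⟩
    filter_upwards [hk, hl, hm.ae_mem, Lp.coeFn_add p.fst q.fst] with r h1 h2 h3 h4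
    rw [WithLp.add_fst, h4, Pi.add_apply, h1, h2, WithLp.add_snd,
      integral_congr_ae (ae_restrict_of_ae (Lp.coeFn_add p.snd q.snd))]
    simp only [Pi.add_apply]
    rw [integral_add (hn.integrableOn_lp _ h3.1 1) (hn.integrableOn_lp _ h3.1 1)]
    ring
  zero_mem' := by
    refine ⟨0, ?_⟩
    filter_upwards [Lp.coeFn_zero ℂ 2 m] with r hr
    rw [WithLp.zero_fst, hr, WithLp.zero_snd,
      integral_congr_ae (ae_restrict_of_ae (Lp.coeFn_zero ℂ 2 n))]
    simp
  smul_mem' := by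
    rintro x p ⟨k, hk⟩
    refine ⟨x * k, ?_⟩
    filter_upwards [hk, Lp.coeFn_smul x p.fst] with r h1 h2
    rw [WithLp.smul_fst, h2, Pi.smul_apply, h1, WithLp.smul_snd,
      integral_congr_ae (ae_restrict_of_ae (Lp.coeFn_smul x p.snd))]
    simp only [Pi.smul_apply, smul_eq_mul]
    rw [integral_const_mul]
    ring

theorem IsRadial.setIntegral_eq_inner {ν : Measure ℝ} (hν : IsRadial ν) {r : ℝ} (hr : 0 < r)
    (f : Lp ℂ 2 ν) : ∫ t in Ioc r 1, f t ∂ν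
      = ⟪indicatorConstLp 2 measurableSet_Ioc (hν.measure_Ioc_lt_top hr 1).ne (1 : ℂ), f⟫_ℂ :=
  (L2.inner_indicatorConstLp_one _ _ f).symm

theorem IsRadial.neBot {ν : Measure ℝ} (hν : IsRadial ν) : (ae ν).NeBot :=
  ae_neBot.2 fun h => hν.pos 0 1 le_rfl one_pos le_rfl (by simp [h])

/-- Along an almost everywhere convergent subsequence the functions converge, and so do the
primitives, being inner products with indicators. The additive constants therefore converge, to a
limit that cannot depend on the point. -/
theorem isClosed_formSpace (hm : IsRadial m) (hn : IsRadial n) :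
    IsClosed (formSpace hm hn : Set (L2Pair m n)) := by
  refine IsSeqClosed.isClosed fun p q hp hpq => ?_
  choose k hk using hp
  have h1 : Tendsto (fun j => (p j).fst) atTop (𝓝 q.fst) :=
    ((WithLp.fstL 2 ℂ (Lp ℂ 2 m) (Lp ℂ 2 n)).continuous.tendsto q).comp hpq
  have h2 : Tendsto (fun j => (p j).snd) atTop (𝓝 q.snd) :=
    ((WithLp.sndL 2 ℂ (Lp ℂ 2 m) (Lp ℂ 2 n)).continuous.tendsto q).comp hpq
  obtain ⟨ns, hns, hae⟩ := (tendstoInMeasure_of_tendsto_Lp h1).exists_seq_tendsto_ae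
  have key : ∀ᵐ s ∂m, Tendsto (fun j => k (ns j)) atTop
      (𝓝 (q.fst s - ∫ t in Ioc s 1, q.snd t ∂n)) := by
    filter_upwards [hae, ae_all_iff.2 hk, hm.ae_mem] with s hs hks hs0
    have h3 : Tendsto (fun j => ∫ t in Ioc s 1, (p (ns j)).snd t ∂n) atTop
        (𝓝 (∫ t in Ioc s 1, q.snd t ∂n)) := by
      simp only [hn.setIntegral_eq_inner hs0.1]
      exact (tendsto_const_nhds (x := _)).inner (h2.comp hns.tendsto_atTop)
    refine (hs.sub h3).congr fun j => ?_
    rw [hks (ns j)]; ring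
  have := hm.neBot
  obtain ⟨s, hs⟩ := key.exists
  refine ⟨q.fst s - ∫ t in Ioc s 1, q.snd t ∂n, ?_⟩
  filter_upwards [key] with r hr
  have := tendsto_nhds_unique hr hs
  rw [← this]; ring

variable (hm : IsRadial m) (hn : IsRadial n)

instance completeSpace_formSpace : CompleteSpace (formSpace hm hn) :=
  (isClosed_formSpace hm hn).completeSpace_coe

variable {hm hn}

namespace formSpace

/-- The value at the end `1` of an element of the form domain. -/
def endValue (p : formSpace hm hn) : ℂ := p.2.choose

/-- The continuous representative of an element of the form domain. -/
def rep (p : formSpace hm hn) (r : ℝ) : ℂ := endValue p + ∫ t in Ioc r 1, p.1.snd t ∂n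

theorem fst_ae_eq_rep (p : formSpace hm hn) : p.1.fst =ᵐ[m] rep p := p.2.choose_spec

theorem hasCoordDeriv_rep (p : formSpace hm hn) : HasCoordDeriv n (rep p) p.1.snd := fun r hr =>
  ⟨hn.integrableOn_lp _ hr.1 1, by simp [rep]⟩

@[simp] theorem rep_one (p : formSpace hm hn) : rep p 1 = endValue p := by simp [rep]

/-- The chosen constant is the only possible one, because `m` is nonzero and so almost everywhere
equality can be tested at some point. -/
theorem eq_endValue (p : formSpace hm hn) {k : ℂ}
    (h : p.1.fst =ᵐ[m] fun r => k + ∫ t in Ioc r 1, p.1.snd t ∂n) : endValue p = k := by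
  have := hm.neBot
  obtain ⟨r, h1, h2⟩ := (h.and (fst_ae_eq_rep p)).exists
  rw [h1, rep] at h2
  exact (add_right_cancel h2).symm

/-- The local Sobolev inequality. -/
theorem norm_rep_le (p : formSpace hm hn) {a b : ℝ} (ha : 0 < a) (hab : a < b) (hb : b ≤ 1) :
    √(m.real (Ioc a b)) * ‖rep p b‖ ≤ √(∫ x in Ioc a b, ‖p.1.fst x‖ ^ 2 ∂m)
      + √(m.real (Ioc a b)) * (√(n.real (Ioc a b)) * √(∫ x in Ioc a b, ‖p.1.snd x‖ ^ 2 ∂n)) := by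
  have hmf := hm.measure_Ioc_lt_top ha b
  have hnf := hn.measure_Ioc_lt_top ha b
  have hpos : 0 < m.real (Ioc a b) := ENNReal.toReal_pos (hm.pos a b ha.le hab hb) hmf.ne
  have hr0 : ∀ s ∈ Ioc a b, s ∈ Ioc (0 : ℝ) 1 := fun s hs => ⟨ha.trans hs.1, hs.2.trans hb⟩
  have diff : ∀ s ∈ Ioc a b, rep p s - rep p b = ∫ t in Ioc s b, p.1.snd t ∂n := by
    intro s hs
    rw [rep, rep, ← Ioc_union_Ioc_eq_Ioc hs.2 hb,
      setIntegral_union (Ioc_disjoint_Ioc_of_le le_rfl) measurableSet_Ioc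
        (hn.integrableOn_lp _ (hr0 s hs).1 _) (hn.integrableOn_lp _ (ha.trans hab) _)]
    ring
  set D := √(n.real (Ioc a b)) * √(∫ x in Ioc a b, ‖p.1.snd x‖ ^ 2 ∂n)
  have hdiff : ∀ s ∈ Ioc a b, ‖rep p s - rep p b‖ ≤ D := by
    intro s hs
    rw [diff s hs]
    refine (norm_setIntegral_le_sqrt_mul_sqrt p.1.snd
      (hn.measure_Ioc_lt_top (hr0 s hs).1 b).ne).trans ?_
    have := Ioc_subset_Ioc_left (b := b) hs.1.le
    refine mul_le_mul (Real.sqrt_le_sqrt (measureReal_mono this hnf.ne)) (Real.sqrt_le_sqrt ?_)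
      (Real.sqrt_nonneg _) (Real.sqrt_nonneg _)
    exact setIntegral_mono_set (integrable_norm_sq _).integrableOn
      (ae_of_all _ fun t => by positivity) this.eventuallyLE
  have hfi : IntegrableOn p.1.fst (Ioc a b) m := hm.integrableOn_lp _ ha b
  have e1 : ∫ s in Ioc a b, p.1.fst s ∂m = ∫ s in Ioc a b, rep p s ∂m :=
    integral_congr_ae (ae_restrict_of_ae (fst_ae_eq_rep p))
  have hri : IntegrableOn (rep p) (Ioc a b) m :=
    hfi.congr_fun_ae (ae_restrict_of_ae (fst_ae_eq_rep p))
  -- The value at `b` is the mean over the window minus the mean deviation from `rep p b`.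
  -- Cauchy–Schwarz bounds the first by the function and the second by the derivative.
  have e2 : (m.real (Ioc a b) : ℂ) * rep p b
      = ∫ s in Ioc a b, p.1.fst s ∂m - ∫ s in Ioc a b, (rep p s - rep p b) ∂m := by
    rw [integral_sub hri (integrableOn_const hmf.ne), e1, setIntegral_const, Complex.real_smul]
    ring
  have e3 : m.real (Ioc a b) * ‖rep p b‖ ≤ √(m.real (Ioc a b))
      * √(∫ x in Ioc a b, ‖p.1.fst x‖ ^ 2 ∂m) + D * m.real (Ioc a b) := by
    calc m.real (Ioc a b) * ‖rep p b‖ = ‖(m.real (Ioc a b) : ℂ) * rep p b‖ := by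
          rw [norm_mul, Complex.norm_real, Real.norm_eq_abs, abs_of_pos hpos]
      _ ≤ _ := by
          rw [e2]
          exact (norm_sub_le _ _).trans (add_le_add (norm_setIntegral_le_sqrt_mul_sqrt _ hmf.ne)
            (norm_setIntegral_le_of_norm_le_const hmf hdiff))
  have hs : 0 < √(m.real (Ioc a b)) := Real.sqrt_pos.2 hpos
  have hss : √(m.real (Ioc a b)) * √(m.real (Ioc a b)) = m.real (Ioc a b) :=
    Real.mul_self_sqrt hpos.le
  refine le_of_mul_le_mul_left ?_ hs
  rw [← mul_assoc, hss]
  refine e3.trans_eq ?_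
  rw [mul_add, ← mul_assoc, hss]; ring

theorem norm_endValue_le (p : formSpace hm hn) {a : ℝ} (ha : 0 < a) (ha1 : a < 1) :
    √(m.real (Ioc a 1)) * ‖endValue p‖ ≤ ‖p.1.fst‖
      + √(m.real (Ioc a 1)) * (√(n.real (Ioc a 1)) * ‖p.1.snd‖) := by
  have h := norm_rep_le p ha ha1 le_rfl
  rw [rep_one] at h
  have e1 : √(∫ x in Ioc a 1, ‖p.1.fst x‖ ^ 2 ∂m) ≤ ‖p.1.fst‖ :=
    (Real.sqrt_le_sqrt (setIntegral_norm_sq_le _ _)).trans_eq (Real.sqrt_sq (norm_nonneg _))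
  have e2 : √(∫ x in Ioc a 1, ‖p.1.snd x‖ ^ 2 ∂n) ≤ ‖p.1.snd‖ :=
    (Real.sqrt_le_sqrt (setIntegral_norm_sq_le _ _)).trans_eq (Real.sqrt_sq (norm_nonneg _))
  refine h.trans (add_le_add e1 ?_)
  gcongr

/-- The local Sobolev inequality on `(r / 2, r]` has constants independent of `r` by the window
bounds, and the energy in that window tends to `0`. Thus the boundary condition at infinity need not
be imposed on the form domain. -/
theorem tendsto_rep (p : formSpace hm hn) : Tendsto (rep p) (𝓝[>] 0) (𝓝 0) := by
  obtain ⟨lo, hi, hlo, hwin⟩ := hm.window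
  obtain ⟨lo', hi', hlo', hwin'⟩ := hn.window
  have h1 := (Real.continuous_sqrt.tendsto 0).comp (tendsto_setIntegral_norm_sq_zero p.1.fst)
  have h2 := (Real.continuous_sqrt.tendsto 0).comp (tendsto_setIntegral_norm_sq_zero p.1.snd)
  rw [Real.sqrt_zero] at h1 h2
  have h3 := (h1.const_mul (√lo)⁻¹).add (h2.const_mul (√hi'))
  rw [mul_zero, mul_zero, add_zero] at h3
  refine squeeze_zero_norm' ?_ h3
  filter_upwards [Ioc_mem_nhdsGT one_pos] with r hr
  have h := norm_rep_le p (a := r / 2) (b := r) (by linarith [hr.1]) (by linarith [hr.1]) hr.2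
  have hw := hwin r hr.1 hr.2
  have hw' := hwin' r hr.1 hr.2
  have hsub : Ioc (r / 2) r ⊆ Ioc 0 r := Ioc_subset_Ioc_left (by linarith [hr.1])
  have hs : 0 < √(m.real (Ioc (r / 2) r)) := Real.sqrt_pos.2 (hlo.trans_le hw.1)
  have b1 : √(∫ x in Ioc (r / 2) r, ‖p.1.fst x‖ ^ 2 ∂m) ≤ √(∫ x in Ioc 0 r, ‖p.1.fst x‖ ^ 2 ∂m) :=
    Real.sqrt_le_sqrt (setIntegral_mono_set (integrable_norm_sq _).integrableOn
      (ae_of_all _ fun t => by positivity) hsub.eventuallyLE)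
  have b2 : √(∫ x in Ioc (r / 2) r, ‖p.1.snd x‖ ^ 2 ∂n) ≤ √(∫ x in Ioc 0 r, ‖p.1.snd x‖ ^ 2 ∂n) :=
    Real.sqrt_le_sqrt (setIntegral_mono_set (integrable_norm_sq _).integrableOn
      (ae_of_all _ fun t => by positivity) hsub.eventuallyLE)
  have h4 : ‖rep p r‖ ≤ (√(m.real (Ioc (r / 2) r)))⁻¹ * √(∫ x in Ioc (r / 2) r, ‖p.1.fst x‖ ^ 2 ∂m)
      + √(n.real (Ioc (r / 2) r)) * √(∫ x in Ioc (r / 2) r, ‖p.1.snd x‖ ^ 2 ∂n) := by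
    rw [← mul_le_mul_iff_right₀ hs]
    refine h.trans_eq ?_
    field_simp
  refine h4.trans (add_le_add ?_ ?_)
  · exact mul_le_mul (inv_anti₀ (Real.sqrt_pos.2 hlo) (Real.sqrt_le_sqrt hw.1)) b1
      (Real.sqrt_nonneg _) (by positivity)
  · exact mul_le_mul (Real.sqrt_le_sqrt hw'.2) b2 (Real.sqrt_nonneg _) (Real.sqrt_nonneg _)

variable (hm hn) in
/-- Evaluation at the end `1` as a continuous linear functional. -/
def endValueL : formSpace hm hn →L[ℂ] ℂ :=
  LinearMap.mkContinuousOfExistsBound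
    { toFun := endValue
      map_add' := fun p q => eq_endValue (p + q) (by
        filter_upwards [fst_ae_eq_rep p, fst_ae_eq_rep q, hm.ae_mem,
          Lp.coeFn_add p.1.fst q.1.fst] with r h1 h2 h3 h4
        rw [Submodule.coe_add, WithLp.add_fst, h4, Pi.add_apply, h1, h2, WithLp.add_snd,
          integral_congr_ae (ae_restrict_of_ae (Lp.coeFn_add p.1.snd q.1.snd))]
        simp only [Pi.add_apply, rep]
        rw [integral_add (hn.integrableOn_lp _ h3.1 1) (hn.integrableOn_lp _ h3.1 1)]
        ring)
      map_smul' := fun x p => eq_endValue (x • p) (by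
        filter_upwards [fst_ae_eq_rep p, Lp.coeFn_smul x p.1.fst] with r h1 h2
        rw [Submodule.coe_smul, WithLp.smul_fst, h2, Pi.smul_apply, h1, WithLp.smul_snd,
          integral_congr_ae (ae_restrict_of_ae (Lp.coeFn_smul x p.1.snd))]
        simp only [Pi.smul_apply, smul_eq_mul, rep, RingHom.id_apply]
        rw [integral_const_mul]
        ring) }
    (by
      -- Any fixed window ending at `1` would serve in the Sobolev inequality.
      set μ := √(m.real (Ioc (1 / 2) 1)) with hμ
      have hμ0 : 0 < μ := Real.sqrt_pos.2 (ENNReal.toReal_pos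
        (hm.pos _ _ (by norm_num) (by norm_num) le_rfl)
        (hm.measure_Ioc_lt_top (by norm_num) _).ne)
      refine ⟨μ⁻¹ + √(n.real (Ioc (1 / 2) 1)), fun p => ?_⟩
      have h := norm_endValue_le p (a := 1 / 2) (by norm_num) (by norm_num)
      have h1 := WithLp.norm_fst_le _ p.1
      have h2 := WithLp.norm_snd_le _ p.1
      change ‖endValue p‖ ≤ _ * ‖p.1‖
      rw [← mul_le_mul_iff_right₀ hμ0]
      refine h.trans ?_
      rw [add_mul, mul_add, mul_inv_cancel_left₀ hμ0.ne', ← hμ]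
      gcongr)

@[simp] theorem endValueL_apply (p : formSpace hm hn) : endValueL hm hn p = endValue p := rfl

end formSpace

end

section

variable {m n : Measure ℝ} (hm : IsRadial m) (hn : IsRadial n)

/-! ### The resolvent of the Neumann operator at `1` -/

/-- The inclusion of the form domain into `L²`. -/
def formIncl : formSpace hm hn →L[ℂ] Lp ℂ 2 m :=
  (WithLp.fstL 2 ℂ (Lp ℂ 2 m) (Lp ℂ 2 n)) ∘L (formSpace hm hn).subtypeL

/-- The variational solution operator: the Riesz representative of `a ↦ ⟪a, k⟫`. -/
def formSolve : Lp ℂ 2 m →L[ℂ] formSpace hm hn := ContinuousLinearMap.adjoint (formIncl hm hn)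

/-- The inverse of `1 - d_m d_n` with the Neumann condition at the end `1`. -/
def neumannResolvent : Lp ℂ 2 m →L[ℂ] Lp ℂ 2 m := formIncl hm hn ∘L formSolve hm hn

/-- The Riesz representative of the evaluation at the end `1`. -/
def endRiesz : formSpace hm hn := (InnerProductSpace.toDual ℂ _).symm (formSpace.endValueL hm hn)

/-- The solution of `d_m d_n ψ = ψ` in the form domain with `d_n ψ = -1` at the end `1`. -/
def endVec : Lp ℂ 2 m := formIncl hm hn (endRiesz hm hn)

variable {hm hn}

theorem formIncl_apply (p : formSpace hm hn) : formIncl hm hn p = p.1.fst := rfl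

theorem inner_formSolve (a : formSpace hm hn) (k : Lp ℂ 2 m) :
    ⟪a, formSolve hm hn k⟫_ℂ = ⟪a.1.fst, k⟫_ℂ := by
  rw [formSolve, ContinuousLinearMap.adjoint_inner_right, formIncl_apply]

theorem inner_endRiesz (a : formSpace hm hn) : ⟪endRiesz hm hn, a⟫_ℂ = formSpace.endValue a := by
  rw [endRiesz, InnerProductSpace.toDual_symm_apply, formSpace.endValueL_apply]

/-- The form inner product with the representer of the end evaluation collapses to the `L²` inner
product. Thus the end values of all solutions are read off from the single vector `endVec`. -/
theorem endValue_formSolve (k : Lp ℂ 2 m) :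
    formSpace.endValue (formSolve hm hn k) = ⟪endVec hm hn, k⟫_ℂ := by
  rw [← inner_endRiesz, inner_formSolve, endVec, formIncl_apply]

theorem neumannResolvent_apply (k : Lp ℂ 2 m) :
    neumannResolvent hm hn k = (formSolve hm hn k).1.fst := rfl

variable (hm hn) in
-- The resolvent is `J J*`, with `J` the inclusion of the form domain into `L²`.
theorem isPositive_neumannResolvent : (neumannResolvent hm hn).IsPositive :=
  ContinuousLinearMap.isPositive_self_comp_adjoint _

variable (hm hn) in
theorem norm_neumannResolvent_le : ‖neumannResolvent hm hn‖ ≤ 1 := by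
  have h1 : ‖formIncl hm hn‖ ≤ 1 :=
    ContinuousLinearMap.opNorm_le_bound _ zero_le_one fun p => by
      rw [one_mul]; exact WithLp.norm_fst_le _ p.1
  have h2 : ‖formSolve hm hn‖ ≤ 1 := by
    rw [formSolve, LinearIsometryEquiv.norm_map]; exact h1
  exact (ContinuousLinearMap.opNorm_comp_le _ _).trans (by
    have := norm_nonneg (formSolve hm hn)
    exact mul_le_one₀ h1 this h2)

theorem inner_Lp_eq {ν : Measure ℝ} (f g : Lp ℂ 2 ν) : ⟪f, g⟫_ℂ = ∫ x, conj (f x) * g x ∂ν := by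
  rw [L2.inner_def]
  congr 1; ext x
  rw [RCLike.inner_apply, mul_comm]

/-- The function of the form domain whose derivative is `b`, supported away from `0`. -/
theorem exists_formSpace_of_support (hm : IsRadial m) (hn : IsRadial n) {a : ℝ} (ha : 0 < a)
    (b : Lp ℂ 2 n) (hb : ∀ᵐ t ∂n, t ∉ Ioc a 1 → b t = 0) :
    ∃ A : formSpace hm hn, A.1.snd = b ∧ formSpace.endValue A = -∫ t in Ioc a 1, b t ∂n ∧
      A.1.fst =ᵐ[m] (Ioc a 1).indicator fun s => -∫ t in Ioc a s, b t ∂n := by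
  -- The constant is chosen to make `v` vanish on `(0, a]`. Only then is it square integrable, since
  -- `m` has infinite mass near `0`.
  set v : ℝ → ℂ := fun r => -(∫ t in Ioc a 1, b t ∂n) + ∫ t in Ioc r 1, b t ∂n with hv
  have hbi : ∀ r, 0 < r → ∀ s, IntegrableOn b (Ioc r s) n := fun r hr s => hn.integrableOn_lp b hr s
  have e : ∀ r ∈ Ioc (0 : ℝ) 1, v r = (Ioc a 1).indicator (fun s => -∫ t in Ioc a s, b t ∂n) r := by
    intro r hr
    by_cases har : a < r
    · rw [indicator_of_mem (show r ∈ Ioc a 1 from ⟨har, hr.2⟩), hv]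
      simp only
      rw [← Ioc_union_Ioc_eq_Ioc har.le hr.2, setIntegral_union (Ioc_disjoint_Ioc_of_le le_rfl)
        measurableSet_Ioc (hbi a ha _) (hbi r hr.1 _)]
      ring
    · rw [indicator_of_notMem (fun h => har h.1), hv]
      simp only
      rcases le_or_gt 1 a with h1 | h1
      · rw [Ioc_eq_empty (not_lt.2 h1)]
        simp only [setIntegral_empty, neg_zero, zero_add]
        refine integral_eq_zero_of_ae (ae_restrict_of_ae ?_)
        filter_upwards [hb] with t ht using ht (by simp [Ioc_eq_empty (not_lt.2 h1)])
      · rw [← Ioc_union_Ioc_eq_Ioc (not_lt.1 har) h1.le,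
          setIntegral_union (Ioc_disjoint_Ioc_of_le le_rfl)
          measurableSet_Ioc (hbi r hr.1 _) (hbi a ha _),
          integral_eq_zero_of_ae (μ := n.restrict (Ioc r a))]
        · ring
        · rw [EventuallyEq, ae_restrict_iff' measurableSet_Ioc]
          filter_upwards [hb] with t ht h using ht fun h' => h'.1.not_ge h.2
  have hc : ContinuousOn v (Ioc 0 1) :=
    (hn.continuousOn_primitive fun r hr => hbi r hr.1 1).const_add _
  have hv2 : MemLp v 2 m := by
    obtain ⟨B, hB⟩ := isCompact_Icc.exists_bound_of_continuousOn
      (hc.mono fun x (hx : x ∈ Icc a 1) => ⟨ha.trans_le hx.1, hx.2⟩)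
    have hi : IsFiniteMeasure (m.restrict (Ioc a 1)) := ⟨by
      rw [Measure.restrict_apply_univ]; exact hm.measure_Ioc_lt_top ha 1⟩
    have h1 : MemLp v 2 (m.restrict (Ioc a 1)) := by
      refine MemLp.of_bound ((hc.mono (Ioc_subset_Ioc_left ha.le)).aestronglyMeasurable
        measurableSet_Ioc) B ?_
      filter_upwards [ae_restrict_mem measurableSet_Ioc] with x hx using
        hB x (Ioc_subset_Icc_self hx)
    refine MemLp.ae_eq ?_ ((memLp_indicator_iff_restrict measurableSet_Ioc).2 h1)
    filter_upwards [hm.ae_mem] with r hr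
    by_cases h : r ∈ Ioc a 1
    · rw [indicator_of_mem h]
    · rw [indicator_of_notMem h, e r hr, indicator_of_notMem h]
  have hA : hv2.toLp v =ᵐ[m] v := hv2.coeFn_toLp
  let A : formSpace hm hn := ⟨WithLp.toLp 2 (hv2.toLp v, b), ⟨_, hA⟩⟩
  refine ⟨A, rfl, formSpace.eq_endValue A hA, ?_⟩
  filter_upwards [hA, hm.ae_mem] with r h1 h2
  rw [← e r h2, ← h1]
  rfl

/-- Regularity of variational solutions. -/
theorem snd_ae_eq_of_weak [SFinite m] [SFinite n] {p : formSpace hm hn} {k : Lp ℂ 2 m} {γ : ℂ}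
    (hp : ∀ a : formSpace hm hn,
      ⟪a, p⟫_ℂ = ⟪a.1.fst, k⟫_ℂ + conj (formSpace.endValue a) * γ) :
    p.1.snd =ᵐ[n] fun y => -γ + ∫ s in Ioc y 1, (p.1.fst - k : Lp ℂ 2 m) s ∂m := by
  set g : Lp ℂ 2 m := p.1.fst - k with hg
  set W : ℝ → ℂ := fun y => -γ + ∫ s in Ioc y 1, g s ∂m with hW
  have hgi : ∀ r, 0 < r → IntegrableOn g (Ioc r 1) m := fun r hr => hm.integrableOn_lp g hr 1
  have hWc : ContinuousOn W (Ioc 0 1) :=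
    (hm.continuousOn_primitive fun r hr => hgi r hr.1).const_add _
  have key : ∀ a : ℝ, 0 < a → ∀ᵐ t ∂n, t ∈ Ioc a 1 → p.1.snd t = W t := by
    intro a ha
    have hfin : IsFiniteMeasure (n.restrict (Ioc a 1)) := ⟨by
      rw [Measure.restrict_apply_univ]; exact hn.measure_Ioc_lt_top ha 1⟩
    obtain ⟨B, hB⟩ := isCompact_Icc.exists_bound_of_continuousOn
      (hWc.mono fun x (hx : x ∈ Icc a 1) => ⟨ha.trans_le hx.1, hx.2⟩)
    have hW2 : MemLp W 2 (n.restrict (Ioc a 1)) := by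
      refine MemLp.of_bound ((hWc.mono (Ioc_subset_Ioc_left ha.le)).aestronglyMeasurable
        measurableSet_Ioc) B ?_
      filter_upwards [ae_restrict_mem measurableSet_Ioc] with x hx using
        hB x (Ioc_subset_Icc_self hx)
    -- The test function has as derivative the defect itself, truncated to `(a, 1]`. After Fubini
    -- the weak equation says that this defect is orthogonal to itself.
    have hb2 : MemLp ((Ioc a 1).indicator fun t => p.1.snd t - W t) 2 n :=
      (memLp_indicator_iff_restrict measurableSet_Ioc).2 (((Lp.memLp p.1.snd).restrict _).sub hW2)
    set b := hb2.toLp _ with hbdef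
    have hb : b =ᵐ[n] (Ioc a 1).indicator fun t => p.1.snd t - W t := hb2.coeFn_toLp
    obtain ⟨A, hA1, hA2, hA3⟩ := exists_formSpace_of_support hm hn ha b (by
      filter_upwards [hb] with t ht h
      rw [ht, indicator_of_notMem h])
    have hbi := hn.integrableOn_lp b ha 1
    have hbc : IntegrableOn (fun t => conj (b t)) (Ioc a 1) n :=
      (Complex.conjLIE.toContinuousLinearEquiv : ℂ →L[ℝ] ℂ).integrable_comp hbi
    have h1 := hp A
    rw [Submodule.coe_inner, WithLp.prod_inner_apply, WithLp.ofLp_fst, WithLp.ofLp_snd,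
      WithLp.ofLp_fst, WithLp.ofLp_snd, hA1, hA2] at h1
    have h2 : ⟪A.1.fst, g⟫_ℂ = -∫ t in Ioc a 1, conj (b t) * ∫ s in Ioc t 1, g s ∂m ∂n := by
      rw [inner_Lp_eq]
      have h3 : ∀ᵐ s ∂m, conj (A.1.fst s) * g s = (Ioc a 1).indicator
          (fun s => -(g s * ∫ t in Ioc a s, conj (b t) ∂n)) s := by
        filter_upwards [hA3] with s hs
        rw [hs]
        by_cases h : s ∈ Ioc a 1
        · rw [indicator_of_mem h, indicator_of_mem h, map_neg, ← integral_conj]; ring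
        · rw [indicator_of_notMem h, indicator_of_notMem h, map_zero, zero_mul]
      rw [integral_congr_ae h3, integral_indicator measurableSet_Ioc, integral_neg,
        ← integral_primitive_mul_swap hn (hgi a ha) hbc]
      simp only [mul_comm]
    have h4 : ⟪b, p.1.snd⟫_ℂ = ∫ t in Ioc a 1, conj (b t) * W t ∂n := by
      have h5 : ⟪A.1.fst, g⟫_ℂ = ⟪A.1.fst, p.1.fst⟫_ℂ - ⟪A.1.fst, k⟫_ℂ := by
        rw [hg, inner_sub_right]
      have h6 : ∫ t in Ioc a 1, conj (b t) * W t ∂n = (∫ t in Ioc a 1, conj (b t) ∂n) * -γ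
          + ∫ t in Ioc a 1, conj (b t) * ∫ s in Ioc t 1, g s ∂m ∂n := by
        rw [← integral_mul_const, ← integral_add (hbc.mul_const _)]
        · simp only [hW, mul_add]
        · exact hbc.mul_continuousOn_of_subset ((hm.continuousOn_primitive fun r hr =>
            hgi r hr.1).mono fun x (hx : x ∈ Icc a 1) => ⟨ha.trans_le hx.1, hx.2⟩)
            measurableSet_Ioc isCompact_Icc Ioc_subset_Icc_self
      rw [map_neg, ← integral_conj] at h1
      rw [h6]
      linear_combination h1 + h5 - h2
    have h7 : ∫ t in Ioc a 1, conj (b t) * W t ∂n = ∫ t, conj (b t) * (Ioc a 1).indicator W t ∂n := by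
      rw [← integral_indicator measurableSet_Ioc]
      congr 1; ext t
      by_cases h : t ∈ Ioc a 1 <;> simp [h]
    have hWL : MemLp ((Ioc a 1).indicator W) 2 n :=
      (memLp_indicator_iff_restrict measurableSet_Ioc).2 hW2
    have h8 : ⟪b, b⟫_ℂ = 0 := by
      have h9 : ⟪b, hWL.toLp _⟫_ℂ = ∫ t, conj (b t) * (Ioc a 1).indicator W t ∂n := by
        rw [inner_Lp_eq]
        refine integral_congr_ae ?_
        filter_upwards [hWL.coeFn_toLp] with t ht
        rw [ht]
      have h10 : ⟪b, b⟫_ℂ = ⟪b, p.1.snd - hWL.toLp _⟫_ℂ := by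
        rw [inner_Lp_eq, inner_Lp_eq]
        refine integral_congr_ae ?_
        filter_upwards [hb, hWL.coeFn_toLp, Lp.coeFn_sub p.1.snd (hWL.toLp _)] with t h1 h2 h3
        rw [h1, h3, Pi.sub_apply, h2]
        by_cases h : t ∈ Ioc a 1 <;> simp [h]
      rw [h10, inner_sub_right, h9, h4, h7, sub_self]
    have h11 : b = 0 := inner_self_eq_zero.1 h8
    filter_upwards [hb, Lp.coeFn_zero ℂ 2 n] with t h1 h2 h3
    rw [h11, h2, indicator_of_mem h3] at h1
    exact (sub_eq_zero.1 h1.symm)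
  have := ae_all_iff.2 fun j : ℕ => key (1 / (j + 1)) (by positivity)
  filter_upwards [this, hn.ae_mem] with t h1 h2
  obtain ⟨j, hj⟩ := exists_nat_one_div_lt h2.1
  exact h1 j ⟨hj, h2.2⟩

theorem HasCoordDeriv.congr_ae {ν : Measure ℝ} {F G G' : ℝ → ℂ} (h : HasCoordDeriv ν F G)
    (hG : G =ᵐ[ν] G') : HasCoordDeriv ν F G' := fun r hr =>
  ⟨(h r hr).1.congr_fun_ae (ae_restrict_of_ae hG), by
    rw [← integral_congr_ae (ae_restrict_of_ae hG)]; exact (h r hr).2⟩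

/-- Variational solutions are classical solutions. -/
theorem hasCoordDeriv_of_weak [SFinite m] [SFinite n] {p : formSpace hm hn} {k : Lp ℂ 2 m} {γ : ℂ}
    (hp : ∀ a : formSpace hm hn,
      ⟪a, p⟫_ℂ = ⟪a.1.fst, k⟫_ℂ + conj (formSpace.endValue a) * γ) :
    HasCoordDeriv n (formSpace.rep p)
      (fun y => -γ + ∫ s in Ioc y 1, (p.1.fst - k : Lp ℂ 2 m) s ∂m) ∧
    HasCoordDeriv m (fun y => -γ + ∫ s in Ioc y 1, (p.1.fst - k : Lp ℂ 2 m) s ∂m)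
      (p.1.fst - k : Lp ℂ 2 m) :=
  ⟨(formSpace.hasCoordDeriv_rep p).congr_ae (snd_ae_eq_of_weak hp),
    hasCoordDeriv_primitive (fun _ hr => hm.integrableOn_lp _ hr.1 1) _⟩

theorem formSolve_weak (k : Lp ℂ 2 m) (a : formSpace hm hn) :
    ⟪a, formSolve hm hn k⟫_ℂ = ⟪a.1.fst, k⟫_ℂ + conj (formSpace.endValue a) * 0 := by
  rw [inner_formSolve, mul_zero, add_zero]

/-- The solution is its end value plus a twofold primitive, with no linear term because the end
derivative is zero. This formula feeds the Volterra chains. -/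
theorem rep_formSolve [SFinite m] [SFinite n] (k : Lp ℂ 2 m) {r : ℝ} (hr : r ∈ Ioc (0 : ℝ) 1) :
    formSpace.rep (formSolve hm hn k) r = ⟪endVec hm hn, k⟫_ℂ
      + ∫ y in Ioc r 1, ∫ s in Ioc y 1, (neumannResolvent hm hn k - k : Lp ℂ 2 m) s ∂m ∂n := by
  have := ((hasCoordDeriv_of_weak (formSolve_weak (hm := hm) (hn := hn) k)).1 r hr).2
  rw [this, formSpace.rep_one, endValue_formSolve]
  simp only [neg_zero, zero_add, neumannResolvent_apply]

/-- Half lines `(y, ∞)` form a generating π-system, so vanishing of the tail integrals spreads to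
all measurable sets inside `(a, 1]`. -/
theorem IsRadial.ae_eq_zero_of_integral_eq_zero {ν : Measure ℝ} (hν : IsRadial ν) (f : Lp ℂ 2 ν)
    (h : ∀ r ∈ Ioc (0 : ℝ) 1, ∫ t in Ioc r 1, f t ∂ν = 0) : f = 0 := by
  have key : ∀ a : ℝ, 0 < a → ∀ᵐ t ∂ν, t ∈ Ioc a 1 → f t = 0 := by
    intro a ha
    have hi : Integrable f (ν.restrict (Ioc a 1)) := hν.integrableOn_lp f ha 1
    have htot : ∫ t, f t ∂(ν.restrict (Ioc a 1)) = 0 := by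
      by_cases ha1 : a ≤ 1
      · exact h a ⟨ha, ha1⟩
      · rw [Ioc_eq_empty (by linarith)]; simp
    have hall : ∀ s, MeasurableSet s → ∫ t in s, f t ∂(ν.restrict (Ioc a 1)) = 0 := by
      intro s hs
      induction s, hs using MeasurableSpace.induction_on_inter (borel_eq_generateFrom_Ioi ℝ ▸
        (BorelSpace.measurable_eq (α := ℝ))) isPiSystem_Ioi with
      | empty => simp
      | basic s hs =>
        obtain ⟨y, rfl⟩ := hs
        rw [Measure.restrict_restrict measurableSet_Ioi]
        have : Ioi y ∩ Ioc a 1 = Ioc (max a y) 1 := by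
          ext x; simp only [mem_inter_iff, mem_Ioi, mem_Ioc, max_lt_iff]; tauto
        rw [this]
        by_cases h1 : max a y ≤ 1
        · exact h _ ⟨lt_max_of_lt_left ha, h1⟩
        · rw [Ioc_eq_empty (by linarith)]; simp
      | compl s hs ih =>
        have := integral_add_compl hs hi
        rw [ih, htot, zero_add] at this
        exact this
      | iUnion s hd hs ih =>
        rw [integral_iUnion hs hd hi.integrableOn]
        simp [ih]
    have := hi.ae_eq_zero_of_forall_setIntegral_eq_zero fun s hs _ => hall s hs
    exact (ae_restrict_iff' measurableSet_Ioc).1 this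
  rw [Lp.eq_zero_iff_ae_eq_zero]
  have := ae_all_iff.2 fun j : ℕ => key (1 / (j + 1)) (by positivity)
  filter_upwards [this, hν.ae_mem] with t h1 h2
  obtain ⟨j, hj⟩ := exists_nat_one_div_lt h2.1
  exact h1 j ⟨hj, h2.2⟩

/-- A disagreement at `r` would persist on an interval ending at `r`, which has positive mass.
Intervals to the left are used so that the end `r = 1` is covered. -/
theorem IsRadial.eqOn_of_ae_eq {ν : Measure ℝ} (hν : IsRadial ν) {f g : ℝ → ℂ}
    (hf : ContinuousOn f (Ioc 0 1)) (hg : ContinuousOn g (Ioc 0 1)) (h : f =ᵐ[ν] g) :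
    EqOn f g (Ioc 0 1) := by
  intro r hr
  by_contra hne
  have h4 : ∀ᶠ x in 𝓝[Ioc 0 r] r, f x - g x ≠ 0 :=
    (((hf r hr).sub (hg r hr)).eventually_ne (sub_ne_zero.2 hne)).filter_mono
      (nhdsWithin_mono _ (Ioc_subset_Ioc_right hr.2))
  rw [nhdsWithin_Ioc_eq_nhdsLE hr.1] at h4
  obtain ⟨a, ha, hsub⟩ := (mem_nhdsLE_iff_exists_Ioc_subset).1 h4
  refine hν.pos (max a 0) r (le_max_right _ _) (max_lt ha hr.1) hr.2 ?_
  refine measure_mono_null (fun x hx => ?_) (ae_iff.1 h)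
  exact fun he => hsub ⟨(le_max_left _ _).trans_lt hx.1, hx.2⟩ (sub_eq_zero.2 he)

/-- `T k = 0` makes the form norm of the solution vanish, since its square is `⟪T k, k⟫`. Regularity
then forces the primitive of `k` to be zero, so `k` is zero. -/
theorem neumannResolvent_injective [SFinite m] [SFinite n] {k : Lp ℂ 2 m}
    (hk : neumannResolvent hm hn k = 0) : k = 0 := by
  have h0 : formSolve hm hn k = 0 := by
    rw [← inner_self_eq_zero (𝕜 := ℂ), inner_formSolve, ← neumannResolvent_apply, hk,
      inner_zero_left]
  have h1 := snd_ae_eq_of_weak (formSolve_weak (hm := hm) (hn := hn) k)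
  rw [h0] at h1
  have hgi : ∀ r, 0 < r → IntegrableOn k (Ioc r 1) m := fun r hr => hm.integrableOn_lp k hr 1
  have hc := hm.continuousOn_primitive fun r hr => hgi r hr.1
  have h2 : (fun y => ∫ s in Ioc y 1, k s ∂m) =ᵐ[n] fun _ => 0 := by
    filter_upwards [h1, Lp.coeFn_zero ℂ 2 n] with y hy h0
    have e : ((0 : L2Pair m n).fst - k : Lp ℂ 2 m) = -k := by
      rw [WithLp.zero_fst, zero_sub]
    rw [Submodule.coe_zero, WithLp.zero_snd, h0, e,
      integral_congr_ae (ae_restrict_of_ae (Lp.coeFn_neg k))] at hy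
    simp only [Pi.zero_apply, Pi.neg_apply, integral_neg, neg_zero, zero_add] at hy
    exact neg_eq_zero.1 hy.symm
  exact hm.ae_eq_zero_of_integral_eq_zero k fun r hr =>
    hn.eqOn_of_ae_eq hc continuousOn_const h2 hr

end

section

/-! ### Cyclic spectral representations in the variable `t = 1 - 1 / s` -/

/-- Transport of a function of `t` to the variable `s = 1 / (1 - t)`, with a weight. -/
def pullInv (j : ℕ) (q : ℝ → ℂ) (z : ℂ) : ℂ := q (1 - 1 / z.re) / (z.re : ℂ) ^ j

/-- As `s → 0` the argument `1 - 1 / s` leaves the support of `q`, so the function is zero near `s =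
0` and the singular weight is harmless. At `s = 0` itself division by zero returns `0` because `j ≠
0`. -/
theorem continuous_pullInv {j : ℕ} (hj : j ≠ 0) {q : ℝ → ℂ} (hq : Continuous q)
    (hq' : HasCompactSupport q) : Continuous (pullInv j q) := by
  have h : Continuous fun s : ℝ => q (1 - 1 / s) / (s : ℂ) ^ j := by
    refine continuous_iff_continuousAt.2 fun s => ?_
    by_cases hs : s = 0
    · subst hs
      obtain ⟨M, hM⟩ := hq'.isBounded.exists_norm_le
      have hM0 : 0 ≤ max M 0 := le_max_right _ _
      have : (fun s : ℝ => q (1 - 1 / s) / (s : ℂ) ^ j) =ᶠ[𝓝 0] fun _ => 0 := by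
        filter_upwards [Metric.ball_mem_nhds (0 : ℝ) (ε := 1 / (max M 0 + 2)) (by positivity)]
          with s hs
        rw [Metric.mem_ball, dist_zero_right, Real.norm_eq_abs] at hs
        by_cases h0 : s = 0
        · simp [h0, hj]
        · have hq0 : q (1 - 1 / s) = 0 := by
            by_contra hne
            have h1 := hM _ (subset_tsupport _ hne)
            rw [Real.norm_eq_abs] at h1
            have h2 : max M 0 + 2 < |1 / s| := by
              rw [abs_div, abs_one, lt_div_iff₀ (abs_pos.2 h0)]
              rw [lt_div_iff₀ (by positivity)] at hs
              linarith
            have h3 : |1 / s| ≤ |1 - 1 / s| + 1 := by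
              have := abs_sub_abs_le_abs_sub (1 / s) 1
              rw [abs_one, abs_sub_comm] at this
              linarith
            have := le_max_left M 0
            linarith
          rw [hq0, zero_div]
      exact continuousAt_const.congr this.symm
    · have h1 : ContinuousAt (fun s : ℝ => q (1 - 1 / s)) s :=
        ContinuousAt.comp (g := q) hq.continuousAt
          (continuousAt_const.sub (continuousAt_const.div continuousAt_id hs))
      refine h1.div (by fun_prop) ?_
      exact pow_ne_zero _ (by exact_mod_cast hs)
  exact h.comp Complex.continuous_re

theorem pullInv_mul_id {z : ℂ} {q : ℝ → ℂ} : (z.re : ℂ) * pullInv 2 q z = pullInv 1 q z := by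
  unfold pullInv
  by_cases h : (z.re : ℂ) = 0
  · simp [h]
  · field_simp

theorem pullInv_id_mul {z : ℂ} {q : ℝ → ℂ} :
    pullInv 1 (fun t => (t : ℂ) * q t) z = pullInv 1 q z - pullInv 2 q z := by
  unfold pullInv
  by_cases h : (z.re : ℂ) = 0
  · simp [h]
  · push_cast
    field_simp

section Operator

variable {H : Type*} [NormedAddCommGroup H] [InnerProductSpace ℂ H] [CompleteSpace H]
  {T : H →L[ℂ] H}

/-- The complex functional calculus only sees real `s ∈ [0, 1]`, and for `s ≠ 0` the variable `t = 1
- 1 / s` is then nonpositive. -/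
theorem spectrum_mem_unit (hT : T.IsPositive) (hT1 : ‖T‖ ≤ 1) {z : ℂ} (hz : z ∈ spectrum ℂ T) :
    z = (z.re : ℂ) ∧ 0 ≤ z.re ∧ z.re ≤ 1 := by
  have h0 : 0 ≤ z := spectrum_nonneg_of_nonneg
    ((ContinuousLinearMap.nonneg_iff_isPositive T).2 hT) hz
  have h1 : ‖z‖ ≤ 1 := by
    refine (spectrum.norm_le_norm_mul_of_mem hz).trans ?_
    have : ‖(1 : H →L[ℂ] H)‖ ≤ 1 := ContinuousLinearMap.norm_id_le
    exact mul_le_one₀ hT1 (norm_nonneg _) this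
  refine ⟨?_, (Complex.le_def.1 h0).1, (Complex.re_le_norm z).trans h1⟩
  exact Complex.ext rfl (Complex.le_def.1 h0).2.symm

/-- The operator `q (1 - 1 / T) / T ^ j`. -/
def invCalc (T : H →L[ℂ] H) (j : ℕ) (q : ℝ → ℂ) : H →L[ℂ] H := cfc (pullInv j q) T

variable {p q : ℝ → ℂ} {j : ℕ}

theorem invCalc_add (hj : j ≠ 0) (hp : Continuous p) (hp' : HasCompactSupport p) (hq : Continuous q)
    (hq' : HasCompactSupport q) :
    invCalc T j (fun t => p t + q t) = invCalc T j p + invCalc T j q := by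
  unfold invCalc
  rw [← cfc_add _ _ _ (continuous_pullInv hj hp hp').continuousOn
    (continuous_pullInv hj hq hq').continuousOn]
  congr 1; ext z; simp only [pullInv, add_div]

theorem invCalc_smul (hj : j ≠ 0) (x : ℂ) (hq : Continuous q) (hq' : HasCompactSupport q) :
    invCalc T j (fun t => x * q t) = x • invCalc T j q := by
  unfold invCalc
  rw [← cfc_smul x _ _ (continuous_pullInv hj hq hq').continuousOn]
  congr 1; ext z; simp only [pullInv, smul_eq_mul, mul_div_assoc]

theorem invCalc_id_mul (hq : Continuous q) (hq' : HasCompactSupport q) :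
    invCalc T 1 (fun t => (t : ℂ) * q t) = invCalc T 1 q - invCalc T 2 q := by
  unfold invCalc
  rw [← cfc_sub _ _ _ (continuous_pullInv one_ne_zero hq hq').continuousOn
    (continuous_pullInv two_ne_zero hq hq').continuousOn]
  congr 1; ext z; exact pullInv_id_mul

theorem adjoint_invCalc : ContinuousLinearMap.adjoint (invCalc T j q)
    = invCalc T j (fun t => conj (q t)) := by
  rw [← ContinuousLinearMap.star_eq_adjoint]
  unfold invCalc
  rw [← cfc_star]
  congr 1; ext z
  simp [pullInv]

theorem invCalc_mul (hp : Continuous p) (hp' : HasCompactSupport p) (hq : Continuous q)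
    (hq' : HasCompactSupport q) :
    invCalc T 2 (fun t => p t * q t) = invCalc T 1 p * invCalc T 1 q := by
  unfold invCalc
  rw [← cfc_mul _ _ _ (continuous_pullInv one_ne_zero hp hp').continuousOn
    (continuous_pullInv one_ne_zero hq hq').continuousOn]
  congr 1; ext z
  simp only [pullInv, pow_one, pow_two, mul_div_mul_comm]

theorem comp_invCalc (hT : T.IsPositive) (hT1 : ‖T‖ ≤ 1) (hq : Continuous q)
    (hq' : HasCompactSupport q) : T * invCalc T 2 q = invCalc T 1 q := by
  have hn : IsStarNormal T := hT.isSelfAdjoint.isStarNormal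
  unfold invCalc
  calc T * cfc (pullInv 2 q) T = cfc (fun z : ℂ => z) T * cfc (pullInv 2 q) T := by rw [cfc_id' ℂ T]
    _ = cfc (fun z => z * pullInv 2 q z) T :=
      (cfc_mul (fun z : ℂ => z) _ _ continuousOn_id
        (continuous_pullInv two_ne_zero hq hq').continuousOn).symm
    _ = cfc (pullInv 1 q) T := by
      refine cfc_congr fun z hz => ?_
      rw [← pullInv_mul_id, ← (spectrum_mem_unit hT hT1 hz).1]

/-- On the spectrum the weight can be absorbed into the function. -/
theorem invCalc_two_weight_mul (hT : T.IsPositive) (hT1 : ‖T‖ ≤ 1) :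
    invCalc T 2 (fun t => ((1 + |t|)⁻¹ : ℝ) * q t) = invCalc T 1 q := by
  unfold invCalc
  refine cfc_congr fun z hz => ?_
  obtain ⟨-, h0, h1⟩ := spectrum_mem_unit hT hT1 hz
  rw [← pullInv_mul_id]
  simp only [pullInv]
  rcases h0.eq_or_lt with h | h
  · simp [← h]
  · have h2 : |1 - 1 / z.re| = 1 / z.re - 1 := by
      rw [abs_sub_comm, abs_of_nonneg]
      rw [sub_nonneg, le_div_iff₀ h]; linarith
    rw [h2, show (1 + (1 / z.re - 1))⁻¹ = z.re by field_simp; ring]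
    rw [mul_div_assoc]

theorem norm_invCalc_le (hT : T.IsPositive) (hT1 : ‖T‖ ≤ 1) {B : ℝ} (hB : 0 ≤ B)
    (h : ∀ s : ℝ, 0 ≤ s → s ≤ 1 → ‖pullInv j q s‖ ≤ B) : ‖invCalc T j q‖ ≤ B := by
  refine norm_cfc_le hB fun z hz => ?_
  obtain ⟨h1, h2, h3⟩ := spectrum_mem_unit hT hT1 hz
  rw [h1]
  exact h _ h2 h3

/-- A vector annihilated by all the operators `invCalc T 1 q` lies in the kernel of `T`. -/
theorem apply_eq_zero_of_invCalc (hT : T.IsPositive) (hT1 : ‖T‖ ≤ 1) {h : H}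
    (hh : ∀ q : ℝ → ℂ, Continuous q → HasCompactSupport q → invCalc T 1 q h = 0) : T h = 0 := by
  have hn : IsStarNormal T := hT.isSelfAdjoint.isStarNormal
  have key : ∀ N : ℕ, ‖T h‖ ≤ 1 / ((N : ℝ) + 1) * ‖h‖ := by
    intro N
    -- A cutoff equal to `1` for `|t| ≤ N`, that is for `s ≥ 1 / (N + 1)`. With the weight `(1 +
    -- |t|)⁻² = s²` on the spectrum, `invCalc T 1 q` becomes `s χ`, which differs from `s` by at
    -- most `1 / (N + 1)`.
    set χ : ℝ → ℝ := fun t => max 0 (min 1 (N + 1 - |t|)) with hχ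
    have hχc : Continuous χ := by fun_prop
    set q : ℝ → ℂ := fun t => (((1 + |t|)⁻¹ ^ 2 * χ t : ℝ) : ℂ) with hq
    have hqc : Continuous q := by
      refine Complex.continuous_ofReal.comp (Continuous.mul (Continuous.pow ?_ 2) hχc)
      exact Continuous.inv₀ (by fun_prop) fun t => by positivity
    have hqs : HasCompactSupport q := by
      refine HasCompactSupport.intro (isCompact_Icc (a := -((N : ℝ) + 1)) (b := N + 1))
        fun t ht => ?_
      have : (N : ℝ) + 1 < |t| := by
        by_contra hle
        exact ht (abs_le.1 (not_lt.1 hle))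
      have : χ t = 0 := by
        rw [hχ]; exact max_eq_left ((min_le_right _ _).trans (by linarith))
      simp [hq, this]
    have hd : T - invCalc T 1 q = cfc (fun z : ℂ => z - pullInv 1 q z) T := by
      rw [cfc_sub (fun z : ℂ => z) _ _ continuousOn_id
        (continuous_pullInv one_ne_zero hqc hqs).continuousOn, cfc_id' ℂ T]
      rfl
    have hle : ‖T - invCalc T 1 q‖ ≤ 1 / ((N : ℝ) + 1) := by
      rw [hd]
      refine norm_cfc_le (by positivity) fun z hz => ?_
      obtain ⟨h1, h2, h3⟩ := spectrum_mem_unit hT hT1 hz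
      rw [h1]
      generalize z.re = s at h2 h3
      rcases h2.eq_or_lt with h | h
      · subst h; simp [pullInv]; positivity
      · have h4 : |1 - 1 / s| = 1 / s - 1 := by
          rw [abs_sub_comm, abs_of_nonneg]
          rw [sub_nonneg, le_div_iff₀ h]; linarith
        have h5 : (s : ℂ) - pullInv 1 q s = ((s * (1 - χ (1 - 1 / s)) : ℝ) : ℂ) := by
          simp only [pullInv, hq, Complex.ofReal_re, h4]
          rw [show (1 + (1 / s - 1))⁻¹ = s by field_simp; ring]
          have : (s : ℂ) ≠ 0 := by exact_mod_cast h.ne'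
          push_cast
          field_simp
        rw [h5, Complex.norm_real, Real.norm_eq_abs]
        have hχ0 : 0 ≤ χ (1 - 1 / s) := le_max_left _ _
        have hχ1 : χ (1 - 1 / s) ≤ 1 := max_le zero_le_one (min_le_left _ _)
        rw [abs_of_nonneg (mul_nonneg h.le (by linarith))]
        by_cases hs : s ≤ 1 / ((N : ℝ) + 1)
        · calc s * (1 - χ (1 - 1 / s)) ≤ s * 1 := by gcongr; linarith
            _ ≤ _ := by linarith
        · have : χ (1 - 1 / s) = 1 := by
            have : 1 / s ≤ N + 1 := by
              rw [div_le_iff₀ h]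
              rw [not_le, div_lt_iff₀ (by positivity)] at hs
              linarith
            simp only [hχ, h4]
            rw [min_eq_left (by linarith), max_eq_right zero_le_one]
          rw [this, sub_self, mul_zero]; positivity
    calc ‖T h‖ = ‖(T - invCalc T 1 q) h‖ := by
          rw [sub_apply, hh q hqc hqs, sub_zero]
      _ ≤ _ := (ContinuousLinearMap.le_opNorm _ _).trans (by gcongr)
  have hl : Tendsto (fun N : ℕ => 1 / ((N : ℝ) + 1) * ‖h‖) atTop (𝓝 0) := by
    simpa using (tendsto_one_div_add_atTop_nhds_zero_nat (𝕜 := ℝ)).mul_const ‖h‖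
  exact norm_le_zero_iff.1 (ge_of_tendsto' hl key)

end Operator

end

/-! ### Uniqueness of the measure in a spectral representation. -/

section

section SpectralRep

variable {H : Type*} [NormedAddCommGroup H] [InnerProductSpace ℂ H] [CompleteSpace H]

/-- `U` is a unitary map onto `L²(μ)`, with `μ` locally finite on `(-∞, 0]`, which diagonalizes `T`
as multiplication by `1 / (1 - t)` and maps `ψ` to `1 / (1 - t)`. -/
structure IsSpectralRep (T : H →L[ℂ] H) (ψ : H) (μ : Measure ℝ) (U : H ≃ₗᵢ[ℂ] Lp ℂ 2 μ) : Prop where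
  locallyFinite : IsLocallyFiniteMeasure μ
  nonpos : μ (Ioi 0) = 0
  map_apply : ∀ h, U (T h) =ᵐ[μ] fun t => 1 / (1 - (t : ℂ)) * U h t
  map_vec : U ψ =ᵐ[μ] fun t => 1 / (1 - (t : ℂ))

theorem locallyIntegrable_lp {μ : Measure ℝ} [IsLocallyFiniteMeasure μ] (f : Lp ℂ 2 μ) :
    LocallyIntegrable f μ :=
  (Lp.memLp f).locallyIntegrable (by norm_num)

theorem ae_eq_of_integral_mul_eq {μ : Measure ℝ} {F G : ℝ → ℂ} (hF : LocallyIntegrable F μ)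
    (hG : LocallyIntegrable G μ) (h : ∀ q : ℝ → ℂ, Continuous q → HasCompactSupport q →
      ∫ t, q t * F t ∂μ = ∫ t, q t * G t ∂μ) : F =ᵐ[μ] G := by
  refine ae_eq_of_integral_contDiff_smul_eq hF hG fun g hg hg' => ?_
  simp only [Complex.real_smul]
  exact h (fun t => (g t : ℂ)) (Complex.continuous_ofReal.comp hg.continuous)
    (hg'.comp_left Complex.ofReal_zero)

theorem memLp_of_hasCompactSupport {μ : Measure ℝ} [IsLocallyFiniteMeasure μ] {q : ℝ → ℂ}
    (hq : Continuous q) (hq' : HasCompactSupport q) : MemLp q 2 μ :=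
  hq.memLp_of_hasCompactSupport hq'

omit [CompleteSpace H] in
/-- Two measures with unitary maps diagonalizing the same operator and vector coincide. -/
theorem IsSpectralRep.measure_unique {T : H →L[ℂ] H} {ψ : H} {μ₁ μ₂ : Measure ℝ}
    {U₁ : H ≃ₗᵢ[ℂ] Lp ℂ 2 μ₁} {U₂ : H ≃ₗᵢ[ℂ] Lp ℂ 2 μ₂} (h₁ : IsSpectralRep T ψ μ₁ U₁)
    (h₂ : IsSpectralRep T ψ μ₂ U₂) : μ₁ = μ₂ := by
  -- a bounded continuous injective function which equals `1 / (1 - t)` on `(-∞, 0]`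
  have hsc : Continuous fun t : ℝ => 1 + t / (1 + |t|) := by
    refine continuous_const.add (continuous_id.div (by fun_prop) fun t => by positivity)
  have hsb : ∀ t : ℝ, ‖1 + t / (1 + |t|)‖ ≤ 2 := by
    intro t
    have h1 : ‖t / (1 + |t|)‖ ≤ 1 := by
      rw [Real.norm_eq_abs, abs_div, abs_of_pos (by positivity : 0 < 1 + |t|),
        div_le_one (by positivity)]
      linarith
    refine (norm_add_le _ _).trans ?_
    rw [norm_one]; linarith
  set s : BoundedContinuousFunction ℝ ℝ := BoundedContinuousFunction.ofNormedAddCommGroup _ hsc 2 hsb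
    with hs
  have hsval : ∀ t : ℝ, t ≤ 0 → ((s t : ℝ) : ℂ) = 1 / (1 - (t : ℂ)) := by
    intro t ht
    have h1 : s t = 1 / (1 - t) := by
      change 1 + t / (1 + |t|) = _
      have : 1 - t ≠ 0 := by linarith
      rw [abs_of_nonpos ht, ← sub_eq_add_neg]
      field_simp; ring
    rw [h1]; push_cast; ring
  have hsinj : Function.Injective s := by
    intro x y hxy
    have h1 : x / (1 + |x|) = y / (1 + |y|) := add_left_cancel hxy
    rw [div_eq_div_iff (by positivity) (by positivity)] at h1
    have h2 : |x| * (1 + |y|) = |y| * (1 + |x|) := by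
      have := congrArg abs h1
      rwa [abs_mul, abs_mul, abs_of_pos (by positivity : 0 < 1 + |x|),
        abs_of_pos (by positivity : 0 < 1 + |y|)] at this
    have h3 : |x| = |y| := by linarith
    rw [h3] at h1
    exact mul_right_cancel₀ (by positivity) h1
  -- This is `|U ψ|²` on the half line, so `w μ` is finite even if `μ` is not, and its integrals are
  -- inner products `⟪ψ, R ψ⟫` that do not involve the representation.
  set w : ℝ → ℝ := fun t => ((1 + |t|)⁻¹) ^ 2 with hw
  have hwm : Measurable fun t => ENNReal.ofReal (w t) := by fun_prop
  have hw0 : ∀ t, 0 < w t := fun t => by positivity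
  -- the data attached to one representation
  have fin : ∀ (μ : Measure ℝ) (U : H ≃ₗᵢ[ℂ] Lp ℂ 2 μ), IsSpectralRep T ψ μ U →
      (∀ᵐ t ∂μ, t ≤ 0) ∧ (∀ᵐ t ∂μ, U ψ t = (((1 + |t|)⁻¹ : ℝ) : ℂ)) ∧
      IsFiniteMeasure (μ.withDensity fun t => ENNReal.ofReal (w t)) := by
    intro μ U h
    have h1 : ∀ᵐ t ∂μ, t ≤ 0 := by simpa [ae_iff] using! h.nonpos
    have h2 : ∀ᵐ t ∂μ, U ψ t = (((1 + |t|)⁻¹ : ℝ) : ℂ) := by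
      filter_upwards [h1, h.map_vec] with t ht h'
      rw [h', abs_of_nonpos ht]; push_cast; rw [one_div, sub_eq_add_neg]
    refine ⟨h1, h2, isFiniteMeasure_withDensity_ofReal ?_⟩
    refine ((integrable_norm_sq (U ψ)).congr ?_).2
    filter_upwards [h2] with t ht
    rw [ht, Complex.norm_real, Real.norm_eq_abs, abs_of_nonneg (by positivity)]
  have recover : ∀ (μ : Measure ℝ), (μ.withDensity fun t => ENNReal.ofReal (w t)).withDensity
      (fun t => ENNReal.ofReal (w t))⁻¹ = μ := fun μ =>
    withDensity_inv_same hwm (ae_of_all _ fun t => (ENNReal.ofReal_pos.2 (hw0 t)).ne')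
      (ae_of_all _ fun t => ENNReal.ofReal_ne_top)
  have moment : ∀ (μ : Measure ℝ) (U : H ≃ₗᵢ[ℂ] Lp ℂ 2 μ), IsSpectralRep T ψ μ U →
      ∀ (g : ℝ → ℝ) (R : H →L[ℂ] H), (∀ h, U (R h) =ᵐ[μ] fun t => (g t : ℂ) * U h t) →
      ((∫ t, g t ∂(μ.withDensity fun t => ENNReal.ofReal (w t)) : ℝ) : ℂ) = ⟪ψ, R ψ⟫_ℂ := by
    intro μ U h g R hR
    rw [integral_withDensity_eq_integral_toReal_smul hwm (ae_of_all _ fun t => ENNReal.ofReal_lt_top),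
      ← integral_complex_ofReal, ← U.inner_map_map, inner_Lp_eq]
    refine integral_congr_ae ?_
    filter_upwards [hR ψ, (fin μ U h).2.1] with t h1 h2
    rw [h1, h2, Complex.conj_ofReal, ENNReal.toReal_ofReal (hw0 t).le, smul_eq_mul, hw]
    push_cast; ring
  have := (fin μ₁ U₁ h₁).2.2
  have := (fin μ₂ U₂ h₂).2.2
  have key : μ₁.withDensity (fun t => ENNReal.ofReal (w t))
      = μ₂.withDensity (fun t => ENNReal.ofReal (w t)) := by
    -- The algebra generated by the injective function `s` separates points, hence determines a
    -- finite measure. Each of its elements is realized by one operator `R`, built from `T`, that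
    -- serves both representations.
    refine ext_of_forall_mem_subalgebra_integral_eq_of_polish (𝕜 := ℝ)
      (A := StarAlgebra.adjoin ℝ {s}) ?_ ?_
    · intro x y hxy
      refine ⟨s, ⟨s.toContinuousMap, ⟨s, StarAlgebra.subset_adjoin ℝ _ rfl, rfl⟩, rfl⟩, ?_⟩
      exact fun h => hxy (hsinj h)
    · intro g hg
      have hR : ∃ R : H →L[ℂ] H, (∀ h, U₁ (R h) =ᵐ[μ₁] fun t => (g t : ℂ) * U₁ h t) ∧
          ∀ h, U₂ (R h) =ᵐ[μ₂] fun t => (g t : ℂ) * U₂ h t := by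
        induction hg using StarAlgebra.adjoin_induction with
        | mem x hx =>
          rw [mem_singleton_iff] at hx
          subst hx
          refine ⟨T, fun h => ?_, fun h => ?_⟩
          · filter_upwards [h₁.map_apply h, (fin μ₁ U₁ h₁).1] with t h1 h2
            rw [h1, hsval t h2]
          · filter_upwards [h₂.map_apply h, (fin μ₂ U₂ h₂).1] with t h1 h2
            rw [h1, hsval t h2]
        | algebraMap r =>
          refine ⟨(r : ℂ) • 1, fun h => ?_, fun h => ?_⟩
          · filter_upwards [Lp.coeFn_smul (r : ℂ) (U₁ h)] with t ht
            rw [smul_apply, one_apply_eq_self, map_smul, ht]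
            rfl
          · filter_upwards [Lp.coeFn_smul (r : ℂ) (U₂ h)] with t ht
            rw [smul_apply, one_apply_eq_self, map_smul, ht]
            rfl
        | add x y hx hy ihx ihy =>
          obtain ⟨R, hR₁, hR₂⟩ := ihx
          obtain ⟨S, hS₁, hS₂⟩ := ihy
          refine ⟨R + S, fun h => ?_, fun h => ?_⟩
          · filter_upwards [hR₁ h, hS₁ h, Lp.coeFn_add (U₁ (R h)) (U₁ (S h))] with t h1 h2 h3
            rw [add_apply, map_add, h3, Pi.add_apply, h1, h2, BoundedContinuousFunction.add_apply]
            push_cast; ring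
          · filter_upwards [hR₂ h, hS₂ h, Lp.coeFn_add (U₂ (R h)) (U₂ (S h))] with t h1 h2 h3
            rw [add_apply, map_add, h3, Pi.add_apply, h1, h2, BoundedContinuousFunction.add_apply]
            push_cast; ring
        | mul x y hx hy ihx ihy =>
          obtain ⟨R, hR₁, hR₂⟩ := ihx
          obtain ⟨S, hS₁, hS₂⟩ := ihy
          refine ⟨R * S, fun h => ?_, fun h => ?_⟩
          · filter_upwards [hR₁ (S h), hS₁ h] with t h1 h2
            rw [mul_apply_eq_comp, h1, h2, BoundedContinuousFunction.mul_apply]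
            push_cast; ring
          · filter_upwards [hR₂ (S h), hS₂ h] with t h1 h2
            rw [mul_apply_eq_comp, h1, h2, BoundedContinuousFunction.mul_apply]
            push_cast; ring
        | star x hx ih =>
          have : star x = x := by ext t; simp
          rw [this]; exact ih
      obtain ⟨R, hR₁, hR₂⟩ := hR
      exact Complex.ofReal_injective ((moment μ₁ U₁ h₁ g R hR₁).trans (moment μ₂ U₂ h₂ g R hR₂).symm)
  rw [← recover μ₁, key, recover μ₂]

end SpectralRep

/-! ### Construction of the measure by the Riesz–Markov theorem, and of the unitary map. -/

section Existence

variable {H : Type*} [NormedAddCommGroup H] [InnerProductSpace ℂ H] [CompleteSpace H]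
  {T : H →L[ℂ] H} {ψ : H}

/-- The functional represented by the spectral measure. -/
def invFunctional (T : H →L[ℂ] H) (ψ : H) (q : ℝ → ℂ) : ℂ := ⟪ψ, invCalc T 2 q ψ⟫_ℂ

variable {p q : ℝ → ℂ}

/-- The weights `1 / s` on the two sides multiply to the `1 / s²` of the functional. This is what
makes `invCalc T 1 q ψ ↦ q` isometric. -/
theorem inner_invCalc (hp : Continuous p) (hp' : HasCompactSupport p)
    (hq : Continuous q) (hq' : HasCompactSupport q) :
    ⟪invCalc T 1 p ψ, invCalc T 1 q ψ⟫_ℂ = invFunctional T ψ fun t => conj (p t) * q t := by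
  rw [← ContinuousLinearMap.adjoint_inner_right, adjoint_invCalc, invFunctional,
    invCalc_mul (p := fun t => conj (p t)) (Complex.continuous_conj.comp hp)
      (hp'.comp_left (map_zero _)) hq hq']
  rfl

theorem invFunctional_conj : invFunctional T ψ (fun t => conj (q t)) = conj (invFunctional T ψ q) := by
  rw [invFunctional, ← adjoint_invCalc, ContinuousLinearMap.adjoint_inner_right, invFunctional,
    inner_conj_symm]

/-- With `g = (√g)²` the value is a squared norm. -/
theorem invFunctional_nonneg {g : ℝ → ℝ} (hg : Continuous g) (hg' : HasCompactSupport g)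
    (h0 : ∀ t, 0 ≤ g t) : 0 ≤ (invFunctional T ψ fun t => (g t : ℂ)).re := by
  have h1 : Continuous fun t => ((√(g t) : ℝ) : ℂ) :=
    Complex.continuous_ofReal.comp (Real.continuous_sqrt.comp hg)
  have h2 : HasCompactSupport fun t => ((√(g t) : ℝ) : ℂ) :=
    hg'.comp_left (g := fun x => ((√x : ℝ) : ℂ)) (by simp)
  have h3 := inner_invCalc (T := T) (ψ := ψ) h1 h2 h1 h2
  have h4 : (fun t => conj ((√(g t) : ℝ) : ℂ) * ((√(g t) : ℝ) : ℂ)) = fun t => (g t : ℂ) := by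
    ext t
    rw [Complex.conj_ofReal, ← Complex.ofReal_mul, Real.mul_self_sqrt (h0 t)]
  rw [h4] at h3
  rw [← h3]
  exact inner_self_nonneg (𝕜 := ℂ)

theorem continuous_ofReal_comp (g : C_c(ℝ, ℝ)) : Continuous fun t => (g t : ℂ) :=
  Complex.continuous_ofReal.comp g.continuous

theorem hasCompactSupport_ofReal_comp (g : C_c(ℝ, ℝ)) : HasCompactSupport fun t => (g t : ℂ) :=
  HasCompactSupport.comp_left (g := Complex.ofReal) g.hasCompactSupport Complex.ofReal_zero

/-- The positive functional on real functions. -/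
def invPositive (T : H →L[ℂ] H) (ψ : H) : C_c(ℝ, ℝ) →ₚ[ℝ] ℝ :=
  PositiveLinearMap.mk₀
    { toFun := fun g => (invFunctional T ψ fun t => (g t : ℂ)).re
      map_add' := fun f g => by
        rw [← Complex.add_re, invFunctional, invFunctional, invFunctional, ← inner_add_right,
          ← add_apply, ← invCalc_add two_ne_zero
            (continuous_ofReal_comp f) (hasCompactSupport_ofReal_comp f)
            (continuous_ofReal_comp g) (hasCompactSupport_ofReal_comp g)]
        simp
      map_smul' := fun x g => by
        have h := invCalc_smul (T := T) two_ne_zero (x : ℂ)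
          (continuous_ofReal_comp g) (hasCompactSupport_ofReal_comp g)
        simp only [invFunctional, CompactlySupportedContinuousMap.coe_smul, Pi.smul_apply,
          smul_eq_mul, Complex.ofReal_mul, RingHom.id_apply]
        rw [h, smul_apply, inner_smul_right, Complex.re_ofReal_mul] }
    fun g hg => invFunctional_nonneg g.continuous g.hasCompactSupport fun t => hg t

/-- The measure of the spectral representation. -/
def invMeasure (T : H →L[ℂ] H) (ψ : H) : Measure ℝ := RealRMK.rieszMeasure (invPositive T ψ)

instance isLocallyFiniteMeasure_invMeasure : IsLocallyFiniteMeasure (invMeasure T ψ) := by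
  unfold invMeasure; infer_instance

theorem integral_invMeasure (hq : Continuous q) (hq' : HasCompactSupport q) :
    ∫ t, q t ∂(invMeasure T ψ) = invFunctional T ψ q := by
  have real : ∀ g : ℝ → ℝ, Continuous g → HasCompactSupport g →
      ∫ t, (g t : ℂ) ∂(invMeasure T ψ) = invFunctional T ψ fun t => (g t : ℂ) := by
    intro g hg hg'
    have h := RealRMK.integral_rieszMeasure (invPositive T ψ) ⟨⟨g, hg⟩, hg'⟩
    have h1 : (invPositive T ψ) ⟨⟨g, hg⟩, hg'⟩ = (invFunctional T ψ fun t => (g t : ℂ)).re := rfl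
    have h2 : ((invFunctional T ψ fun t => (g t : ℂ)).re : ℂ) = invFunctional T ψ fun t => (g t : ℂ) := by
      rw [← Complex.conj_eq_iff_re, ← invFunctional_conj]
      simp
    rw [integral_complex_ofReal, ← h2, ← h1, ← h]
    rfl
  have hr := real (fun t => (q t).re) (Complex.continuous_re.comp hq)
    (hq'.comp_left (g := Complex.re) rfl)
  have hi := real (fun t => (q t).im) (Complex.continuous_im.comp hq)
    (hq'.comp_left (g := Complex.im) rfl)
  have hrc : Continuous fun t => ((q t).re : ℂ) := by fun_prop
  have hic : Continuous fun t => ((q t).im : ℂ) := by fun_prop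
  have hrs : HasCompactSupport fun t => ((q t).re : ℂ) :=
    hq'.comp_left (g := fun z : ℂ => (z.re : ℂ)) (by simp)
  have his : HasCompactSupport fun t => ((q t).im : ℂ) :=
    hq'.comp_left (g := fun z : ℂ => (z.im : ℂ)) (by simp)
  have e : q = fun t => ((q t).re : ℂ) + Complex.I * ((q t).im : ℂ) := by
    ext t
    rw [mul_comm]; exact (Complex.re_add_im _).symm
  have hIc : Continuous fun t => Complex.I * ((q t).im : ℂ) := continuous_const.mul hic
  have hIs : HasCompactSupport fun t => Complex.I * ((q t).im : ℂ) := his.mul_left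
  rw [e, integral_add (hrc.integrable_of_hasCompactSupport hrs)
    (hIc.integrable_of_hasCompactSupport hIs), integral_const_mul, hr, hi]
  simp only [invFunctional]
  rw [invCalc_add two_ne_zero hrc hrs hIc hIs, invCalc_smul two_ne_zero _ hic his]
  simp only [add_apply, smul_apply, inner_add_right,
    inner_smul_right]

/-- On the spectrum `1 - 1 / s ≤ 0`, so a function supported in `t ≥ 0` and vanishing at `0` gives
the zero operator. A tent positive on `(0, N)` therefore has integral zero. -/
theorem invMeasure_Ioi (hT : T.IsPositive) (hT1 : ‖T‖ ≤ 1) : invMeasure T ψ (Ioi 0) = 0 := by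
  have key : ∀ N : ℕ, invMeasure T ψ (Ioo 0 (N : ℝ)) = 0 := by
    intro N
    set g : ℝ → ℝ := fun t => max 0 (min t (N - t)) with hg
    have hgc : Continuous g := by fun_prop
    have hgs : HasCompactSupport g := by
      refine HasCompactSupport.intro (isCompact_Icc (a := (0 : ℝ)) (b := N)) fun t ht => ?_
      rw [hg]
      refine max_eq_left ?_
      by_cases h0 : 0 ≤ t
      · have : (N : ℝ) < t := by
          by_contra hle
          exact ht ⟨h0, not_lt.1 hle⟩
        exact (min_le_right _ _).trans (by linarith)
      · exact (min_le_left _ _).trans (by linarith)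
    have h1 := integral_invMeasure (T := T) (ψ := ψ) (q := fun t => (g t : ℂ))
      (Complex.continuous_ofReal.comp hgc)
      (HasCompactSupport.comp_left (g := Complex.ofReal) hgs Complex.ofReal_zero)
    have h2 : invCalc T 2 (fun t => (g t : ℂ)) = 0 := by
      rw [← norm_le_zero_iff]
      refine norm_invCalc_le hT hT1 le_rfl fun s h0 h1 => ?_
      simp only [pullInv, Complex.ofReal_re]
      rcases h0.eq_or_lt with h | h
      · simp [← h]
      · have : g (1 - 1 / s) = 0 := by
          refine max_eq_left ((min_le_left _ _).trans ?_)
          rw [sub_nonpos, le_div_iff₀ h]; linarith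
        rw [this]; simp
    rw [invFunctional, h2, zero_apply, inner_zero_right,
      integral_complex_ofReal, Complex.ofReal_eq_zero,
      integral_eq_zero_iff_of_nonneg (f := g) (fun t => le_max_left _ _)
        (hgc.integrable_of_hasCompactSupport hgs)] at h1
    refine measure_mono_null (fun t ht => ?_) (ae_iff.1 h1)
    have : 0 < g t := lt_max_of_lt_right (lt_min ht.1 (by linarith [ht.2]))
    exact this.ne'
  have : Ioi (0 : ℝ) ⊆ ⋃ N : ℕ, Ioo 0 (N : ℝ) := fun t ht => by
    obtain ⟨N, hN⟩ := exists_nat_gt t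
    exact mem_iUnion.2 ⟨N, ht, hN⟩
  exact measure_mono_null this (measure_iUnion_null key)

/-- The vectors `invCalc T 1 q ψ`, depending linearly on `q`. -/
def invVec (T : H →L[ℂ] H) (ψ : H) : C_c(ℝ, ℂ) →ₗ[ℂ] H where
  toFun q := invCalc T 1 q ψ
  map_add' p q := by
    rw [← add_apply, ← invCalc_add (p := p) (q := q) one_ne_zero p.continuous
      p.hasCompactSupport q.continuous q.hasCompactSupport]
    rfl
  map_smul' x q := by
    rw [RingHom.id_apply, ← smul_apply,
      ← invCalc_smul (q := q) one_ne_zero x q.continuous q.hasCompactSupport]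
    rfl

/-- Compactly supported continuous functions as elements of `L²`. -/
def compactToLp (μ : Measure ℝ) [IsLocallyFiniteMeasure μ] : C_c(ℝ, ℂ) →ₗ[ℂ] Lp ℂ 2 μ where
  toFun q := (memLp_of_hasCompactSupport (μ := μ) q.continuous q.hasCompactSupport).toLp q
  map_add' p q := MemLp.toLp_add (memLp_of_hasCompactSupport p.continuous p.hasCompactSupport)
    (memLp_of_hasCompactSupport q.continuous q.hasCompactSupport)
  map_smul' x q := MemLp.toLp_const_smul x
    (memLp_of_hasCompactSupport q.continuous q.hasCompactSupport)

theorem compactToLp_ae (μ : Measure ℝ) [IsLocallyFiniteMeasure μ] (q : C_c(ℝ, ℂ)) :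
    compactToLp μ q =ᵐ[μ] q :=
  (memLp_of_hasCompactSupport (μ := μ) q.continuous q.hasCompactSupport).coeFn_toLp

theorem inner_compactToLp {μ : Measure ℝ} [IsLocallyFiniteMeasure μ] (q : C_c(ℝ, ℂ)) (f : Lp ℂ 2 μ) :
    ⟪compactToLp μ q, f⟫_ℂ = ∫ t, conj (q t) * f t ∂μ := by
  rw [inner_Lp_eq]
  refine integral_congr_ae ?_
  filter_upwards [compactToLp_ae μ q] with t ht
  rw [ht]

theorem denseRange_compactToLp (μ : Measure ℝ) [IsLocallyFiniteMeasure μ] :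
    DenseRange (compactToLp μ) := by
  have h : (LinearMap.range (compactToLp μ)).topologicalClosure = ⊤ := by
    rw [Submodule.topologicalClosure_eq_top_iff, Submodule.eq_bot_iff]
    intro f hf
    rw [Lp.eq_zero_iff_ae_eq_zero]
    refine ae_eq_of_integral_mul_eq (locallyIntegrable_lp f) (locallyIntegrable_const 0)
      fun q hq hq' => ?_
    have := (Submodule.mem_orthogonal _ _).1 hf _ (LinearMap.mem_range_self (compactToLp μ)
      ⟨⟨fun t => conj (q t), Complex.continuous_conj.comp hq⟩, hq'.comp_left (map_zero _)⟩)
    rw [inner_compactToLp] at this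
    simpa using this
  rw [← Submodule.dense_iff_topologicalClosure_eq_top] at h
  exact h

/-- The cyclic spectral theorem in the variable `t = 1 - 1 / s`. -/
theorem exists_isSpectralRep (hT : T.IsPositive) (hT1 : ‖T‖ ≤ 1)
    (hcyc : ∀ h : H, (∀ q : ℝ → ℂ, Continuous q → HasCompactSupport q →
      ⟪invCalc T 1 q ψ, h⟫_ℂ = 0) → h = 0) :
    ∃ (μ : Measure ℝ) (U : H ≃ₗᵢ[ℂ] Lp ℂ 2 μ), IsSpectralRep T ψ μ U := by
  set μ := invMeasure T ψ with hμ
  have hd1 : DenseRange (invVec T ψ) := by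
    have h : (LinearMap.range (invVec T ψ)).topologicalClosure = ⊤ := by
      rw [Submodule.topologicalClosure_eq_top_iff, Submodule.eq_bot_iff]
      intro f hf
      refine hcyc f fun q hq hq' => ?_
      exact (Submodule.mem_orthogonal _ _).1 hf _
        (LinearMap.mem_range_self (invVec T ψ) ⟨⟨q, hq⟩, hq'⟩)
    rw [← Submodule.dense_iff_topologicalClosure_eq_top] at h
    exact h
  have hinner : ∀ p q : C_c(ℝ, ℂ), ⟪invVec T ψ p, invVec T ψ q⟫_ℂ
      = ⟪compactToLp μ p, compactToLp μ q⟫_ℂ := by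
    intro p q
    have h1 := inner_invCalc (T := T) (ψ := ψ) (p := p) (q := q) p.continuous p.hasCompactSupport
      q.continuous q.hasCompactSupport
    rw [← integral_invMeasure (q := fun t => conj (p t) * q t)
      ((Complex.continuous_conj.comp p.continuous).mul q.continuous)
      q.hasCompactSupport.mul_left] at h1
    rw [inner_compactToLp]
    refine h1.trans (integral_congr_ae ?_)
    filter_upwards [compactToLp_ae μ q] with t ht
    rw [ht]
  have hnorm : ∀ q, ‖compactToLp μ (LinearEquiv.refl ℂ _ q)‖ = ‖invVec T ψ q‖ := by
    intro q
    rw [LinearEquiv.refl_apply, norm_eq_sqrt_re_inner (𝕜 := ℂ), norm_eq_sqrt_re_inner (𝕜 := ℂ),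
      hinner]
  -- Compactly supported functions map densely both to `H`, by cyclicity, and to `L²(μ)`, with equal
  -- norms; `U` extends the resulting correspondence.
  set U := (LinearEquiv.refl ℂ C_c(ℝ, ℂ)).extendOfIsometry (invVec T ψ) (compactToLp μ) hd1
    (denseRange_compactToLp μ) hnorm with hU
  have hUq : ∀ q, U (invVec T ψ q) = compactToLp μ q := fun q =>
    LinearEquiv.extendOfIsometry_eq _ _ _ hd1 (denseRange_compactToLp μ) hnorm q
  have hle : ∀ᵐ t ∂μ, t ≤ 0 := by
    simpa [ae_iff] using! (invMeasure_Ioi hT hT1 : μ (Ioi 0) = 0)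
  have hw : Continuous fun t : ℝ => (((1 + |t|)⁻¹ : ℝ) : ℂ) :=
    Complex.continuous_ofReal.comp (Continuous.inv₀ (by fun_prop) fun t => by positivity)
  have hwt : ∀ t : ℝ, t ≤ 0 → (((1 + |t|)⁻¹ : ℝ) : ℂ) = 1 / (1 - (t : ℂ)) := by
    intro t ht
    rw [abs_of_nonpos ht]; push_cast; rw [one_div, sub_eq_add_neg]
  -- Unitarity turns integrals of `U h` against test functions into inner products in `H`. Both
  -- remaining identities are checked in this form.
  have hUin : ∀ (q : ℝ → ℂ) (hq : Continuous q) (hq' : HasCompactSupport q) (h : H),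
      ∫ t, q t * U h t ∂μ = ⟪invCalc T 1 (fun t => conj (q t)) ψ, h⟫_ℂ := by
    intro q hq hq' h
    set Q : C_c(ℝ, ℂ) := ⟨⟨fun t => conj (q t), Complex.continuous_conj.comp hq⟩,
      hq'.comp_left (map_zero _)⟩ with hQ
    have h1 : ⟪invVec T ψ Q, h⟫_ℂ = ⟪compactToLp μ Q, U h⟫_ℂ := by
      rw [← hUq, LinearIsometryEquiv.inner_map_map]
    rw [inner_compactToLp] at h1
    refine Eq.trans ?_ h1.symm
    congr 1; ext t
    simp [hQ]
  refine ⟨μ, U, inferInstance, invMeasure_Ioi hT hT1, fun h => ?_, ?_⟩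
  · have h1 : U (T h) =ᵐ[μ] fun t => (((1 + |t|)⁻¹ : ℝ) : ℂ) * U h t := by
      refine ae_eq_of_integral_mul_eq (locallyIntegrable_lp _) ?_ fun q hq hq' => ?_
      · refine MemLp.locallyIntegrable (p := 2) (MemLp.of_le (Lp.memLp (U h))
          (hw.aestronglyMeasurable.mul (Lp.aestronglyMeasurable _)) (ae_of_all _ fun t => ?_))
          (by norm_num)
        rw [norm_mul, Complex.norm_real, Real.norm_eq_abs, abs_of_nonneg (by positivity)]
        refine mul_le_of_le_one_left (norm_nonneg _) (inv_le_one_of_one_le₀ ?_)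
        linarith [abs_nonneg t]
      · have h2 := hUin q hq hq' (T h)
        have h3 := hUin (fun t => (((1 + |t|)⁻¹ : ℝ) : ℂ) * q t) (hw.mul hq) hq'.mul_left h
        have hqc := Complex.continuous_conj.comp hq
        have hqs : HasCompactSupport fun t => conj (q t) := hq'.comp_left (map_zero _)
        have h4 : T * invCalc T 1 (fun t => conj (q t))
            = invCalc T 1 (fun t => conj ((((1 + |t|)⁻¹ : ℝ) : ℂ) * q t)) := by
          simp only [map_mul, Complex.conj_ofReal]
          rw [← invCalc_two_weight_mul hT hT1, comp_invCalc (q := fun t => (((1 + |t|)⁻¹ : ℝ) : ℂ) * conj (q t))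
            hT hT1 (hw.mul hqc) hqs.mul_left]
        rw [h2, ← ContinuousLinearMap.adjoint_inner_left, hT.isSelfAdjoint.adjoint_eq]
        rw [← h4] at h3
        refine h3.symm.trans ?_
        congr 1; ext t; ring
    filter_upwards [h1, hle] with t ht h0
    rw [ht, hwt t h0]
  · have h1 : U ψ =ᵐ[μ] fun t => (((1 + |t|)⁻¹ : ℝ) : ℂ) := by
      refine ae_eq_of_integral_mul_eq (locallyIntegrable_lp _) hw.locallyIntegrable
        fun q hq hq' => ?_
      rw [hUin q hq hq' ψ, ← invCalc_two_weight_mul hT hT1, ← inner_conj_symm]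
      change conj (invFunctional T ψ _) = _
      rw [← invFunctional_conj, ← integral_invMeasure]
      · refine integral_congr_ae (ae_of_all _ fun t => ?_)
        simp; ring
      · simp only [map_mul, Complex.conj_ofReal, Complex.conj_conj]; exact hw.mul hq
      · simp only [map_mul, Complex.conj_ofReal, Complex.conj_conj]; exact hq'.mul_left
    filter_upwards [h1, hle] with t ht h0
    rw [ht, hwt t h0]

end Existence

end

section

variable {m n : Measure ℝ} {hm : IsRadial m} {hn : IsRadial n}

/-! ### Cyclicity of the end vector -/

theorem norm_formSolve_le (k : Lp ℂ 2 m) : ‖formSolve hm hn k‖ ≤ ‖k‖ := by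
  have h1 : ‖formIncl hm hn‖ ≤ 1 :=
    ContinuousLinearMap.opNorm_le_bound _ zero_le_one fun p => by
      rw [one_mul]; exact WithLp.norm_fst_le _ p.1
  refine (formSolve hm hn).le_of_opNorm_le (c := 1) ?_ k |>.trans_eq (one_mul _)
  rw [formSolve, LinearIsometryEquiv.norm_map]; exact h1

theorem exists_norm_rep_le (hm : IsRadial m) (hn : IsRadial n) {a : ℝ} (ha : 0 < a) :
    ∃ C : ℝ, 0 ≤ C ∧
    ∀ p : formSpace hm hn, ∀ r ∈ Ioc a 1, ‖formSpace.rep p r‖ ≤ C * ‖p‖ := by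
  refine ⟨‖formSpace.endValueL hm hn‖ + √(n.real (Ioc a 1)), by positivity, fun p r hr => ?_⟩
  have h1 : ‖formSpace.endValue p‖ ≤ ‖formSpace.endValueL hm hn‖ * ‖p‖ := by
    rw [← formSpace.endValueL_apply]; exact ContinuousLinearMap.le_opNorm _ _
  have hra : 0 < r := ha.trans hr.1
  have h2 := norm_setIntegral_le_sqrt_mul_sqrt p.1.snd (hn.measure_Ioc_lt_top hra 1).ne
  have h3 : √(n.real (Ioc r 1)) ≤ √(n.real (Ioc a 1)) :=
    Real.sqrt_le_sqrt (measureReal_mono (Ioc_subset_Ioc_left hr.1.le)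
      (hn.measure_Ioc_lt_top ha 1).ne)
  have h4 : √(∫ x in Ioc r 1, ‖p.1.snd x‖ ^ 2 ∂n) ≤ ‖p‖ :=
    (Real.sqrt_le_left (norm_nonneg _)).2 ((setIntegral_norm_sq_le _ _).trans
      (pow_le_pow_left₀ (norm_nonneg _) (WithLp.norm_snd_le _ p.1) 2))
  refine (norm_add_le _ _).trans ?_
  rw [add_mul]
  exact add_le_add h1 (h2.trans (mul_le_mul h3 h4 (Real.sqrt_nonneg _) (Real.sqrt_nonneg _)))

/-- The solutions with data `x k` and the functions `u k` obey the same recursion with the same end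
values, so their differences form a Volterra chain. Taking `u = 0` gives cyclicity; taking `u` to be
inverse transforms identifies the unitary map. -/
theorem rep_formSolve_eq_of_chain [SFinite m] [SFinite n] {x : ℕ → Lp ℂ 2 m} {u : ℕ → ℝ → ℂ}
    {B M : ℝ} (hx : ∀ k, neumannResolvent hm hn (x k) - x k = neumannResolvent hm hn (x (k + 1)))
    (hxB : ∀ k, ‖x k‖ ≤ B * M ^ k)
    (hui : ∀ k r, 0 < r → IntegrableOn (u k) (Ioc r 1) m)
    (hu : ∀ k, ∀ r ∈ Ioc (0 : ℝ) 1, u k r = ⟪endVec hm hn, x k⟫_ℂ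
      + ∫ y in Ioc r 1, ∫ s in Ioc y 1, u (k + 1) s ∂m ∂n)
    (huB : ∀ a, 0 < a → ∃ B', ∀ k, ∀ r ∈ Ioc a 1, ‖u k r‖ ≤ B' * M ^ k) {r : ℝ}
    (hr : r ∈ Ioc (0 : ℝ) 1) : formSpace.rep (formSolve hm hn (x 0)) r = u 0 r := by
  obtain ⟨a, ha, har⟩ := exists_between hr.1
  obtain ⟨C, hC, hCb⟩ := exists_norm_rep_le hm hn ha
  obtain ⟨B', hB'⟩ := huB a ha
  have hci : ∀ k r, 0 < r → IntegrableOn (neumannResolvent hm hn (x k)) (Ioc r 1) m :=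
    fun k r hr => hm.integrableOn_lp _ hr 1
  refine sub_eq_zero.1 (eq_zero_of_volterra_chain hm hn ha
    (d := fun k r => formSpace.rep (formSolve hm hn (x k)) r - u k r) (B := C * B + B') (M := M)
    (fun k s hs => ?_) (fun k s hs => ?_) r ⟨har, hr.2⟩)
  · refine (norm_sub_le _ _).trans ?_
    rw [add_mul, mul_assoc]
    exact add_le_add ((hCb _ s hs).trans (mul_le_mul_of_nonneg_left
      ((norm_formSolve_le _).trans (hxB k)) hC)) (hB' k s hs)
  · have hs0 : s ∈ Ioc (0 : ℝ) 1 := ⟨ha.trans hs.1, hs.2⟩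
    rw [rep_formSolve _ hs0, hu k s hs0, add_sub_add_left_eq_sub, hx, ← integral_sub]
    · refine setIntegral_congr_fun measurableSet_Ioc fun y hy => ?_
      have hy0 : 0 < y := hs0.1.trans hy.1
      rw [← integral_sub (hci _ y hy0) (hui _ y hy0)]
      refine integral_congr_ae (ae_restrict_of_ae ?_)
      filter_upwards [formSpace.fst_ae_eq_rep (formSolve hm hn (x (k + 1)))] with z hz
      rw [neumannResolvent_apply, hz]
    · exact hn.integrableOn_of_continuousOn
        (hm.continuousOn_primitive fun r hr => hci _ r hr.1) hs0.1
    · exact hn.integrableOn_of_continuousOn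
        (hm.continuousOn_primitive fun r hr => hui _ r hr.1) hs0.1

theorem exists_pow_bound {q : ℝ → ℂ} (hq' : HasCompactSupport q) :
    ∃ M : ℝ, 0 ≤ M ∧ ∀ t, q t ≠ 0 → |t| ≤ M := by
  obtain ⟨M, hM⟩ := hq'.isBounded.exists_norm_le
  exact ⟨max M 0, le_max_right _ _, fun t ht =>
    (hM t (subset_tsupport _ ht)).trans (le_max_left _ _)⟩

/-- The end vector is cyclic for the resolvent. -/
theorem eq_zero_of_inner_invCalc_endVec [SFinite m] [SFinite n] {h : Lp ℂ 2 m}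
    (hh : ∀ q : ℝ → ℂ, Continuous q → HasCompactSupport q →
      ⟪invCalc (neumannResolvent hm hn) 1 q (endVec hm hn), h⟫_ℂ = 0) : h = 0 := by
  set T := neumannResolvent hm hn with hTdef
  have hT : T.IsPositive := isPositive_neumannResolvent hm hn
  have hT1 : ‖T‖ ≤ 1 := norm_neumannResolvent_le hm hn
  have h1w : Continuous fun t : ℝ => (((1 + |t| : ℝ)) : ℂ) := by fun_prop
  -- The orthogonality hypothesis now says that the solutions with data `invCalc T 2 q h` have end
  -- value zero for every `q`.
  have hh2 : ∀ q : ℝ → ℂ, Continuous q → HasCompactSupport q →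
      ⟪endVec hm hn, invCalc T 2 q h⟫_ℂ = 0 := by
    intro q hq hq'
    have e1 : invCalc T 2 q = invCalc T 1 (fun t => ((1 + |t| : ℝ) : ℂ) * q t) := by
      rw [← invCalc_two_weight_mul hT hT1]
      congr 1; ext t
      rw [← mul_assoc, ← Complex.ofReal_mul, inv_mul_cancel₀ (by positivity), Complex.ofReal_one,
        one_mul]
    rw [e1, ← ContinuousLinearMap.adjoint_inner_left, adjoint_invCalc]
    exact hh _ (Complex.continuous_conj.comp (h1w.mul hq)) (HasCompactSupport.comp_left (g := conj)
      hq'.mul_left (map_zero _))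
  refine neumannResolvent_injective (hm := hm) (hn := hn)
    (apply_eq_zero_of_invCalc hT hT1 fun q hq hq' => ?_)
  obtain ⟨M, hM, hMq⟩ := exists_pow_bound hq'
  have hc : ∀ k : ℕ, Continuous fun t : ℝ => (t : ℂ) ^ k * q t := fun k => by fun_prop
  have hs : ∀ k : ℕ, HasCompactSupport fun t : ℝ => (t : ℂ) ^ k * q t := fun k => hq'.mul_left
  have hTx : ∀ k : ℕ, T (invCalc T 2 (fun t => (t : ℂ) ^ k * q t) h)
      = invCalc T 1 (fun t => (t : ℂ) ^ k * q t) h := fun k => by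
    rw [← comp_invCalc hT hT1 (hc k) (hs k)]; rfl
  obtain ⟨B, hB⟩ := isCompact_Icc.exists_bound_of_continuousOn
    ((continuous_pullInv two_ne_zero hq hq').comp Complex.continuous_ofReal).continuousOn
    (s := Icc (0 : ℝ) 1)
  have hB0 : 0 ≤ B := (norm_nonneg _).trans (hB 0 ⟨le_rfl, zero_le_one⟩)
  -- Multiplying `q` by `t` applies the operator once. Since `|t| ≤ M` on the support of `q`, the
  -- data grow at most like `M ^ k`.
  have key := fun r hr => rep_formSolve_eq_of_chain (hm := hm) (hn := hn) (B := B * ‖h‖) (M := M)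
    (x := fun k => invCalc T 2 (fun t => (t : ℂ) ^ k * q t) h) (u := fun _ _ => 0)
    (fun k => ?_) (fun k => ?_) (fun _ _ _ => integrableOn_zero) (fun k r hr => ?_)
    (fun a ha => ⟨0, by simp⟩) (r := r) hr
  · have h2 : T (invCalc T 2 (fun t => (t : ℂ) ^ 0 * q t) h) = 0 := by
      rw [Lp.eq_zero_iff_ae_eq_zero, hTdef, neumannResolvent_apply]
      filter_upwards [formSpace.fst_ae_eq_rep (formSolve hm hn
        (invCalc T 2 (fun t => (t : ℂ) ^ 0 * q t) h)), hm.ae_mem] with z hz hz'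
      rw [hz, key z hz']; rfl
    rw [hTx] at h2
    simpa using h2
  · have e := invCalc_id_mul (T := T) (hc k) (hs k)
    have e2 : (fun t : ℝ => (t : ℂ) * ((t : ℂ) ^ k * q t)) = fun t : ℝ => (t : ℂ) ^ (k + 1) * q t := by
      ext t; ring
    rw [← hTdef, hTx, hTx, ← e2, e, sub_apply]
  · refine ((invCalc T 2 _).le_of_opNorm_le (c := B * M ^ k) ?_ h).trans_eq (by ring)
    refine norm_invCalc_le hT hT1 (by positivity) fun s h0 h1 => ?_
    have e3 : pullInv 2 (fun t : ℝ => (t : ℂ) ^ k * q t) s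
        = ((1 - 1 / s : ℝ) : ℂ) ^ k * pullInv 2 q s := by
      simp only [pullInv, Complex.ofReal_re]; ring
    rw [e3, norm_mul, norm_pow, Complex.norm_real, mul_comm]
    by_cases hz : q (1 - 1 / s) = 0
    · have : pullInv 2 q s = 0 := by
        rw [pullInv, Complex.ofReal_re, hz, zero_div]
      rw [this, norm_zero, zero_mul]; positivity
    · exact mul_le_mul (hB s ⟨h0, h1⟩) (pow_le_pow_left₀ (norm_nonneg _) (hMq _ hz) k)
        (by positivity) hB0
  · simp [hh2 _ (hc k) (hs k)]

/-- The resolvent has a spectral representation. -/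
theorem exists_isSpectralRep_neumannResolvent [SFinite m] [SFinite n] (hm : IsRadial m)
    (hn : IsRadial n) : ∃ (μ : Measure ℝ) (U : Lp ℂ 2 m ≃ₗᵢ[ℂ] Lp ℂ 2 μ),
      IsSpectralRep (neumannResolvent hm hn) (endVec hm hn) μ U :=
  exists_isSpectralRep (isPositive_neumannResolvent hm hn) (norm_neumannResolvent_le hm hn)
    fun _ hh => eq_zero_of_inner_invCalc_endVec hh

end

section

variable {m n μ : Measure ℝ} {hm : IsRadial m} {hn : IsRadial n}

/-! ### The generalized Fourier transform -/

/-- The conjugate solves the same initial value problem, whose parameter is real. -/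
theorem conj_fundSol (hm : IsRadial m) (hn : IsRadial n) (t : ℝ) {r : ℝ} (hr : r ∈ Ioc (0 : ℝ) 1) :
    conj (fundSol m n t r) = fundSol m n t r := by
  obtain ⟨-, h1, h2⟩ := continuousOn_fundSol hm hn t
  have h3 := h2.star
  simp only [map_mul, Complex.conj_ofReal] at h3
  exact eq_fundSol hm hn h1.star h3 (by simp [fundSol_one]) (by simp) r hr

theorem integrable_mul_mul_prod {ν : Measure ℝ} [SFinite μ] [SFinite ν] {G : ℝ × ℝ → ℂ}
    (hG : Measurable G) {f g : ℝ → ℂ} (hf : Integrable f μ) {S : Set ℝ} (hS : MeasurableSet S)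
    (hg : IntegrableOn g S ν) {B : ℝ} (hB : ∀ t s, f t ≠ 0 → s ∈ S → ‖G (t, s)‖ ≤ B) :
    Integrable (fun p : ℝ × ℝ => G p * (f p.1 * g p.2)) (μ.prod (ν.restrict S)) := by
  have h1 := hf.mul_prod hg
  refine (h1.norm.const_mul B).mono' (hG.aestronglyMeasurable.mul h1.aestronglyMeasurable) ?_
  filter_upwards [Measure.quasiMeasurePreserving_snd.ae (ae_restrict_mem hS)] with p hp
  rw [norm_mul]
  by_cases h0 : f p.1 = 0
  · simp [h0]
  · exact mul_le_mul_of_nonneg_right (hB p.1 p.2 h0 hp) (norm_nonneg _)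

/-- The inverse transform of `q`. -/
def bandSol (m n μ : Measure ℝ) (q : ℝ → ℂ) (r : ℝ) : ℂ := ∫ t, fundSol m n t r * q t ∂μ

theorem bandSol_one (q : ℝ → ℂ) : bandSol m n μ q 1 = ∫ t, q t ∂μ := by
  simp [bandSol, fundSol_one]

/-- Band limitation, `|t| ≤ M` where `q ≠ 0`, is what makes the growth in `k` geometric, as the
chain argument requires. -/
theorem exists_norm_bandSol_le (hm : IsRadial m) (hn : IsRadial n) (q : ℝ → ℂ)
    (hqi : Integrable q μ) {M : ℝ} (hM : ∀ t, q t ≠ 0 → |t| ≤ M) {a : ℝ} (ha : 0 < a) :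
    ∃ B', ∀ k : ℕ, ∀ r ∈ Ioc a 1, ‖bandSol m n μ (fun t => (t : ℂ) ^ k * q t) r‖ ≤ B' * M ^ k := by
  obtain ⟨B, hB, hb⟩ := norm_fundSol_le hm hn ha M
  refine ⟨B * ∫ t, ‖q t‖ ∂μ, fun k r hr => ?_⟩
  rw [mul_right_comm, ← integral_const_mul]
  refine norm_integral_le_of_norm_le (hqi.norm.const_mul _) (ae_of_all _ fun t => ?_)
  by_cases h0 : q t = 0
  · simp [h0]
  · rw [norm_mul, norm_mul, norm_pow, Complex.norm_real, Real.norm_eq_abs, ← mul_assoc]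
    gcongr
    · exact hb t (hM t h0) r hr
    · exact hM t h0

theorem stronglyMeasurable_bandSol [SFinite μ] (hm : IsRadial m) (hn : IsRadial n) {q : ℝ → ℂ}
    (hq : Measurable q) : StronglyMeasurable (bandSol m n μ q) :=
  StronglyMeasurable.integral_prod_left (f := fun t r => fundSol m n t r * q t)
    ((measurable_fundSol hm hn).mul (hq.comp measurable_fst)).stronglyMeasurable

theorem integrableOn_bandSol [SFinite μ] (hm : IsRadial m) (hn : IsRadial n) {q : ℝ → ℂ}
    (hq : Measurable q) (hqi : Integrable q μ) {M : ℝ} (hM : ∀ t, q t ≠ 0 → |t| ≤ M) {r : ℝ}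
    (hr : 0 < r) : IntegrableOn (bandSol m n μ q) (Ioc r 1) m := by
  obtain ⟨B', hB'⟩ := exists_norm_bandSol_le hm hn q hqi hM hr
  refine Measure.integrableOn_of_bounded (M := B') (hm.measure_Ioc_lt_top hr 1).ne
    (stronglyMeasurable_bandSol hm hn hq).aestronglyMeasurable ?_
  filter_upwards [ae_restrict_mem measurableSet_Ioc] with x hx
  simpa using hB' 0 x hx

/-- The integral equation of the fundamental solution, integrated against `q dμ`; two exchanges of
integrals move the `t`-integration inside. -/
theorem bandSol_eq [SFinite μ] [SFinite m] [SFinite n] (hm : IsRadial m) (hn : IsRadial n)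
    {q : ℝ → ℂ} (hq : Measurable q) (hqi : Integrable q μ) {M : ℝ} (hM : ∀ t, q t ≠ 0 → |t| ≤ M)
    {r : ℝ} (hr : r ∈ Ioc (0 : ℝ) 1) : bandSol m n μ q r = ∫ t, q t ∂μ
      + ∫ y in Ioc r 1, ∫ s in Ioc y 1, bandSol m n μ (fun t => (t : ℂ) * q t) s ∂m ∂n := by
  obtain ⟨B, hB, hb⟩ := norm_fundSol_le hm hn hr.1 M
  have hti : Integrable (fun t : ℝ => (t : ℂ) * q t) μ := by
    refine (hqi.norm.const_mul M).mono' (by fun_prop) (ae_of_all _ fun t => ?_)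
    by_cases h0 : q t = 0
    · simp [h0]
    · rw [norm_mul, Complex.norm_real]
      exact mul_le_mul_of_nonneg_right (hM t h0) (norm_nonneg _)
  have hmr : IntegrableOn (fun _ => (1 : ℂ)) (Ioc r 1) m :=
    integrableOn_const (hm.measure_Ioc_lt_top hr.1 1).ne
  have hnr : IntegrableOn (fun _ => (1 : ℂ)) (Ioc r 1) n :=
    integrableOn_const (hn.measure_Ioc_lt_top hr.1 1).ne
  have hq0 : ∀ t : ℝ, (t : ℂ) * q t ≠ 0 → |t| ≤ M := fun t h => hM t (right_ne_zero_of_mul h)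
  have s1 : ∀ y ∈ Ioc r 1, ∫ s in Ioc y 1, bandSol m n μ (fun t => (t : ℂ) * q t) s ∂m
      = ∫ t, (∫ s in Ioc y 1, fundSol m n t s ∂m) * ((t : ℂ) * q t) ∂μ := by
    intro y hy
    have hsub : Ioc y 1 ⊆ Ioc r 1 := Ioc_subset_Ioc_left hy.1.le
    have := integrable_mul_mul_prod (measurable_fundSol hm hn) hti measurableSet_Ioc
      (hmr.mono_set hsub) (B := B) fun t s h0 hs => hb t (hq0 t h0) s (hsub hs)
    simp only [mul_one] at this
    simp only [← integral_mul_const]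
    exact (integral_integral_swap (f := fun t s => fundSol m n t s * ((t : ℂ) * q t)) this).symm
  set H : ℝ × ℝ → ℂ := fun p => ∫ s in Ioc p.2 1, fundSol m n p.1 s ∂m with hH
  have hHm : Measurable H := by
    -- The moving interval of integration is absorbed in an indicator on the product, so that joint
    -- measurability follows from that of parametric integrals.
    have e : H = fun p => ∫ s, (fun z : (ℝ × ℝ) × ℝ => {z : (ℝ × ℝ) × ℝ | z.1.2 < z.2 ∧ z.2 ≤ 1}.indicator
        (fun z => fundSol m n z.1.1 z.2) z) (p, s) ∂m := by
      ext p
      rw [hH]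
      simp only
      rw [← integral_indicator measurableSet_Ioc]
      rfl
    rw [e]
    refine (StronglyMeasurable.integral_prod_right' (f := fun z : (ℝ × ℝ) × ℝ =>
      {z : (ℝ × ℝ) × ℝ | z.1.2 < z.2 ∧ z.2 ≤ 1}.indicator
        (fun z => fundSol m n z.1.1 z.2) z) (Measurable.stronglyMeasurable ?_)).measurable
    refine Measurable.indicator ((measurable_fundSol hm hn).comp
      ((measurable_fst.comp measurable_fst).prodMk measurable_snd)) ?_
    exact (measurableSet_lt (measurable_snd.comp measurable_fst) measurable_snd).inter
      (measurableSet_le measurable_snd measurable_const)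
  have hHb : ∀ t y : ℝ, (t : ℂ) * q t ≠ 0 → y ∈ Ioc r 1 → ‖H (t, y)‖ ≤ B * m.real (Ioc r 1) := by
    intro t y h0 hy
    have hsub : Ioc y 1 ⊆ Ioc r 1 := Ioc_subset_Ioc_left hy.1.le
    refine (norm_setIntegral_le_of_norm_le_const
      ((measure_mono hsub).trans_lt (hm.measure_Ioc_lt_top hr.1 1))
      fun s hs => hb t (hq0 t h0) s (hsub hs)).trans ?_
    exact mul_le_mul_of_nonneg_left (measureReal_mono hsub (hm.measure_Ioc_lt_top hr.1 1).ne) hB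
  have s2 := integrable_mul_mul_prod hHm hti measurableSet_Ioc hnr hHb
  simp only [mul_one] at s2
  rw [setIntegral_congr_fun measurableSet_Ioc s1,
    ← integral_integral_swap (f := fun t y => H (t, y) * ((t : ℂ) * q t)) s2,
    ← integral_add hqi s2.integral_prod_left, bandSol]
  refine integral_congr_ae (ae_of_all _ fun t => ?_)
  simp only [integral_mul_const, hH]
  rw [fundSol_eq hm hn t hr]
  simp only [integral_const_mul]
  ring

theorem IsSpectralRep.ae_nonpos {H : Type*} [NormedAddCommGroup H] [InnerProductSpace ℂ H]
    {T : H →L[ℂ] H} {ψ : H} {U : H ≃ₗᵢ[ℂ] Lp ℂ 2 μ} (h : IsSpectralRep T ψ μ U) :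
    ∀ᵐ t ∂μ, t ≤ 0 := by
  simpa [ae_iff] using! (h.nonpos : μ (Ioi 0) = 0)

theorem one_sub_ofReal_ne_zero {t : ℝ} (ht : t ≤ 0) : (1 : ℂ) - t ≠ 0 := by
  rw [← Complex.ofReal_one, ← Complex.ofReal_sub, Complex.ofReal_ne_zero]
  linarith

/-- The inverse of a spectral representation is given by the fundamental solutions. -/
theorem IsSpectralRep.symm_ae_eq_bandSol [SFinite m] [SFinite n] [IsLocallyFiniteMeasure μ]
    {U : Lp ℂ 2 m ≃ₗᵢ[ℂ] Lp ℂ 2 μ}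
    (h : IsSpectralRep (neumannResolvent hm hn) (endVec hm hn) μ U) (q : C_c(ℝ, ℂ)) :
    U.symm (compactToLp μ q) =ᵐ[m] bandSol m n μ q := by
  obtain ⟨M, hM, hMq⟩ := exists_pow_bound q.hasCompactSupport
  let Q : ℕ → C_c(ℝ, ℂ) := fun k => ⟨⟨fun t => (t : ℂ) ^ k * q t, by
    have := q.continuous; fun_prop⟩, q.hasCompactSupport.mul_left⟩
  -- The factor `1 - t` undoes the resolvent, so `U⁻¹ (t ^ k q)` is `T` applied to `U⁻¹ (P k)`. It
  -- also cancels `U ψ = 1 / (1 - t)`, which makes the end value `∫ t ^ k q dμ`.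
  let P : ℕ → C_c(ℝ, ℂ) := fun k => ⟨⟨fun t => (1 - (t : ℂ)) * ((t : ℂ) ^ k * q t), by
    have := q.continuous; fun_prop⟩, q.hasCompactSupport.mul_left.mul_left⟩
  have hQi : ∀ k, Integrable (fun t : ℝ => (t : ℂ) ^ k * q t) μ := fun k =>
    (Q k).continuous.integrable_of_hasCompactSupport (Q k).hasCompactSupport
  have hQm : ∀ k : ℕ, Measurable fun t : ℝ => (t : ℂ) ^ k * q t := fun k =>
    (Q k).continuous.measurable
  have hQ0 : ∀ k : ℕ, ∀ t : ℝ, (t : ℂ) ^ k * q t ≠ 0 → |t| ≤ M := fun k t h =>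
    hMq t (right_ne_zero_of_mul h)
  have hT : ∀ k, neumannResolvent hm hn (U.symm (compactToLp μ (P k)))
      = U.symm (compactToLp μ (Q k)) := by
    intro k
    rw [LinearIsometryEquiv.eq_symm_apply]
    refine Lp.ext ?_
    filter_upwards [h.map_apply (U.symm (compactToLp μ (P k))), compactToLp_ae μ (P k),
      compactToLp_ae μ (Q k), h.ae_nonpos] with t h1 h2 h3 h4
    rw [h1, LinearIsometryEquiv.apply_symm_apply, h2, h3]
    have := one_sub_ofReal_ne_zero h4
    change 1 / (1 - (t : ℂ)) * ((1 - (t : ℂ)) * ((t : ℂ) ^ k * q t)) = (t : ℂ) ^ k * q t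
    field_simp
  have key := fun r hr => rep_formSolve_eq_of_chain (hm := hm) (hn := hn)
    (x := fun k => U.symm (compactToLp μ (P k)))
    (u := fun k => bandSol m n μ (fun t => (t : ℂ) ^ k * q t)) (B := ‖compactToLp μ (P 0)‖) (M := M)
    (fun k => ?_) (fun k => ?_)
    (fun k r hr => integrableOn_bandSol hm hn (hQm k) (hQi k) (hQ0 k) hr) (fun k r hr => ?_)
    (fun a ha => exists_norm_bandSol_le hm hn q
      (q.continuous.integrable_of_hasCompactSupport q.hasCompactSupport) hMq ha) (r := r) hr
  · have e : U.symm (compactToLp μ q) = neumannResolvent hm hn (U.symm (compactToLp μ (P 0))) := by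
      rw [hT]; congr 2; ext t; simp [Q]
    rw [e, neumannResolvent_apply]
    filter_upwards [formSpace.fst_ae_eq_rep (formSolve hm hn (U.symm (compactToLp μ (P 0)))),
      hm.ae_mem] with r h1 h2
    rw [h1, key r h2]
    simp
  · simp only [hT]
    rw [← map_sub, ← map_sub]
    congr 2; ext t
    change (t : ℂ) ^ k * q t - (1 - (t : ℂ)) * ((t : ℂ) ^ k * q t) = (t : ℂ) ^ (k + 1) * q t
    ring
  · simp only [LinearIsometryEquiv.norm_map]
    rw [mul_comm]
    refine Lp.norm_le_mul_norm_of_ae_le_mul ?_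
    filter_upwards [compactToLp_ae μ (P k), compactToLp_ae μ (P 0)] with t h1 h2
    rw [h1, h2]
    change ‖(1 - (t : ℂ)) * ((t : ℂ) ^ k * q t)‖ ≤ M ^ k * ‖(1 - (t : ℂ)) * ((t : ℂ) ^ 0 * q t)‖
    by_cases h0 : q t = 0
    · simp [h0]
    · rw [norm_mul, norm_mul, norm_mul, pow_zero, one_mul, norm_pow, Complex.norm_real,
        Real.norm_eq_abs]
      have := pow_le_pow_left₀ (abs_nonneg t) (hMq t h0) k
      calc ‖1 - (t : ℂ)‖ * (|t| ^ k * ‖q t‖) = |t| ^ k * (‖1 - (t : ℂ)‖ * ‖q t‖) := by ring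
        _ ≤ _ := mul_le_mul_of_nonneg_right this (by positivity)
  · rw [bandSol_eq hm hn (hQm k) (hQi k) (hQ0 k) hr]
    have e1 : ∫ t : ℝ, (t : ℂ) ^ k * q t ∂μ = ⟪endVec hm hn, U.symm (compactToLp μ (P k))⟫_ℂ := by
      rw [← U.inner_map_map, LinearIsometryEquiv.apply_symm_apply, inner_Lp_eq]
      refine integral_congr_ae ?_
      filter_upwards [h.map_vec, compactToLp_ae μ (P k), h.ae_nonpos] with t h1 h2 h4
      rw [h1, h2]
      have := one_sub_ofReal_ne_zero h4
      change _ = conj (1 / (1 - (t : ℂ))) * ((1 - (t : ℂ)) * ((t : ℂ) ^ k * q t))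
      rw [map_div₀, map_sub, map_one, Complex.conj_ofReal]
      field_simp
    rw [e1]
    simp only [pow_succ', mul_assoc]

theorem setIntegral_mul_bandSol [SFinite μ] [SFinite m] (hm : IsRadial m)
    (hn : IsRadial n) {q f : ℝ → ℂ} (hqi : Integrable q μ) {M : ℝ}
    (hM : ∀ t, q t ≠ 0 → |t| ≤ M) {a : ℝ} (ha : 0 < a) (hf : IntegrableOn f (Ioc a 1) m) :
    ∫ x in Ioc a 1, f x * bandSol m n μ q x ∂m
      = ∫ t, q t * ∫ x in Ioc a 1, f x * fundSol m n t x ∂m ∂μ := by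
  obtain ⟨B, hB, hb⟩ := norm_fundSol_le hm hn ha M
  have h2 := integrable_mul_mul_prod (measurable_fundSol hm hn) hqi measurableSet_Ioc hf
    fun t s h0 hs => hb t (hM t h0) s hs
  calc _ = ∫ x in Ioc a 1, ∫ t, fundSol m n t x * (q t * f x) ∂μ ∂m := by
          refine integral_congr_ae (ae_of_all _ fun x => ?_)
          simp only [bandSol]
          rw [← integral_const_mul]
          congr 1; ext t; ring
      _ = ∫ t, ∫ x in Ioc a 1, fundSol m n t x * (q t * f x) ∂m ∂μ :=
          (integral_integral_swap (f := fun t x => fundSol m n t x * (q t * f x)) h2).symm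
      _ = _ := by
          congr 1; ext t
          rw [← integral_const_mul]
          congr 1; ext x; ring

theorem conj_bandSol (hm : IsRadial m) (hn : IsRadial n) (q : ℝ → ℂ) {r : ℝ}
    (hr : r ∈ Ioc (0 : ℝ) 1) :
    conj (bandSol m n μ q r) = bandSol m n μ (fun t => conj (q t)) r := by
  rw [bandSol, bandSol, ← integral_conj]
  simp only [map_mul, conj_fundSol hm hn _ hr]

/-- A spectral representation is the generalized Fourier transform. -/
theorem IsSpectralRep.ae_eq_integral [SFinite m] [SFinite n]
    {U : Lp ℂ 2 m ≃ₗᵢ[ℂ] Lp ℂ 2 μ}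
    (h : IsSpectralRep (neumannResolvent hm hn) (endVec hm hn) μ U) {a : ℝ} (ha : 0 < a)
    {f : Lp ℂ 2 m} (hf : ∀ᵐ x ∂m, x ∉ Ioc a 1 → f x = 0) :
    U f =ᵐ[μ] fun t => ∫ x, f x * fundSol m n t x ∂m := by
  have := h.locallyFinite
  have hfi : IntegrableOn f (Ioc a 1) m := hm.integrableOn_lp f ha 1
  have hset : ∀ g : ℝ → ℂ, ∫ x, f x * g x ∂m = ∫ x in Ioc a 1, f x * g x ∂m := fun g => by
    rw [setIntegral_eq_integral_of_ae_compl_eq_zero]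
    filter_upwards [hf] with x hx hx'
    rw [hx hx', zero_mul]
  simp only [hset]
  -- A strongly measurable representative makes the integrand jointly measurable, hence the
  -- transform measurable in `t`.
  obtain ⟨F, hFm, hF⟩ : ∃ F : ℝ → ℂ, StronglyMeasurable F ∧ F =ᵐ[m.restrict (Ioc a 1)] f :=
    ⟨_, hfi.aestronglyMeasurable.stronglyMeasurable_mk, hfi.aestronglyMeasurable.ae_eq_mk.symm⟩
  have hcongr : ∀ t, ∫ x in Ioc a 1, f x * fundSol m n t x ∂m
      = ∫ x in Ioc a 1, F x * fundSol m n t x ∂m := fun t => by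
    refine integral_congr_ae ?_
    filter_upwards [hF] with x hx
    rw [hx]
  have hmeas : StronglyMeasurable fun t => ∫ x in Ioc a 1, f x * fundSol m n t x ∂m := by
    simp only [hcongr]
    exact StronglyMeasurable.integral_prod_right' (f := fun p : ℝ × ℝ => F p.2 * fundSol m n p.1 p.2)
      ((hFm.measurable.comp measurable_snd).mul (measurable_fundSol hm hn)).stronglyMeasurable
  refine ae_eq_of_integral_mul_eq (locallyIntegrable_lp _) ?_ fun q hq hq' => ?_
  · refine locallyIntegrable_iff.2 fun K hK => ?_
    obtain ⟨R, hR⟩ := hK.isBounded.exists_norm_le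
    obtain ⟨B, hB, hb⟩ := norm_fundSol_le hm hn ha R
    refine Measure.integrableOn_of_bounded (M := ∫ x in Ioc a 1, ‖f x‖ * B ∂m)
      hK.measure_lt_top.ne hmeas.aestronglyMeasurable ?_
    filter_upwards [ae_restrict_mem hK.measurableSet] with t ht
    refine norm_integral_le_of_norm_le (hfi.norm.mul_const _) ?_
    filter_upwards [ae_restrict_mem measurableSet_Ioc] with x hx
    rw [norm_mul]
    exact mul_le_mul_of_nonneg_left (hb t (hR t ht) x hx) (norm_nonneg _)
  · set Q : C_c(ℝ, ℂ) := ⟨⟨fun t => conj (q t), Complex.continuous_conj.comp hq⟩,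
      HasCompactSupport.comp_left (g := conj) hq' (map_zero _)⟩ with hQ
    have h1 : ∫ t, q t * U f t ∂μ = ⟪compactToLp μ Q, U f⟫_ℂ := by
      rw [inner_compactToLp]
      congr 1; ext t
      simp [hQ]
    obtain ⟨M, hM, hMq⟩ := exists_pow_bound hq'
    -- Testing against `q` moves `U` to the other side, where the inverse is already known as an
    -- integral of fundamental solutions.
    rw [h1, ← U.symm.inner_map_map, LinearIsometryEquiv.symm_apply_apply, inner_Lp_eq]
    calc ∫ x, conj (U.symm (compactToLp μ Q) x) * f x ∂m
        = ∫ x, f x * bandSol m n μ q x ∂m := by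
          refine integral_congr_ae ?_
          filter_upwards [h.symm_ae_eq_bandSol Q, hm.ae_mem] with x hx hx'
          rw [hx, bandSol, bandSol, ← integral_conj, mul_comm]
          congr 1
          refine integral_congr_ae (ae_of_all _ fun t => ?_)
          simp [hQ, conj_fundSol hm hn t hx']
      _ = _ := by
          rw [hset]
          exact setIntegral_mul_bandSol hm hn (hq.integrable_of_hasCompactSupport hq') hMq ha hfi

end

section

section Radial

variable {m n μ : Measure ℝ} {hm : IsRadial m} {hn : IsRadial n}

/-! ### The graph of the operator and the spectral measure -/

theorem HasCoordDeriv.add {ν : Measure ℝ} {F F' G G' : ℝ → ℂ} (h : HasCoordDeriv ν F G)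
    (h' : HasCoordDeriv ν F' G') :
    HasCoordDeriv ν (fun r => F r + F' r) (fun r => G r + G' r) := fun r hr =>
  ⟨(h r hr).1.add (h' r hr).1, by
    simp only
    rw [integral_add (h r hr).1 (h' r hr).1, (h r hr).2, (h' r hr).2]; ring⟩

theorem HasCoordDeriv.const_mul {ν : Measure ℝ} {F G : ℝ → ℂ} (h : HasCoordDeriv ν F G) (x : ℂ) :
    HasCoordDeriv ν (fun r => x * F r) (fun r => x * G r) := fun r hr =>
  ⟨(h r hr).1.const_mul x, by
    simp only
    rw [integral_const_mul, (h r hr).2]; ring⟩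

theorem HasCoordDeriv.sub {ν : Measure ℝ} {F F' G G' : ℝ → ℂ} (h : HasCoordDeriv ν F G)
    (h' : HasCoordDeriv ν F' G') :
    HasCoordDeriv ν (fun r => F r - F' r) (fun r => G r - G' r) := by
  simpa [sub_eq_add_neg] using h.add (h'.const_mul (-1))

/-- The classical graph equals that of the variational operator. For a classical pair, the
difference between `V` and the variational solution with data `v - g` is a decaying Neumann solution
for `lam = 1`, hence zero. -/
theorem exists_hasCoordDeriv_iff [SFinite m] [SFinite n] (v g : Lp ℂ 2 m) :
    (∃ V W : ℝ → ℂ, v =ᵐ[m] V ∧ HasCoordDeriv n V W ∧ HasCoordDeriv m W g ∧ W 1 = 0 ∧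
      Tendsto V (𝓝[>] 0) (𝓝 0)) ↔ v = neumannResolvent hm hn (v - g) := by
  have hu := hasCoordDeriv_of_weak (formSolve_weak (hm := hm) (hn := hn) (v - g))
  have hrep := formSpace.fst_ae_eq_rep (formSolve hm hn (v - g))
  have ht := formSpace.tendsto_rep (formSolve hm hn (v - g))
  set u := formSolve hm hn (v - g) with hudef
  constructor
  · rintro ⟨V, W, hvV, hV, hW, hW1, hV0⟩
    have hD := eq_zero_of_neumann_of_tendsto hm hn (lam := 1) Complex.one_mem_slitPlane
      (hV.sub hu.1) ((hW.sub hu.2).congr_ae ?_) (by simpa using! hV0.sub ht) (by simp [hW1])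
    · refine Lp.ext ?_
      rw [neumannResolvent_apply]
      filter_upwards [hvV, hrep, hm.ae_mem] with x h1 h2 h3
      rw [h1, h2]
      exact sub_eq_zero.1 (hD x h3)
    · filter_upwards [hvV, hrep, Lp.coeFn_sub u.1.fst (v - g), Lp.coeFn_sub v g] with x h1 h2 h3 h4
      rw [h3, Pi.sub_apply, h4, Pi.sub_apply, h1, h2]
      ring
  · intro hv
    have e : u.1.fst - (v - g) = g := by
      rw [hudef, ← neumannResolvent_apply, ← hv]; abel
    rw [e] at hu
    refine ⟨_, _, ?_, hu.1, hu.2, by simp, ht⟩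
    have e2 : v = u.1.fst := hv
    nth_rewrite 1 [e2]
    exact hrep

theorem IsSpectralRep.eq_apply_sub_iff {H : Type*} [NormedAddCommGroup H] [InnerProductSpace ℂ H]
    {T : H →L[ℂ] H} {ψ : H} {U : H ≃ₗᵢ[ℂ] Lp ℂ 2 μ} (h : IsSpectralRep T ψ μ U) (v g : H) :
    v = T (v - g) ↔ U g =ᵐ[μ] fun t => (t : ℂ) * U v t := by
  rw [← U.injective.eq_iff, Lp.ext_iff]
  have h1 := h.map_apply (v - g)
  rw [map_sub U] at h1
  constructor
  · intro h2
    filter_upwards [h1, h2, Lp.coeFn_sub (U v) (U g), h.ae_nonpos] with t h3 h4 h5 h6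
    rw [h3, h5, Pi.sub_apply] at h4
    have := one_sub_ofReal_ne_zero h6
    field_simp at h4
    linear_combination h4
  · intro h2
    filter_upwards [h1, h2, Lp.coeFn_sub (U v) (U g), h.ae_nonpos] with t h3 h4 h5 h6
    rw [h3, h5, Pi.sub_apply, h4]
    have := one_sub_ofReal_ne_zero h6
    field_simp

theorem continuousOn_bandSol [SFinite μ] [SFinite m] [SFinite n] (hm : IsRadial m)
    (hn : IsRadial n) {q : ℝ → ℂ} (hq : Measurable q) (hqi : Integrable q μ) {M : ℝ}
    (hM : ∀ t, q t ≠ 0 → |t| ≤ M) : ContinuousOn (bandSol m n μ q) (Ioc 0 1) := by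
  have hti : Integrable (fun t : ℝ => (t : ℂ) * q t) μ := by
    refine (hqi.norm.const_mul M).mono' (by fun_prop) (ae_of_all _ fun t => ?_)
    by_cases h0 : q t = 0
    · simp [h0]
    · rw [norm_mul, Complex.norm_real]
      exact mul_le_mul_of_nonneg_right (hM t h0) (norm_nonneg _)
  have h1 : ∀ r, 0 < r → IntegrableOn (bandSol m n μ fun t => (t : ℂ) * q t) (Ioc r 1) m :=
    fun r hr => integrableOn_bandSol hm hn (by fun_prop) hti
      (fun t h => hM t (right_ne_zero_of_mul h)) hr
  have h2 := hm.continuousOn_primitive fun r hr => h1 r hr.1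
  refine ((hn.continuousOn_primitive fun r hr => hn.integrableOn_of_continuousOn h2 hr.1).const_add
    (∫ t, q t ∂μ)).congr fun r hr => bandSol_eq hm hn hq hqi hM hr

/-- Here the transform formula is the hypothesis and the inversion formula follows by duality: the
truncated difference `d` of the two sides is transformed, and Fubini shows that `d` is orthogonal to
itself. -/
theorem symm_ae_eq_bandSol_of_transform [SFinite m] [SFinite n] [IsLocallyFiniteMeasure μ]
    (hm : IsRadial m) (hn : IsRadial n) {U : Lp ℂ 2 m ≃ₗᵢ[ℂ] Lp ℂ 2 μ}
    (hU : ∀ a : ℝ, 0 < a → a < 1 → ∀ f : Lp ℂ 2 m, (∀ᵐ x ∂m, x ∉ Ioc a 1 → f x = 0) →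
      U f =ᵐ[μ] fun t => ∫ x, f x * fundSol m n t x ∂m) (q : C_c(ℝ, ℂ)) :
    U.symm (compactToLp μ q) =ᵐ[m] bandSol m n μ q := by
  obtain ⟨M, hM, hMq⟩ := exists_pow_bound q.hasCompactSupport
  have hqi := q.continuous.integrable_of_hasCompactSupport q.hasCompactSupport (μ := μ)
  have hqm := q.continuous.measurable
  have hcM : ∀ t, conj (q t) ≠ 0 → |t| ≤ M := fun t h => hMq t fun h0 => h (by rw [h0, map_zero])
  have hci : Integrable (fun t => conj (q t)) μ :=
    (Complex.conjLIE.toContinuousLinearEquiv : ℂ →L[ℝ] ℂ).integrable_comp hqi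
  set x := U.symm (compactToLp μ q) with hx
  have key : ∀ a : ℝ, 0 < a → a < 1 → ∀ᵐ r ∂m, r ∈ Ioc a 1 → x r = bandSol m n μ q r := by
    intro a ha ha1
    have hfin : IsFiniteMeasure (m.restrict (Ioc a 1)) := ⟨by
      rw [Measure.restrict_apply_univ]; exact hm.measure_Ioc_lt_top ha 1⟩
    have hb2 : MemLp (bandSol m n μ q) 2 (m.restrict (Ioc a 1)) := by
      obtain ⟨B', hB'⟩ := exists_norm_bandSol_le hm hn q hqi hMq ha
      refine MemLp.of_bound (stronglyMeasurable_bandSol hm hn hqm).aestronglyMeasurable B' ?_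
      filter_upwards [ae_restrict_mem measurableSet_Ioc] with r hr
      simpa using hB' 0 r hr
    have hd2 : MemLp ((Ioc a 1).indicator fun r => x r - bandSol m n μ q r) 2 m :=
      (memLp_indicator_iff_restrict measurableSet_Ioc).2 (((Lp.memLp x).restrict _).sub hb2)
    set d := hd2.toLp _ with hddef
    have hd : d =ᵐ[m] (Ioc a 1).indicator fun r => x r - bandSol m n μ q r := hd2.coeFn_toLp
    have hd0 : ∀ᵐ r ∂m, r ∉ Ioc a 1 → d r = 0 := by
      filter_upwards [hd] with r hr h
      rw [hr, indicator_of_notMem h]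
    have hset : ∀ g : ℝ → ℂ, ∫ r, d r * g r ∂m = ∫ r in Ioc a 1, d r * g r ∂m := fun g => by
      rw [setIntegral_eq_integral_of_ae_compl_eq_zero]
      filter_upwards [hd0] with r hr hr'
      rw [hr hr', zero_mul]
    have h1 : ⟪x, d⟫_ℂ = ∫ r in Ioc a 1, d r * bandSol m n μ (fun t => conj (q t)) r ∂m := by
      rw [setIntegral_mul_bandSol hm hn hci hcM ha (hm.integrableOn_lp d ha 1), hx,
        ← U.inner_map_map, LinearIsometryEquiv.apply_symm_apply, inner_compactToLp]
      refine integral_congr_ae ?_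
      filter_upwards [hU a ha ha1 d hd0] with t ht
      rw [ht, hset]
    have h2 : ⟪d, d⟫_ℂ = 0 := by
      have h3 : ⟪x, d⟫_ℂ = ∫ r in Ioc a 1, d r * conj (x r) ∂m := by
        rw [← hset, inner_Lp_eq]
        congr 1; ext r; ring
      have h4 : ⟪d, d⟫_ℂ = ∫ r in Ioc a 1, (d r * conj (x r)
          - d r * bandSol m n μ (fun t => conj (q t)) r) ∂m := by
        rw [inner_Lp_eq]
        have : ∀ r, conj (d r) * d r = d r * conj (d r) := fun r => mul_comm _ _
        simp only [this]
        rw [hset]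
        refine integral_congr_ae ?_
        filter_upwards [ae_restrict_of_ae hd, ae_restrict_mem measurableSet_Ioc] with r h5 h6
        rw [h5, indicator_of_mem h6, ← conj_bandSol hm hn _ ⟨ha.trans h6.1, h6.2⟩, map_sub]
        ring
      rw [h4, integral_sub, ← h3, h1, sub_self]
      · exact MemLp.integrable_mul (p := 2) (q := 2) ((Lp.memLp d).restrict _)
          ((Lp.memLp x).star.restrict _)
      · refine MemLp.integrable_mul (p := 2) (q := 2) ((Lp.memLp d).restrict _)
          (hb2.star.ae_eq ?_)
        filter_upwards [ae_restrict_mem measurableSet_Ioc] with r h6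
        rw [← conj_bandSol hm hn _ ⟨ha.trans h6.1, h6.2⟩]
        rfl
    have h3 : d = 0 := inner_self_eq_zero.1 h2
    filter_upwards [hd, Lp.coeFn_zero ℂ 2 m] with r h1 h2 h4
    rw [h3, h2, indicator_of_mem h4] at h1
    exact sub_eq_zero.1 h1.symm
  have := ae_all_iff.2 fun j : ℕ => key (1 / (j + 1 + 1)) (by positivity) (by
    rw [div_lt_one (by positivity)]
    have : (0 : ℝ) ≤ j := j.cast_nonneg
    linarith)
  filter_upwards [this, hm.ae_mem] with r h1 h2
  obtain ⟨j, hj⟩ := exists_nat_one_div_lt h2.1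
  refine h1 j ⟨lt_of_le_of_lt ?_ hj, h2.2⟩
  have : (0 : ℝ) ≤ j := j.cast_nonneg
  exact one_div_le_one_div_of_le (by linarith) (by linarith)

/-- A unitary generalized Fourier transform which diagonalizes the operator diagonalizes
its resolvent, and maps the end vector to `1 / (1 - t)`. -/
theorem isSpectralRep_of_transform [SFinite m] [SFinite n] [hμ : IsLocallyFiniteMeasure μ]
    (h0 : μ (Ioi 0) = 0) {U : Lp ℂ 2 m ≃ₗᵢ[ℂ] Lp ℂ 2 μ}
    (hU : ∀ a : ℝ, 0 < a → a < 1 → ∀ f : Lp ℂ 2 m, (∀ᵐ x ∂m, x ∉ Ioc a 1 → f x = 0) →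
      U f =ᵐ[μ] fun t => ∫ x, f x * fundSol m n t x ∂m)
    (hg : ∀ v g : Lp ℂ 2 m, v = neumannResolvent hm hn (v - g) →
      U g =ᵐ[μ] fun t => (t : ℂ) * U v t) :
    IsSpectralRep (neumannResolvent hm hn) (endVec hm hn) μ U := by
  have hle : ∀ᵐ t ∂μ, t ≤ 0 := by simpa [ae_iff] using! (h0 : μ (Ioi 0) = 0)
  have hT : ∀ h, U (neumannResolvent hm hn h) =ᵐ[μ] fun t => 1 / (1 - (t : ℂ)) * U h t := by
    intro h
    have h1 := hg (neumannResolvent hm hn h) (neumannResolvent hm hn h - h) (by congr 1; abel)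
    rw [map_sub] at h1
    filter_upwards [h1, Lp.coeFn_sub (U (neumannResolvent hm hn h)) (U h), hle] with t h2 h3 h4
    rw [h3, Pi.sub_apply] at h2
    have := one_sub_ofReal_ne_zero h4
    field_simp
    linear_combination h2
  have hw : Continuous fun t : ℝ => (((1 + |t|)⁻¹ : ℝ) : ℂ) :=
    Complex.continuous_ofReal.comp (Continuous.inv₀ (by fun_prop) fun t => by positivity)
  have hwt : ∀ t : ℝ, t ≤ 0 → (((1 + |t|)⁻¹ : ℝ) : ℂ) = 1 / (1 - (t : ℂ)) := by
    intro t ht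
    rw [abs_of_nonpos ht]; push_cast; rw [one_div, sub_eq_add_neg]
  refine ⟨hμ, h0, hT, ?_⟩
  -- For a test function `q`, the resolvent of `U⁻¹ q` has two continuous representatives, the
  -- variational one and the inverse transform of `q / (1 + |t|)`. Comparing them at the end `1`
  -- gives `⟪ψ, U⁻¹ q⟫ = ∫ q / (1 + |t|) dμ`.
  have key : (fun t => conj (U (endVec hm hn) t)) =ᵐ[μ] fun t : ℝ => (((1 + |t|)⁻¹ : ℝ) : ℂ) := by
    refine ae_eq_of_integral_mul_eq ((Lp.memLp (U (endVec hm hn))).star.locallyIntegrable (by norm_num))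
      hw.locallyIntegrable fun q hq hq' => ?_
    set Q : C_c(ℝ, ℂ) := ⟨⟨q, hq⟩, hq'⟩ with hQ
    set P : C_c(ℝ, ℂ) := ⟨⟨fun t => (((1 + |t|)⁻¹ : ℝ) : ℂ) * q t, hw.mul hq⟩, hq'.mul_left⟩ with hP
    have e : neumannResolvent hm hn (U.symm (compactToLp μ Q)) = U.symm (compactToLp μ P) := by
      rw [LinearIsometryEquiv.eq_symm_apply]
      refine Lp.ext ?_
      filter_upwards [hT (U.symm (compactToLp μ Q)), compactToLp_ae μ Q, compactToLp_ae μ P, hle]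
        with t h1 h2 h3 h4
      rw [h1, LinearIsometryEquiv.apply_symm_apply, h2, h3, ← hwt t h4]
      rfl
    obtain ⟨M, hM, hMP⟩ := exists_pow_bound P.hasCompactSupport
    have h1 : formSpace.rep (formSolve hm hn (U.symm (compactToLp μ Q))) =ᵐ[m] bandSol m n μ P :=
      (formSpace.fst_ae_eq_rep _).symm.trans
        (by rw [← neumannResolvent_apply, e]; exact symm_ae_eq_bandSol_of_transform hm hn hU P)
    have h2 := hm.eqOn_of_ae_eq (hn.hasCoordDeriv_continuousOn (formSpace.hasCoordDeriv_rep _))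
      (continuousOn_bandSol hm hn P.continuous.measurable
        (P.continuous.integrable_of_hasCompactSupport P.hasCompactSupport) hMP) h1
      (⟨zero_lt_one, le_rfl⟩ : (1 : ℝ) ∈ Ioc (0 : ℝ) 1)
    rw [formSpace.rep_one, endValue_formSolve, bandSol_one, ← U.inner_map_map,
      LinearIsometryEquiv.apply_symm_apply, inner_Lp_eq] at h2
    calc ∫ t, q t * conj (U (endVec hm hn) t) ∂μ
        = ∫ t, conj (U (endVec hm hn) t) * compactToLp μ Q t ∂μ := by
          refine integral_congr_ae ?_
          filter_upwards [compactToLp_ae μ Q] with t ht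
          rw [ht, mul_comm]; rfl
      _ = ∫ t, P t ∂μ := h2
      _ = _ := by
          congr 1; ext t
          rw [mul_comm]; rfl
  filter_upwards [key, hle] with t h1 h2
  have h3 := congrArg conj h1
  rw [Complex.conj_conj, Complex.conj_ofReal, hwt t h2] at h3
  exact h3

end Radial

end

section

section Impedance

variable {m n μ : Measure ℝ} {hm : IsRadial m} {hn : IsRadial n}

/-! ### The Neumann-to-Dirichlet function -/

/-- The distance from `lam` to the half line is positive, so `1 / (lam - t)` is dominated there by a
multiple of `1 / (1 - t)`. -/
theorem exists_norm_one_sub_le {lam : ℂ} (hlam : lam ∈ Complex.slitPlane) :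
    ∃ C : ℝ, 0 ≤ C ∧ ∀ t : ℝ, t ≤ 0 → ‖1 - (t : ℂ)‖ ≤ C * ‖lam - t‖ := by
  obtain ⟨d, hd, hdt⟩ : ∃ d : ℝ, 0 < d ∧ ∀ t : ℝ, t ≤ 0 → d ≤ ‖lam - t‖ := by
    rcases hlam with h | h
    · refine ⟨lam.re, h, fun t ht => ?_⟩
      have := Complex.re_le_norm (lam - t)
      rw [Complex.sub_re, Complex.ofReal_re] at this
      linarith
    · refine ⟨|lam.im|, abs_pos.2 h, fun t ht => ?_⟩
      have := Complex.abs_im_le_norm (lam - t)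
      rwa [Complex.sub_im, Complex.ofReal_im, sub_zero] at this
  refine ⟨1 + ‖1 - lam‖ / d, by positivity, fun t ht => ?_⟩
  have h1 : ‖1 - (t : ℂ)‖ ≤ ‖lam - t‖ + ‖1 - lam‖ := by
    have : 1 - (t : ℂ) = (lam - t) + (1 - lam) := by ring
    rw [this]; exact norm_add_le _ _
  have h2 : ‖1 - lam‖ ≤ ‖1 - lam‖ / d * ‖lam - t‖ := by
    rw [div_mul_eq_mul_div, le_div_iff₀ hd]
    exact mul_le_mul_of_nonneg_left (hdt t ht) (norm_nonneg _)
  linarith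

theorem sub_ofReal_ne_zero_of_mem_slitPlane {lam : ℂ} (hlam : lam ∈ Complex.slitPlane) {t : ℝ}
    (ht : t ≤ 0) : lam - t ≠ 0 := by
  intro h
  obtain ⟨C, -, hC⟩ := exists_norm_one_sub_le hlam
  have := hC t ht
  rw [h, norm_zero, mul_zero, norm_le_zero_iff] at this
  exact one_sub_ofReal_ne_zero ht this

section Abstract

variable {H : Type*} [NormedAddCommGroup H] [InnerProductSpace ℂ H] {T : H →L[ℂ] H} {ψ : H}
  {U : H ≃ₗᵢ[ℂ] Lp ℂ 2 μ}

theorem measurable_one_div_sub (lam : ℂ) : Measurable fun t : ℝ => 1 / (lam - (t : ℂ)) := by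
  fun_prop

theorem IsSpectralRep.memLp_one_div_sub (h : IsSpectralRep T ψ μ U) {lam : ℂ}
    (hlam : lam ∈ Complex.slitPlane) : MemLp (fun t : ℝ => 1 / (lam - (t : ℂ))) 2 μ := by
  obtain ⟨C, hC0, hC⟩ := exists_norm_one_sub_le hlam
  refine MemLp.of_le_mul (c := C) (Lp.memLp (U ψ))
    (measurable_one_div_sub lam).aestronglyMeasurable ?_
  filter_upwards [h.map_vec, h.ae_nonpos] with t h1 h2
  rw [h1, norm_div, norm_div, norm_one, ← mul_div_assoc, mul_one,
    div_le_div_iff₀ (norm_pos_iff.2 (sub_ofReal_ne_zero_of_mem_slitPlane hlam h2))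
      (norm_pos_iff.2 (one_sub_ofReal_ne_zero h2)), one_mul]
  exact hC t h2

/-- The vector with transform `1 / (lam - t)`. -/
theorem IsSpectralRep.exists_solution (h : IsSpectralRep T ψ μ U) {lam : ℂ}
    (hlam : lam ∈ Complex.slitPlane) : ∃ x : H, x = ψ + (1 - lam) • T x ∧
      ⟪ψ, x⟫_ℂ = ∫ t, 1 / (1 - (t : ℂ)) * (1 / (lam - (t : ℂ))) ∂μ := by
  have hx : U (U.symm ((h.memLp_one_div_sub hlam).toLp _)) =ᵐ[μ]
      fun t : ℝ => 1 / (lam - (t : ℂ)) := by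
    rw [LinearIsometryEquiv.apply_symm_apply]; exact MemLp.coeFn_toLp _
  set x := U.symm ((h.memLp_one_div_sub hlam).toLp _)
  refine ⟨x, ?_, ?_⟩
  · rw [← U.injective.eq_iff, map_add, map_smul]
    refine Lp.ext ?_
    filter_upwards [hx, h.map_vec, h.map_apply x, Lp.coeFn_add (U ψ) ((1 - lam) • U (T x)),
      Lp.coeFn_smul (1 - lam) (U (T x)), h.ae_nonpos] with t h1 h2 h3 h4 h5 h6
    rw [h4, Pi.add_apply, h5, Pi.smul_apply, h3, h1, h2, smul_eq_mul]
    have := one_sub_ofReal_ne_zero h6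
    have := sub_ofReal_ne_zero_of_mem_slitPlane hlam h6
    field_simp
    ring
  · rw [← U.inner_map_map, inner_Lp_eq]
    refine integral_congr_ae ?_
    filter_upwards [hx, h.map_vec] with t h1 h2
    rw [h1, h2, map_div₀, map_sub, map_one, Complex.conj_ofReal]

end Abstract

/-- The value of the Neumann-to-Dirichlet function for a pair of measures. -/
def IsRadialNtD (m n : Measure ℝ) (lam f : ℂ) : Prop :=
  ∃ (v w : ℝ → ℂ) (φ : ℂ), (HasCoordDeriv n v w ∧ HasCoordDeriv m w fun r => lam * v r) ∧
    Tendsto v (𝓝[>] 0) (𝓝 0) ∧ -w 1 = φ ∧ φ ≠ 0 ∧ f = v 1 / φ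

section Solution

variable {lam : ℂ} {x : Lp ℂ 2 m}

theorem fst_endRiesz_add (hx : x = endVec hm hn + (1 - lam) • neumannResolvent hm hn x) :
    (endRiesz hm hn + (1 - lam) • formSolve hm hn x).1.fst = x := by
  conv_rhs => rw [hx]
  rfl

theorem inner_smul_formSolve (a : formSpace hm hn) :
    ⟪a, (1 - lam) • formSolve hm hn x⟫_ℂ = (1 - lam) * ⟪a, formSolve hm hn x⟫_ℂ :=
  inner_smul_right (𝕜 := ℂ) (E := formSpace hm hn) a (formSolve hm hn x) (1 - lam)

theorem inner_endRiesz_add (a : formSpace hm hn) :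
    ⟪a, endRiesz hm hn + (1 - lam) • formSolve hm hn x⟫_ℂ
      = ⟪a.1.fst, (1 - lam) • x⟫_ℂ + conj (formSpace.endValue a) * 1 := by
  rw [inner_add_right, inner_smul_formSolve, inner_smul_right, inner_formSolve, ← inner_endRiesz,
    inner_conj_symm (𝕜 := ℂ) (E := formSpace hm hn) a (endRiesz hm hn)]
  ring

theorem endValue_endRiesz_add :
    formSpace.endValue (endRiesz hm hn + (1 - lam) • formSolve hm hn x)
      = formSpace.endValue (endRiesz hm hn) + (1 - lam) * ⟪endVec hm hn, x⟫_ℂ := by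
  rw [← inner_endRiesz, inner_add_right, inner_smul_formSolve, inner_endRiesz, inner_endRiesz,
    endValue_formSolve]

/-- The element `p` solves the weak problem with data `(1 - lam) x` and unit flux. Since its `L²`
part is `x`, this says `d_m d_n p = p - (1 - lam) p = lam p`. For any other solution with flux `φ`,
subtracting `φ p` leaves a decaying Neumann solution, which vanishes. -/
theorem isRadialNtD_iff [SFinite m] [SFinite n] (hlam : lam ∈ Complex.slitPlane)
    (hx : x = endVec hm hn + (1 - lam) • neumannResolvent hm hn x) (f : ℂ) :
    IsRadialNtD m n lam f ↔
      f = formSpace.endValue (endRiesz hm hn) + (1 - lam) * ⟪endVec hm hn, x⟫_ℂ := by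
  set p := endRiesz hm hn + (1 - lam) • formSolve hm hn x with hp
  have hw := hasCoordDeriv_of_weak (p := p) (fun a => inner_endRiesz_add (lam := lam) (x := x) a)
  have hp1 : p.1.fst = x := fst_endRiesz_add hx
  have hfun : (p.1.fst - (1 - lam) • x : Lp ℂ 2 m) =ᵐ[m] fun r => lam * formSpace.rep p r := by
    filter_upwards [Lp.coeFn_sub p.1.fst ((1 - lam) • x), Lp.coeFn_smul (1 - lam) x,
      formSpace.fst_ae_eq_rep p] with r h1 h2 h3
    rw [hp1] at h3
    rw [h1, Pi.sub_apply, h2, hp1, Pi.smul_apply, smul_eq_mul, h3]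
    ring
  have hw2 := hw.2.congr_ae hfun
  rw [← endValue_endRiesz_add, ← hp]
  constructor
  · rintro ⟨v, w, φ, ⟨hv, hvw⟩, h0, hφ, hφ0, rfl⟩
    have h1 := eq_zero_of_neumann_of_tendsto hm hn hlam (hv.sub (hw.1.const_mul φ))
      ((hvw.sub (hw2.const_mul φ)).congr_ae (ae_of_all _ fun r => by ring))
      (by simpa using! h0.sub ((formSpace.tendsto_rep p).const_mul φ))
      (by simp [← hφ]) 1 ⟨zero_lt_one, le_rfl⟩
    rw [formSpace.rep_one] at h1
    rw [div_eq_iff hφ0]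
    linear_combination h1
  · rintro rfl
    refine ⟨_, _, 1, ⟨hw.1, hw2⟩, formSpace.tendsto_rep p, by simp, one_ne_zero, ?_⟩
    rw [formSpace.rep_one, div_one]

/-- The energy identity for the solution with a real parameter. -/
theorem endValue_eq_energy {s : ℝ} (hs : 0 ≤ s)
    (hx : x = endVec hm hn + (1 - (s : ℂ)) • neumannResolvent hm hn x) :
    ∃ b : Lp ℂ 2 n, formSpace.endValue (endRiesz hm hn) + (1 - (s : ℂ)) * ⟪endVec hm hn, x⟫_ℂ
      = ((s * ‖x‖ ^ 2 + ‖b‖ ^ 2 : ℝ) : ℂ) ∧ ∀ a : ℝ, 0 < a → a < 1 →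
      √(m.real (Ioc a 1)) * (s * ‖x‖ ^ 2 + ‖b‖ ^ 2) ≤ ‖x‖
        + √(m.real (Ioc a 1)) * (√(n.real (Ioc a 1)) * ‖b‖) := by
  set p := endRiesz hm hn + (1 - (s : ℂ)) • formSolve hm hn x with hp
  have hp1 : p.1.fst = x := fst_endRiesz_add hx
  -- Testing the weak equation with the solution itself shows that its end value is its energy.
  have h1 := inner_endRiesz_add (lam := s) (x := x) p
  rw [← hp, Submodule.coe_inner, WithLp.prod_inner_apply, WithLp.ofLp_fst, WithLp.ofLp_snd, hp1,
    inner_smul_right, inner_self_eq_norm_sq_to_K, inner_self_eq_norm_sq_to_K, mul_one] at h1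
  have h2 : formSpace.endValue p = ((s * ‖x‖ ^ 2 + ‖p.1.snd‖ ^ 2 : ℝ) : ℂ) := by
    have h3 := congrArg conj h1
    simp only [map_add, map_mul, map_pow, map_sub, map_one, Complex.conj_conj,
      RCLike.ofReal_eq_complex_ofReal, Complex.conj_ofReal] at h3
    push_cast
    linear_combination -h3
  refine ⟨p.1.snd, by rw [← endValue_endRiesz_add, ← hp, h2], fun a ha ha1 => ?_⟩
  have h4 := formSpace.norm_endValue_le p ha ha1
  rwa [h2, hp1, Complex.norm_real, Real.norm_eq_abs, abs_of_nonneg (by positivity)] at h4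

end Solution

theorem IsRadial.tendsto_real_Ioc_one {ν : Measure ℝ} (hν : IsRadial ν) :
    Tendsto (fun a => ν.real (Ioc a 1)) (𝓝[<] 1) (𝓝 0) := by
  obtain ⟨K, -, hK⟩ := hν.integral_pow_le (1 / 2) (by norm_num)
  have h1 : Tendsto (fun a : ℝ => K * (1 - a)) (𝓝[<] 1) (𝓝 0) := by
    have : Tendsto (fun a : ℝ => K * (1 - a)) (𝓝 1) (𝓝 (K * (1 - 1))) :=
      (continuous_const.mul (continuous_const.sub continuous_id)).tendsto 1
    rw [sub_self, mul_zero] at this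
    exact this.mono_left nhdsWithin_le_nhds
  refine squeeze_zero' (Eventually.of_forall fun a => measureReal_nonneg) ?_ h1
  filter_upwards [Ioo_mem_nhdsLT (show (1 / 2 : ℝ) < 1 by norm_num)] with a ha
  have := (hK a ⟨ha.1, ha.2.le⟩ 0).2
  simpa using! this

/-- The values of the Neumann-to-Dirichlet function tend to `0` along the positive axis. -/
theorem tendsto_endValue_zero {x : ℕ → Lp ℂ 2 m}
    (hx : ∀ k : ℕ, x k = endVec hm hn + (1 - ((k + 1 : ℝ) : ℂ)) • neumannResolvent hm hn (x k)) :
    Tendsto (fun k : ℕ => formSpace.endValue (endRiesz hm hn)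
      + (1 - ((k + 1 : ℝ) : ℂ)) * ⟪endVec hm hn, x k⟫_ℂ) atTop (𝓝 0) := by
  choose b hb hb' using fun k : ℕ => endValue_eq_energy (s := (k : ℝ) + 1) (by positivity) (hx k)
  simp only [hb]
  rw [← Complex.ofReal_zero]
  refine (Complex.continuous_ofReal.tendsto 0).comp ?_
  set F : ℕ → ℝ := fun k => (k + 1 : ℝ) * ‖x k‖ ^ 2 + ‖b k‖ ^ 2 with hF
  have hF0 : ∀ k, 0 ≤ F k := fun k => by positivity
  -- The Sobolev inequality bounds the energy linearly in `‖x‖` and `‖b‖`; by Young's inequality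
  -- half of the energy is absorbed. One first takes `a` close to `1`, so that `n (a, 1]` is small,
  -- and then `k` large.
  have bound : ∀ a : ℝ, 0 < a → a < 1 → ∀ k : ℕ,
      F k ≤ 1 / m.real (Ioc a 1) * (1 / ((k : ℝ) + 1)) + n.real (Ioc a 1) := by
    intro a ha ha1 k
    have h1 := hb' k a ha ha1
    have hM : 0 < m.real (Ioc a 1) := ENNReal.toReal_pos (hm.pos a 1 ha.le ha1 le_rfl)
      (hm.measure_Ioc_lt_top ha 1).ne
    set s := √(m.real (Ioc a 1)) with hs
    have hs0 : 0 < s := Real.sqrt_pos.2 hM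
    have hs2 : m.real (Ioc a 1) = s ^ 2 := (Real.sq_sqrt hM.le).symm
    set N := √(n.real (Ioc a 1)) with hN
    have hN2 : n.real (Ioc a 1) = N ^ 2 := (Real.sq_sqrt measureReal_nonneg).symm
    rw [hs2, hN2]
    have hk : (0 : ℝ) < k + 1 := by positivity
    have h2 : F k ≤ ‖x k‖ / s + N * ‖b k‖ := by
      rw [← sub_le_iff_le_add, le_div_iff₀ hs0]
      have : s * F k ≤ ‖x k‖ + s * (N * ‖b k‖) := h1
      linarith
    have h3 : ‖x k‖ / s ≤ ((k : ℝ) + 1) * ‖x k‖ ^ 2 / 2 + 1 / s ^ 2 * (1 / ((k : ℝ) + 1)) / 2 := by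
      have : ((k : ℝ) + 1) * ‖x k‖ ^ 2 / 2 + 1 / s ^ 2 * (1 / ((k : ℝ) + 1)) / 2 - ‖x k‖ / s
          = ((k : ℝ) + 1) / 2 * (‖x k‖ - 1 / (s * ((k : ℝ) + 1))) ^ 2 := by
        field_simp; ring
      have h5 : 0 ≤ ((k : ℝ) + 1) / 2 * (‖x k‖ - 1 / (s * ((k : ℝ) + 1))) ^ 2 := by positivity
      linarith
    have h4 : N * ‖b k‖ ≤ ‖b k‖ ^ 2 / 2 + N ^ 2 / 2 := by nlinarith [sq_nonneg (N - ‖b k‖)]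
    have h5 : F k = (k + 1 : ℝ) * ‖x k‖ ^ 2 + ‖b k‖ ^ 2 := rfl
    linarith
  rw [Metric.tendsto_atTop]
  intro ε hε
  have h1 : ∀ᶠ a in 𝓝[<] (1 : ℝ), n.real (Ioc a 1) < ε / 2 :=
    hn.tendsto_real_Ioc_one.eventually_lt_const (by positivity)
  obtain ⟨a, ha, haI⟩ := (h1.and (Ioo_mem_nhdsLT (zero_lt_one' ℝ))).exists
  have h2 : Tendsto (fun k : ℕ => 1 / m.real (Ioc a 1) * (1 / ((k : ℝ) + 1))) atTop (𝓝 0) := by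
    simpa using! (tendsto_one_div_add_atTop_nhds_zero_nat (𝕜 := ℝ)).const_mul (1 / m.real (Ioc a 1))
  obtain ⟨K, hK⟩ := eventually_atTop.1 (h2.eventually_lt_const (show 0 < ε / 2 by positivity))
  refine ⟨K, fun k hk => ?_⟩
  rw [Real.dist_0_eq_abs, abs_of_nonneg (hF0 k)]
  linarith [bound a haI.1 haI.2 k, hK k hk]

/-- A priori only `1 / (1 - t)²` is integrable. The stronger integrability and the value come from
decay of the Neumann-to-Dirichlet function at the points `k + 1`, where it equals the end value of
`ψ` minus `∫ f k dμ`. -/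
theorem IsSpectralRep.integral_one_div_one_sub
    {U : Lp ℂ 2 m ≃ₗᵢ[ℂ] Lp ℂ 2 μ}
    (h : IsSpectralRep (neumannResolvent hm hn) (endVec hm hn) μ U) :
    Integrable (fun t : ℝ => 1 / (1 - (t : ℂ))) μ ∧
    ∫ t : ℝ, 1 / (1 - (t : ℂ)) ∂μ = formSpace.endValue (endRiesz hm hn) := by
  have hslit : ∀ k : ℕ, ((k + 1 : ℝ) : ℂ) ∈ Complex.slitPlane := fun k =>
    Complex.ofReal_mem_slitPlane.2 (by positivity)
  choose x hx hx' using fun k => h.exists_solution (hslit k)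
  have hlim := tendsto_endValue_zero hx
  obtain ⟨b, hb, -⟩ := endValue_eq_energy (hm := hm) (hn := hn) (s := 1) zero_le_one
    (x := endVec hm hn) (by simp)
  rw [Complex.ofReal_one, sub_self, zero_mul, add_zero] at hb
  set E : ℝ := 1 * ‖endVec hm hn‖ ^ 2 + ‖b‖ ^ 2 with hE
  -- Here `k = lam - 1` for `lam = k + 1`. On the half line `f k` equals `1 / (1 - t) - 1 / (k + 1 -
  -- t)` and increases to `1 / (1 - t)`, so monotone convergence applies.
  set f : ℕ → ℝ → ℝ := fun k t => k * (1 / (1 - t) * (1 / (k + 1 - t))) with hf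
  have hfi : ∀ k, Integrable (f k) μ := by
    intro k
    have h1 := (MemLp.integrable_mul (p := 2) (q := 2)
      (h.memLp_one_div_sub Complex.one_mem_slitPlane) (h.memLp_one_div_sub (hslit k))).const_mul
      (k : ℂ)
    refine h1.re.congr (ae_of_all _ fun t => ?_)
    have : (k : ℂ) * (((fun t : ℝ => 1 / (1 - (t : ℂ))) * fun t : ℝ => 1 / (((k + 1 : ℝ) : ℂ) - t)) t)
        = ((f k t : ℝ) : ℂ) := by
      simp only [hf, Pi.mul_apply]; push_cast; ring
    simp only [this]
    exact Complex.ofReal_re _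
  have hfint : ∀ k, ((∫ t, f k t ∂μ : ℝ) : ℂ) = (k : ℂ) * ⟪endVec hm hn, x k⟫_ℂ := by
    intro k
    rw [hx', ← integral_complex_ofReal, ← integral_const_mul]
    congr 1; ext t
    simp only [hf]; push_cast; ring
  have hlim2 : Tendsto (fun k => ∫ t, f k t ∂μ) atTop (𝓝 E) := by
    have h1 : Tendsto (fun k => ((E - ∫ t, f k t ∂μ : ℝ) : ℂ)) atTop (𝓝 ((0 : ℝ) : ℂ)) := by
      rw [Complex.ofReal_zero]
      refine hlim.congr fun k => ?_
      rw [hb, Complex.ofReal_sub, hfint]; push_cast; ring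
    have h2 : Tendsto (fun k => E - ∫ t, f k t ∂μ) atTop (𝓝 0) := by
      simpa using! (Complex.continuous_re.tendsto _).comp h1
    simpa using! h2.const_sub E
  have hf0 : ∀ k t, t ≤ 0 → 0 ≤ f k t := by
    intro k t ht
    have h1 : 0 < 1 - t := by linarith
    have h2 : 0 < (k : ℝ) + 1 - t := by linarith [(k.cast_nonneg : (0 : ℝ) ≤ k)]
    positivity
  have hl : Tendsto (fun k => ∫⁻ t, ENNReal.ofReal (f k t) ∂μ) atTop
      (𝓝 (∫⁻ t, ENNReal.ofReal (1 / (1 - t)) ∂μ)) := by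
    refine lintegral_tendsto_of_tendsto_of_monotone
      (fun k => (hfi k).aestronglyMeasurable.aemeasurable.ennreal_ofReal) ?_ ?_
    · filter_upwards [h.ae_nonpos] with t ht i j hij
      have hij' : (i : ℝ) ≤ j := by exact_mod_cast hij
      have hi : (0 : ℝ) ≤ i := i.cast_nonneg
      refine ENNReal.ofReal_le_ofReal ?_
      simp only [hf]
      have h1 : 0 < 1 - t := by linarith
      have h2 : 0 < (i : ℝ) + 1 - t := by linarith
      have h3 : 0 < (j : ℝ) + 1 - t := by linarith
      have e : ∀ k : ℝ, k * (1 / (1 - t) * (1 / (k + 1 - t))) = 1 / (1 - t) * (k / (k + 1 - t)) :=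
        fun k => by ring
      rw [e, e]
      refine mul_le_mul_of_nonneg_left ?_ (by positivity)
      rw [div_le_div_iff₀ h2 h3]
      nlinarith
    · filter_upwards [h.ae_nonpos] with t ht
      refine ENNReal.tendsto_ofReal ?_
      have h1 : 0 < 1 - t := by linarith
      have e : ∀ k : ℕ, f k t = 1 / (1 - t) - 1 / (k + 1 - t) := by
        intro k
        have h2 : 0 < (k : ℝ) + 1 - t := by linarith [(k.cast_nonneg : (0 : ℝ) ≤ k)]
        simp only [hf]
        field_simp
        ring
      simp only [e]
      have h3 : Tendsto (fun k : ℕ => (1 : ℝ) / (k + 1 - t)) atTop (𝓝 0) := by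
        simp only [one_div]
        refine tendsto_inv_atTop_zero.comp ?_
        refine (tendsto_atTop_add_const_right _ (1 - t) tendsto_natCast_atTop_atTop).congr fun k => ?_
        ring
      simpa using! h3.const_sub (1 / (1 - t))
  have hl2 : Tendsto (fun k => ∫⁻ t, ENNReal.ofReal (f k t) ∂μ) atTop (𝓝 (ENNReal.ofReal E)) := by
    refine (ENNReal.tendsto_ofReal hlim2).congr fun k => ?_
    refine ofReal_integral_eq_lintegral_ofReal (hfi k) ?_
    filter_upwards [h.ae_nonpos] with t ht using hf0 k t ht
  have hval := tendsto_nhds_unique hl hl2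
  have hg0 : 0 ≤ᵐ[μ] fun t : ℝ => 1 / (1 - t) := by
    filter_upwards [h.ae_nonpos] with t ht
    have h1 : 0 < 1 - t := by linarith
    simp only [Pi.zero_apply]; positivity
  have hgm : AEStronglyMeasurable (fun t : ℝ => 1 / (1 - t)) μ :=
    Measurable.aestronglyMeasurable (by fun_prop)
  have hgi : Integrable (fun t : ℝ => 1 / (1 - t)) μ := by
    refine ⟨hgm, ?_⟩
    rw [hasFiniteIntegral_iff_ofReal hg0, hval]
    exact ENNReal.ofReal_lt_top
  have hgv : ∫ t : ℝ, 1 / (1 - t) ∂μ = E := by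
    rw [integral_eq_lintegral_of_nonneg_ae hg0 hgm, hval, ENNReal.toReal_ofReal (by positivity)]
  have e : (fun t : ℝ => 1 / (1 - (t : ℂ))) = fun t : ℝ => ((1 / (1 - t) : ℝ) : ℂ) := by
    ext t; push_cast; rfl
  rw [e]
  exact ⟨hgi.ofReal, by rw [integral_complex_ofReal, hgv, hb]⟩

/-- The Neumann-to-Dirichlet function is the Stieltjes transform of the spectral measure. -/
theorem IsSpectralRep.isRadialNtD_iff [SFinite m] [SFinite n]
    {U : Lp ℂ 2 m ≃ₗᵢ[ℂ] Lp ℂ 2 μ}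
    (h : IsSpectralRep (neumannResolvent hm hn) (endVec hm hn) μ U) {lam : ℂ}
    (hlam : lam ∈ Complex.slitPlane) :
    IntegrableOn (fun t : ℝ => 1 / (lam - (t : ℂ))) (Iic 0) μ ∧
    ∀ f : ℂ, IsRadialNtD m n lam f ↔ f = ∫ t in Iic (0 : ℝ), 1 / (lam - (t : ℂ)) ∂μ := by
  have hr : μ.restrict (Iic 0) = μ := Measure.restrict_eq_self_of_ae_mem h.ae_nonpos
  rw [IntegrableOn, hr]
  obtain ⟨hi, hv⟩ := h.integral_one_div_one_sub
  have hli : Integrable (fun t : ℝ => 1 / (lam - (t : ℂ))) μ := by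
    obtain ⟨C, hC0, hC⟩ := exists_norm_one_sub_le hlam
    refine (hi.norm.const_mul C).mono' (measurable_one_div_sub lam).aestronglyMeasurable ?_
    filter_upwards [h.ae_nonpos] with t h2
    rw [norm_div, norm_div, norm_one, ← mul_div_assoc, mul_one,
      div_le_div_iff₀ (norm_pos_iff.2 (sub_ofReal_ne_zero_of_mem_slitPlane hlam h2))
        (norm_pos_iff.2 (one_sub_ofReal_ne_zero h2)), one_mul]
    exact hC t h2
  refine ⟨hli, fun f => ?_⟩
  obtain ⟨x, hx, hx'⟩ := h.exists_solution hlam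
  rw [_root_.isRadialNtD_iff hlam hx, ← hv, hx', ← integral_const_mul, ← integral_add hi]
  -- The partial fraction `1 / (lam - t) = 1 / (1 - t) + (1 - lam) / ((1 - t) (lam - t))`.
  · refine Eq.congr_right (integral_congr_ae ?_)
    filter_upwards [h.ae_nonpos] with t ht
    have := one_sub_ofReal_ne_zero ht
    have := sub_ofReal_ne_zero_of_mem_slitPlane hlam ht
    field_simp
    ring
  · exact (MemLp.integrable_mul (p := 2) (q := 2)
      (h.memLp_one_div_sub Complex.one_mem_slitPlane) (h.memLp_one_div_sub hlam)).const_mul _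

end Impedance

/-! ### Return to the conductivity: the spectral measure of the string. -/

section String

variable {σ : ℝ → ℝ} {c C : ℝ} {μ : Measure ℝ}

/-- The spectral measures of the string are those of the spectral representations of
the resolvent. -/
theorem isStringSpectralMeasure_iff (hm : IsRadial (dzhatMeasure σ)) (hn : IsRadial (dzMeasure σ)) :
    IsStringSpectralMeasure σ μ ↔ ∃ U : Lp ℂ 2 (dzhatMeasure σ) ≃ₗᵢ[ℂ] Lp ℂ 2 μ,
      IsSpectralRep (neumannResolvent hm hn) (endVec hm hn) μ U := by
  constructor
  · rintro ⟨hμ, h0, Φ, U, hΦ, hU, hg⟩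
    refine ⟨U, isSpectralRep_of_transform h0 (fun a ha ha1 f hf => ?_)
      fun v g hvg => (hg v g).1 ((exists_hasCoordDeriv_iff v g).2 hvg)⟩
    refine (hU _ ⟨a, ha, ha1, rfl⟩ f hf).trans (ae_of_all _ fun t => ?_)
    obtain ⟨w, ⟨h1, h2⟩, h3, h4⟩ := hΦ t
    refine integral_congr_ae ?_
    filter_upwards [hm.ae_mem] with r hr
    rw [eq_fundSol hm hn h1 h2 h3 h4 r hr]
  · rintro ⟨U, h⟩
    refine ⟨h.locallyFinite, h.nonpos, fundSol (dzhatMeasure σ) (dzMeasure σ), U, fun t => ?_, ?_,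
      fun v g => (exists_hasCoordDeriv_iff v g).trans (h.eq_apply_sub_iff v g)⟩
    · exact ⟨_, (continuousOn_fundSol hm hn t).2, fundSol_one t, by simp⟩
    · rintro _ ⟨a, ha, -, rfl⟩ f hf
      exact h.ae_eq_integral ha hf

theorem existsUnique_isStringSpectralMeasure (hc : 0 < c)
    (hσ : ∀ᵐ r ∂(volume.restrict (Ioc (0 : ℝ) 1)), c ≤ σ r ∧ σ r ≤ C) :
    ∃! μ : Measure ℝ, IsStringSpectralMeasure σ μ := by
  have hm := isRadial_dzhatMeasure hc hσ
  have hn := isRadial_dzMeasure hc hσ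
  obtain ⟨μ, U, h⟩ := exists_isSpectralRep_neumannResolvent hm hn
  refine ⟨μ, (isStringSpectralMeasure_iff hm hn).2 ⟨U, h⟩, fun ν hν => ?_⟩
  obtain ⟨V, h'⟩ := (isStringSpectralMeasure_iff hm hn).1 hν
  exact h'.measure_unique h

theorem isNtDValue_iff_integral (hc : 0 < c)
    (hσ : ∀ᵐ r ∂(volume.restrict (Ioc (0 : ℝ) 1)), c ≤ σ r ∧ σ r ≤ C)
    (hμ : IsStringSpectralMeasure σ μ) {lam : ℂ} (hlam : lam ∈ Complex.slitPlane) :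
    IntegrableOn (fun t : ℝ => 1 / (lam - (t : ℂ))) (Iic 0) μ ∧
    ∀ f : ℂ, IsNtDValue σ lam f ↔ f = ∫ t in Iic (0 : ℝ), 1 / (lam - (t : ℂ)) ∂μ := by
  obtain ⟨U, h⟩ := (isStringSpectralMeasure_iff (isRadial_dzhatMeasure hc hσ)
    (isRadial_dzMeasure hc hσ)).1 hμ
  exact h.isRadialNtD_iff hlam

end String

end

section

section Difference

variable {ℓ : ℕ} {α αh : ℕ → ℝ}

/-! ### The difference equation -/

/-- Symmetry for the weighted inner product: adjacent nodes share the conductance `1 / α` of the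
link between them. -/
theorem jacobiA_mul_comm (hα : ∀ j, j ≤ ℓ → 0 < α j) (hαh : ∀ j, 1 ≤ j → j ≤ ℓ → 0 < αh j)
    (p q : Fin ℓ) : αh (p + 1) * jacobiA ℓ α αh p q = αh (q + 1) * jacobiA ℓ α αh q p := by
  have key : ∀ p q : Fin ℓ, p < q →
      αh (p + 1) * jacobiA ℓ α αh p q = αh (q + 1) * jacobiA ℓ α αh q p := by
    intro p q hpq
    have hpq' : (p : ℕ) < q := hpq
    have hp := (hαh (p + 1) (by omega) (by omega)).ne'
    have hq := (hαh (q + 1) (by omega) (by omega)).ne'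
    have hq0 : (q : ℕ) ≠ 0 := by omega
    have hpα := (hα (p + 1) (by omega)).ne'
    by_cases h : (q : ℕ) = p + 1
    · have h1 : jacobiA ℓ α αh p q = 1 / (αh (p + 1) * α (p + 1)) := by
        have e1 : (p : ℕ) + 1 + 1 ≠ p := by omega
        by_cases hp0 : (p : ℕ) = 0 <;> simp [jacobiA, h, hp0, e1]
      have h2 : jacobiA ℓ α αh q p = 1 / (αh (q + 1) * α (p + 1)) := by
        have e1 : (p : ℕ) ≠ p + 1 + 1 := by omega
        simp [jacobiA, h, e1]
      rw [h1, h2]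
      field_simp
    · have h1 : jacobiA ℓ α αh p q = 0 := by
        by_cases hp0 : (p : ℕ) = 0
        · have : (q : ℕ) ≠ 1 := by omega
          simp [jacobiA, hp0, hq0, this]
        · have e1 : (q : ℕ) ≠ p := by omega
          have e2 : (q : ℕ) + 1 ≠ p := by omega
          simp [jacobiA, hp0, h, e1, e2]
      have h2 : jacobiA ℓ α αh q p = 0 := by
        have e1 : (p : ℕ) ≠ q := by omega
        have e2 : (p : ℕ) + 1 ≠ q := by omega
        have e3 : (p : ℕ) ≠ q + 1 := by omega
        simp [jacobiA, hq0, e1, e2, e3]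
      rw [h1, h2, mul_zero, mul_zero]
  rcases lt_trichotomy p q with h | h | h
  · exact key p q h
  · rw [h]
  · exact (key q p h).symm

theorem sum_fin_ite_mul (V : ℕ → ℂ) (hV : V (ℓ + 1) = 0) {k : ℕ} (hk : 1 ≤ k) (hk' : k ≤ ℓ + 1) :
    ∑ q : Fin ℓ, (if (q : ℕ) + 1 = k then 1 else 0) * V (q + 1) = V k := by
  rcases hk'.eq_or_lt with rfl | h
  · rw [hV]
    refine Finset.sum_eq_zero fun q _ => ?_
    rw [if_neg (by omega), zero_mul]
  · rw [Finset.sum_eq_single (⟨k - 1, by omega⟩ : Fin ℓ)]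
    · have : k - 1 + 1 = k := by omega
      simp [this]
    · intro q _ hq
      rw [if_neg, zero_mul]
      intro h1
      apply hq
      ext
      simp only
      omega
    · simp

/-- The difference operator is the weighted Jacobi matrix plus the boundary term. -/
theorem diffOp_eq_sum (hα : ∀ j, j ≤ ℓ → 0 < α j) (hαh : ∀ j, 1 ≤ j → j ≤ ℓ → 0 < αh j)
    (V : ℕ → ℂ) (hV : V (ℓ + 1) = 0) (p : Fin ℓ) :
    diffOp α αh V (p + 1) = ∑ q : Fin ℓ, (jacobiA ℓ α αh p q : ℂ) * V (q + 1)
      + if (p : ℕ) = 0 then (V 0 - V 1) / (α 0 : ℂ) / (αh 1 : ℂ) else 0 := by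
  have hp : (αh (p + 1) : ℂ) ≠ 0 := by
    exact_mod_cast (hαh (p + 1) (by omega) (by omega)).ne'
  have hpα : (α (p + 1) : ℂ) ≠ 0 := by exact_mod_cast (hα (p + 1) (by omega)).ne'
  have hpα0 : (α p : ℂ) ≠ 0 := by exact_mod_cast (hα p (by omega)).ne'
  by_cases h0 : (p : ℕ) = 0
  · rw [if_pos h0, diffOp]
    have h1 : ∀ q : Fin ℓ, (jacobiA ℓ α αh p q : ℂ) * V (q + 1)
        = -(1 / (αh 1 * α 1 : ℂ)) * ((if (q : ℕ) + 1 = 1 then 1 else 0) * V (q + 1))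
          + 1 / (αh 1 * α 1 : ℂ) * ((if (q : ℕ) + 1 = 2 then 1 else 0) * V (q + 1)) := by
      intro q
      simp only [jacobiA, Matrix.of_apply, h0, zero_add, if_true]
      split_ifs <;> push_cast <;> ring
    simp only [h1]
    rw [Finset.sum_add_distrib, ← Finset.mul_sum, ← Finset.mul_sum, sum_fin_ite_mul V hV le_rfl
      (by omega), sum_fin_ite_mul V hV (by norm_num) (by have := p.2; omega)]
    simp only [h0, zero_add, Nat.reduceAdd, Nat.sub_self] at hp hpα hpα0 ⊢
    field_simp
    ring
  · rw [if_neg h0, add_zero, diffOp]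
    have h1 : ∀ q : Fin ℓ, (jacobiA ℓ α αh p q : ℂ) * V (q + 1)
        = -(1 / (αh (p + 1) : ℂ) * (1 / α (p + 1) + 1 / α p))
            * ((if (q : ℕ) + 1 = p + 1 then 1 else 0) * V (q + 1))
          + 1 / (αh (p + 1) * α p : ℂ) * ((if (q : ℕ) + 1 = p then 1 else 0) * V (q + 1))
          + 1 / (αh (p + 1) * α (p + 1) : ℂ)
            * ((if (q : ℕ) + 1 = p + 1 + 1 then 1 else 0) * V (q + 1)) := by
      intro q
      have : (p : ℕ) + 1 ≠ 1 := by omega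
      simp only [jacobiA, Matrix.of_apply, if_neg this, Nat.add_sub_cancel]
      split_ifs <;> push_cast <;> ring
    simp only [h1]
    rw [Finset.sum_add_distrib, Finset.sum_add_distrib, ← Finset.mul_sum, ← Finset.mul_sum,
      ← Finset.mul_sum, sum_fin_ite_mul V hV (by omega) (by omega),
      sum_fin_ite_mul V hV (by omega) (by omega), sum_fin_ite_mul V hV (by omega) (by omega)]
    simp only [Nat.add_sub_cancel]
    field_simp
    ring

theorem diffOp_eq_iff {V : ℕ → ℂ} {j : ℕ} {x : ℂ} (hαj : α j ≠ 0) (hαhj : αh j ≠ 0) :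
    diffOp α αh V j = x ↔
      V (j + 1) = V j + α j * ((V j - V (j - 1)) / α (j - 1) + αh j * x) := by
  have h1 : (α j : ℂ) ≠ 0 := by exact_mod_cast hαj
  have h2 : (αh j : ℂ) ≠ 0 := by exact_mod_cast hαhj
  rw [diffOp, one_div, inv_mul_eq_iff_eq_mul₀ h2, sub_eq_iff_eq_add, div_eq_iff h1, sub_eq_iff_eq_add]
  constructor <;> intro h <;> rw [h] <;> ring

theorem eq_of_diffOp_eq (hα : ∀ j, j ≤ ℓ → 0 < α j) (hαh : ∀ j, 1 ≤ j → j ≤ ℓ → 0 < αh j)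
    {V W : ℕ → ℂ} {t : ℂ} (hV : ∀ j, 1 ≤ j → j ≤ ℓ → diffOp α αh V j = t * V j)
    (hW : ∀ j, 1 ≤ j → j ≤ ℓ → diffOp α αh W j = t * W j) (h0 : V 0 = W 0) (h1 : V 1 = W 1) :
    ∀ k ≤ ℓ + 1, V k = W k := by
  have key : ∀ k ≤ ℓ, V k = W k ∧ V (k + 1) = W (k + 1) := by
    intro k
    induction k with
    | zero => exact fun _ => ⟨h0, h1⟩
    | succ k ih =>
      intro hk
      obtain ⟨i1, i2⟩ := ih (by omega)
      refine ⟨i2, ?_⟩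
      have e1 := (diffOp_eq_iff (hα _ hk).ne' (hαh _ (by omega) hk).ne').1 (hV (k + 1) (by omega) hk)
      have e2 := (diffOp_eq_iff (hα _ hk).ne' (hαh _ (by omega) hk).ne').1 (hW (k + 1) (by omega) hk)
      rw [e1, e2, Nat.add_sub_cancel, i1, i2]
  intro k hk
  rcases k with _ | k
  · exact h0
  · exact (key k (by omega)).2

/-- The solution of the difference equation with `V₀ = V₁ = 1`, with its predecessor. -/
def diffSolPair (α αh : ℕ → ℝ) (t : ℝ) : ℕ → ℂ × ℂ
  | 0 => (1, 1)
  | k + 1 => ((diffSolPair α αh t k).2, (diffSolPair α αh t k).2 + α (k + 1) *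
      (((diffSolPair α αh t k).2 - (diffSolPair α αh t k).1) / α k
        + αh (k + 1) * (t * (diffSolPair α αh t k).2)))

/-- The solution of the difference equation with `V₀ = V₁ = 1`. -/
def diffSol (α αh : ℕ → ℝ) (t : ℝ) (k : ℕ) : ℂ := (diffSolPair α αh t k).1

theorem diffSol_zero (t : ℝ) : diffSol α αh t 0 = 1 := rfl

theorem diffSol_one (t : ℝ) : diffSol α αh t 1 = 1 := rfl

theorem diffOp_diffSol (hα : ∀ j, j ≤ ℓ → 0 < α j) (hαh : ∀ j, 1 ≤ j → j ≤ ℓ → 0 < αh j) (t : ℝ)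
    (j : ℕ) (hj : 1 ≤ j) (hj' : j ≤ ℓ) :
    diffOp α αh (diffSol α αh t) j = t * diffSol α αh t j := by
  rw [diffOp_eq_iff (hα j hj').ne' (hαh j hj hj').ne']
  obtain ⟨k, rfl⟩ : ∃ k, j = k + 1 := ⟨j - 1, by omega⟩
  rfl

/-- The sequence with the initial value `x₀`, the entries of `x` and the final value `0`. -/
def nodeExtend (x₀ : ℂ) (x : Fin ℓ → ℂ) (k : ℕ) : ℂ :=
  if k = 0 then x₀ else if h : k - 1 < ℓ then x ⟨k - 1, h⟩ else 0

theorem nodeExtend_zero (x₀ : ℂ) (x : Fin ℓ → ℂ) : nodeExtend x₀ x 0 = x₀ := rfl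

theorem nodeExtend_succ (x₀ : ℂ) (x : Fin ℓ → ℂ) (p : Fin ℓ) :
    nodeExtend x₀ x (p + 1) = x p := by simp [nodeExtend]

theorem nodeExtend_last (x₀ : ℂ) (x : Fin ℓ → ℂ) : nodeExtend x₀ x (ℓ + 1) = 0 := by
  simp [nodeExtend]

theorem nodeExtend_one (hℓ : 0 < ℓ) (x₀ : ℂ) (x : Fin ℓ → ℂ) : nodeExtend x₀ x 1 = x ⟨0, hℓ⟩ :=
  nodeExtend_succ x₀ x ⟨0, hℓ⟩

/-- Repeating the first entry at node `0` imposes the Neumann condition, so the boundary term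
vanishes. -/
theorem diffOp_nodeExtend (hα : ∀ j, j ≤ ℓ → 0 < α j) (hαh : ∀ j, 1 ≤ j → j ≤ ℓ → 0 < αh j)
    (hℓ : 0 < ℓ) (x : Fin ℓ → ℂ) (p : Fin ℓ) :
    diffOp α αh (nodeExtend (x ⟨0, hℓ⟩) x) (p + 1) = ∑ q : Fin ℓ, (jacobiA ℓ α αh p q : ℂ) * x q := by
  rw [diffOp_eq_sum hα hαh _ (nodeExtend_last _ _), nodeExtend_zero, nodeExtend_one hℓ]
  simp [nodeExtend_succ]

theorem mem_diffGraph_iff (hα : ∀ j, j ≤ ℓ → 0 < α j) (hαh : ∀ j, 1 ≤ j → j ≤ ℓ → 0 < αh j)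
    (hℓ : 0 < ℓ) (v g : Lp ℂ 2 (nodeMeasure ℓ αh)) : (v, g) ∈ diffGraph ℓ α αh ↔
      ∀ p, g p = ∑ q : Fin ℓ, (jacobiA ℓ α αh p q : ℂ) * v q := by
  constructor
  · rintro ⟨V, h01, hl, hV⟩ p
    rw [(hV p).2, diffOp_eq_sum hα hαh V hl, h01]
    simp [(hV _).1]
  · intro h
    exact ⟨nodeExtend (v ⟨0, hℓ⟩) v, (nodeExtend_one hℓ _ _).symm, nodeExtend_last _ _, fun p =>
      ⟨(nodeExtend_succ _ _ p).symm, (h p).trans (diffOp_nodeExtend hα hαh hℓ v p).symm⟩⟩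

/-- Eigenvectors of the Jacobi matrix solve the difference equation. -/
theorem diffOp_nodeExtend_eigenvector (hα : ∀ j, j ≤ ℓ → 0 < α j)
    (hαh : ∀ j, 1 ≤ j → j ≤ ℓ → 0 < αh j) (hℓ : 0 < ℓ) {y : Fin ℓ → ℝ} {t : ℝ}
    (hy : (jacobiA ℓ α αh).mulVec y = t • y) (j : ℕ) (hj : 1 ≤ j) (hj' : j ≤ ℓ) :
    diffOp α αh (nodeExtend (y ⟨0, hℓ⟩) fun p => (y p : ℂ)) j
      = t * nodeExtend (y ⟨0, hℓ⟩) (fun p => (y p : ℂ)) j := by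
  obtain ⟨p, rfl⟩ : ∃ p : Fin ℓ, j = p + 1 := ⟨⟨j - 1, by omega⟩, by simp; omega⟩
  rw [diffOp_nodeExtend hα hαh hℓ (fun p => (y p : ℂ)), nodeExtend_succ]
  have := congrFun hy p
  rw [Matrix.mulVec, dotProduct, Pi.smul_apply, smul_eq_mul] at this
  exact_mod_cast this

/-- A second order recurrence is determined by its first two values, and the Neumann condition makes
these equal. The Dirichlet condition at the last node is what remains as the second conclusion. -/
theorem eigenvector_eq_mul_diffSol (hα : ∀ j, j ≤ ℓ → 0 < α j)
    (hαh : ∀ j, 1 ≤ j → j ≤ ℓ → 0 < αh j) (hℓ : 0 < ℓ) {y : Fin ℓ → ℝ} {t : ℝ}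
    (hy : (jacobiA ℓ α αh).mulVec y = t • y) :
    (∀ p : Fin ℓ, (y p : ℂ) = y ⟨0, hℓ⟩ * diffSol α αh t (p + 1)) ∧
      (y ⟨0, hℓ⟩ : ℂ) * diffSol α αh t (ℓ + 1) = 0 := by
  have h2 : ∀ j, 1 ≤ j → j ≤ ℓ → diffOp α αh (fun k => y ⟨0, hℓ⟩ * diffSol α αh t k) j
      = t * (y ⟨0, hℓ⟩ * diffSol α αh t j) := by
    intro j hj hj'
    have := diffOp_diffSol hα hαh t j hj hj'
    rw [mul_left_comm, ← this, diffOp, diffOp]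
    ring
  have h3 := eq_of_diffOp_eq hα hαh (diffOp_nodeExtend_eigenvector hα hαh hℓ hy) h2
    (by rw [nodeExtend_zero, diffSol_zero, mul_one])
    (by rw [nodeExtend_one hℓ, diffSol_one, mul_one])
  refine ⟨fun p => ?_, ?_⟩
  · rw [← h3 (p + 1) (by omega), nodeExtend_succ]
  · rw [← h3 (ℓ + 1) le_rfl, nodeExtend_last]

theorem eigenvector_first_ne_zero (hα : ∀ j, j ≤ ℓ → 0 < α j)
    (hαh : ∀ j, 1 ≤ j → j ≤ ℓ → 0 < αh j) (hℓ : 0 < ℓ) {y : Fin ℓ → ℝ} {t : ℝ}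
    (hy : (jacobiA ℓ α αh).mulVec y = t • y) (hy0 : y ≠ 0) : y ⟨0, hℓ⟩ ≠ 0 := by
  intro h
  apply hy0
  ext p
  have := (eigenvector_eq_mul_diffSol hα hαh hℓ hy).1 p
  rw [h, Complex.ofReal_zero, zero_mul] at this
  exact_mod_cast this

/-- For `t ≥ 0` the fundamental solution is at least `1`. -/
theorem exists_one_le_diffSol (hα : ∀ j, j ≤ ℓ → 0 < α j)
    (hαh : ∀ j, 1 ≤ j → j ≤ ℓ → 0 < αh j) {t : ℝ} (ht : 0 ≤ t) :
    ∀ k ≤ ℓ, ∃ a b : ℝ, diffSol α αh t k = a ∧ diffSol α αh t (k + 1) = b ∧ 1 ≤ a ∧ a ≤ b := by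
  intro k
  induction k with
  | zero => exact fun _ => ⟨1, 1, by simp [diffSol_zero], by simp [diffSol_one], le_rfl, le_rfl⟩
  | succ k ih =>
    intro hk
    obtain ⟨a, b, h1, h2, h3, h4⟩ := ih (by omega)
    have e := (diffOp_eq_iff (hα _ hk).ne' (hαh _ (by omega) hk).ne').1
      (diffOp_diffSol hα hαh t (k + 1) (by omega) hk)
    rw [Nat.add_sub_cancel, h1, h2] at e
    refine ⟨b, b + α (k + 1) * ((b - a) / α k + αh (k + 1) * (t * b)), h2, by exact_mod_cast e,
      h3.trans h4, ?_⟩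
    have h5 := hα (k + 1) hk
    have h6 := hα k (by omega)
    have h7 := hαh (k + 1) (by omega) hk
    have h8 : 0 ≤ b - a := by linarith
    have h9 : 0 ≤ b := by linarith
    have : 0 ≤ α (k + 1) * ((b - a) / α k + αh (k + 1) * (t * b)) := by positivity
    linarith

/-- For `t ≥ 0` the fundamental solution stays at least `1` and cannot satisfy the Dirichlet
condition at node `ℓ + 1`. -/
theorem eigenvalue_neg (hα : ∀ j, j ≤ ℓ → 0 < α j)
    (hαh : ∀ j, 1 ≤ j → j ≤ ℓ → 0 < αh j) (hℓ : 0 < ℓ) {y : Fin ℓ → ℝ} {t : ℝ}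
    (hy : (jacobiA ℓ α αh).mulVec y = t • y) (hy0 : y ≠ 0) : t < 0 := by
  by_contra ht
  obtain ⟨a, b, -, h2, h3, h4⟩ := exists_one_le_diffSol hα hαh (not_lt.1 ht) ℓ le_rfl
  have h5 := (eigenvector_eq_mul_diffSol hα hαh hℓ hy).2
  rw [h2] at h5
  have h6 : y ⟨0, hℓ⟩ * b = 0 := by exact_mod_cast h5
  rcases mul_eq_zero.1 h6 with h | h
  · exact eigenvector_first_ne_zero hα hαh hℓ hy hy0 h
  · linarith

/-- The symmetric matrix similar to the weighted Jacobi matrix. -/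
def symmJacobi (ℓ : ℕ) (α αh : ℕ → ℝ) : Matrix (Fin ℓ) (Fin ℓ) ℝ :=
  Matrix.of fun p q => √(αh (p + 1)) * jacobiA ℓ α αh p q * (√(αh (q + 1)))⁻¹

theorem isHermitian_symmJacobi (hα : ∀ j, j ≤ ℓ → 0 < α j)
    (hαh : ∀ j, 1 ≤ j → j ≤ ℓ → 0 < αh j) : (symmJacobi ℓ α αh).IsHermitian := by
  ext p q
  have hp := hαh (p + 1) (by omega) (by omega)
  have hq := hαh (q + 1) (by omega) (by omega)
  have h := jacobiA_mul_comm hα hαh p q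
  have hp' := Real.sqrt_pos.2 hp
  have hq' := Real.sqrt_pos.2 hq
  rw [← Real.mul_self_sqrt hp.le, ← Real.mul_self_sqrt hq.le] at h
  simp only [Matrix.conjTranspose_apply, symmJacobi, Matrix.of_apply, star_trivial]
  field_simp
  linear_combination -h

theorem charpoly_symmJacobi (hαh : ∀ j, 1 ≤ j → j ≤ ℓ → 0 < αh j) :
    (symmJacobi ℓ α αh).charpoly = (jacobiA ℓ α αh).charpoly := by
  have hne : ∀ p : Fin ℓ, √(αh (p + 1)) ≠ 0 := fun p =>
    (Real.sqrt_pos.2 (hαh (p + 1) (by omega) (by omega))).ne'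
  let M : (Matrix (Fin ℓ) (Fin ℓ) ℝ)ˣ :=
    { val := Matrix.diagonal fun p => √(αh (p + 1))
      inv := Matrix.diagonal fun p => (√(αh (p + 1)))⁻¹
      val_inv := by simp [Matrix.diagonal_mul_diagonal, hne]
      inv_val := by simp [Matrix.diagonal_mul_diagonal, hne] }
  have : symmJacobi ℓ α αh = M.val * jacobiA ℓ α αh * (M⁻¹).val := by
    ext p q
    change _ = ((Matrix.diagonal fun p : Fin ℓ => √(αh (p + 1))) * jacobiA ℓ α αh
      * Matrix.diagonal fun p : Fin ℓ => (√(αh (p + 1)))⁻¹) p q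
    rw [Matrix.mul_diagonal, Matrix.diagonal_mul]
    rfl
  rw [this, Matrix.coe_units_inv, Matrix.charpoly_units_conj]

/-- The Jacobi matrix has simple negative eigenvalues and a weighted orthonormal eigenbasis. -/
theorem exists_isWeightedEigenbasis (hα : ∀ j, j ≤ ℓ → 0 < α j)
    (hαh : ∀ j, 1 ≤ j → j ≤ ℓ → 0 < αh j) (hℓ : 0 < ℓ) :
    ∃ δ : Fin ℓ → ℝ, (∀ j, 0 < δ j) ∧ StrictMono δ ∧
      (jacobiA ℓ α αh).charpoly = ∏ j, (Polynomial.X + Polynomial.C ((δ j) ^ 2)) ∧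
      ∃ Y : Matrix (Fin ℓ) (Fin ℓ) ℝ, IsWeightedEigenbasis ℓ α αh δ Y := by
  have hS := isHermitian_symmJacobi hα hαh
  set e := hS.eigenvalues with he
  set u := hS.eigenvectorBasis with hu
  have hs : ∀ p : Fin ℓ, 0 < √(αh (p + 1)) := fun p =>
    Real.sqrt_pos.2 (hαh (p + 1) (by omega) (by omega))
  let y : Fin ℓ → Fin ℓ → ℝ := fun j p => (√(αh (p + 1)))⁻¹ * u j p
  have hortho : ∀ i j, ∑ p : Fin ℓ, αh (p + 1) * y i p * y j p = if i = j then 1 else 0 := by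
    intro i j
    rw [← orthonormal_iff_ite.1 u.orthonormal i j, PiLp.inner_apply]
    refine Finset.sum_congr rfl fun p _ => ?_
    simp only [y, RCLike.inner_apply, conj_trivial]
    have h1 := (hs p).ne'
    have h2 : αh (p + 1) = √(αh (p + 1)) * √(αh (p + 1)) :=
      (Real.mul_self_sqrt (hαh (p + 1) (by omega) (by omega)).le).symm
    rw [h2]
    field_simp
    rw [Real.sqrt_sq (hs p).le]
  have hy0 : ∀ j, y j ≠ 0 := by
    intro j h
    have := hortho j j
    simp [h] at this
  have heig : ∀ j, (jacobiA ℓ α αh).mulVec (y j) = e j • y j := by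
    intro j
    ext p
    have h1 := congrFun (hS.mulVec_eigenvectorBasis j) p
    rw [Matrix.mulVec, dotProduct, Pi.smul_apply, smul_eq_mul] at h1 ⊢
    have h3 : ∀ q, symmJacobi ℓ α αh p q
        = √(αh (p + 1)) * jacobiA ℓ α αh p q * (√(αh (q + 1)))⁻¹ := fun q => rfl
    simp only [h3, mul_assoc] at h1
    rw [← Finset.mul_sum] at h1
    have h2 := (hs p).ne'
    simp only [y]
    rw [mul_left_comm, eq_inv_mul_iff_mul_eq₀ h2]
    exact h1
  have hneg : ∀ j, e j < 0 := fun j => eigenvalue_neg hα hαh hℓ (heig j) (hy0 j)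
  -- Eigenvectors with a common eigenvalue are multiples of the same fundamental solution, hence
  -- proportional with nonzero first entries. This contradicts their orthogonality.
  have hinj : Function.Injective e := by
    intro i j hij
    by_contra hne
    have h1 := eigenvector_first_ne_zero hα hαh hℓ (heig i) (hy0 i)
    have h2 : ∀ p, y j ⟨0, hℓ⟩ * y i p = y i ⟨0, hℓ⟩ * y j p := by
      intro p
      have h3 := (eigenvector_eq_mul_diffSol hα hαh hℓ (heig i)).1 p
      have h4 := (eigenvector_eq_mul_diffSol hα hαh hℓ (heig j)).1 p
      rw [← hij] at h4
      have : (y j ⟨0, hℓ⟩ : ℂ) * y i p = y i ⟨0, hℓ⟩ * y j p := by rw [h3, h4]; ring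
      exact_mod_cast this
    have h5 := hortho i j
    rw [if_neg hne] at h5
    have h6 := hortho j j
    rw [if_pos rfl] at h6
    have h7 : y i ⟨0, hℓ⟩ * ∑ p : Fin ℓ, αh (p + 1) * y j p * y j p
        = y j ⟨0, hℓ⟩ * ∑ p : Fin ℓ, αh (p + 1) * y i p * y j p := by
      rw [Finset.mul_sum, Finset.mul_sum]
      refine Finset.sum_congr rfl fun p _ => ?_
      linear_combination (-αh (p + 1) * y j p) * h2 p
    rw [h5, h6] at h7
    exact h1 (by simpa using h7)
  let d : Fin ℓ → ℝ := fun j => √(-e j)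
  have hd2 : ∀ j, d j ^ 2 = -e j := fun j => Real.sq_sqrt (by linarith [hneg j])
  have hdinj : Function.Injective d := fun i j hij => hinj (by
    have := congrArg (· ^ 2) hij
    simp only [hd2] at this
    linarith)
  -- The spectral theorem gives no suitable order, so the frequencies are sorted; injectivity makes
  -- the sorted sequence strictly increasing.
  refine ⟨d ∘ Tuple.sort d, fun j => Real.sqrt_pos.2 (by linarith [hneg (Tuple.sort d j)]),
    (Tuple.monotone_sort d).strictMono_of_injective (hdinj.comp (Tuple.sort d).injective), ?_,
    Matrix.of fun p j => y (Tuple.sort d j) p, fun j => ?_, fun i j => ?_⟩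
  · rw [← charpoly_symmJacobi hαh, hS.charpoly_eq]
    simp only [Function.comp_apply]
    rw [Equiv.prod_comp (Tuple.sort d) fun j => Polynomial.X + Polynomial.C (d j ^ 2)]
    refine Finset.prod_congr rfl fun j _ => ?_
    rw [hd2, Polynomial.C_neg, sub_eq_add_neg]
    rfl
  · simp only [Function.comp_apply, hd2, neg_neg]
    exact heig _
  · simp only [Matrix.of_apply]
    rw [hortho]
    simp [(Tuple.sort d).injective.eq_iff]

end Difference

end

section

section PointMeasure

/-! ### Finite sums of point masses -/

variable {ι X : Type*} [Fintype ι] [MeasurableSpace X] [MeasurableSingletonClass X]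

/-- The sum of point masses `s i ^ 2` at the points `x i`. -/
def pointMeasure (s : ι → ℝ) (x : ι → X) : Measure X :=
  Measure.sum fun i => ENNReal.ofReal (s i ^ 2) • Measure.dirac (x i)

variable {s : ι → ℝ} {x : ι → X}

omit [MeasurableSingletonClass X] in
theorem pointMeasure_eq_sum :
    pointMeasure s x = ∑ i, ENNReal.ofReal (s i ^ 2) • Measure.dirac (x i) :=
  Measure.sum_fintype _

instance isFiniteMeasure_pointMeasure : IsFiniteMeasure (pointMeasure s x) := by
  refine ⟨?_⟩
  rw [pointMeasure_eq_sum, Measure.finsetSum_apply]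
  refine ENNReal.sum_lt_top.2 fun i _ => ?_
  rw [Measure.smul_apply, measure_univ, smul_eq_mul, mul_one]
  exact ENNReal.ofReal_lt_top

/-- All masses being positive, classes in `L²` have well defined values at the points `x i`. -/
theorem ae_pointMeasure_iff (hs : ∀ i, s i ≠ 0) {P : X → Prop} :
    (∀ᵐ y ∂(pointMeasure s x), P y) ↔ ∀ i, P (x i) := by
  rw [pointMeasure, Measure.ae_sum_iff]
  refine forall_congr' fun i => ?_
  rw [Measure.ae_ennreal_smul_measure_iff, ae_dirac_eq]
  · rfl
  · exact (ENNReal.ofReal_pos.2 (by have := hs i; positivity)).ne'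

theorem integral_pointMeasure (f : X → ℂ) :
    ∫ y, f y ∂(pointMeasure s x) = ∑ i, (s i : ℂ) ^ 2 * f (x i) := by
  rw [pointMeasure_eq_sum, integral_finsetSum_measure]
  · refine Finset.sum_congr rfl fun i _ => ?_
    rw [integral_smul_measure, integral_dirac, ENNReal.toReal_ofReal (sq_nonneg _),
      Complex.real_smul, Complex.ofReal_pow]
  · exact fun i _ => (integrable_dirac (by simp)).smul_measure ENNReal.ofReal_ne_top

/-- The coordinates in `L²` of a finite sum of point masses. -/
def pointIsometry (hs : ∀ i, s i ≠ 0) : Lp ℂ 2 (pointMeasure s x) →ₗᵢ[ℂ] EuclideanSpace ℂ ι where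
  toFun f := WithLp.toLp 2 fun i => (s i : ℂ) * f (x i)
  map_add' f g := by
    ext i
    have := (ae_pointMeasure_iff hs).1 (Lp.coeFn_add f g) i
    simp only [PiLp.add_apply]
    rw [this, Pi.add_apply, mul_add]
  map_smul' c f := by
    ext i
    have := (ae_pointMeasure_iff hs).1 (Lp.coeFn_smul c f) i
    simp only [PiLp.smul_apply, RingHom.id_apply]
    rw [this, Pi.smul_apply, smul_eq_mul, smul_eq_mul, mul_left_comm]
  norm_map' f := by
    have h1 : ((‖f‖ ^ 2 : ℝ) : ℂ) = ∑ i, (s i : ℂ) ^ 2 * (conj (f (x i)) * f (x i)) := by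
      rw [← integral_pointMeasure fun y => conj (f y) * f y]
      have := inner_self_eq_norm_sq_to_K (𝕜 := ℂ) f
      rw [L2.inner_def] at this
      push_cast
      rw [← RCLike.ofReal_eq_complex_ofReal, ← this]
      congr 1; ext y
      rw [RCLike.inner_apply, mul_comm]
    have h2 : ‖f‖ ^ 2 = ∑ i, ‖(s i : ℂ) * f (x i)‖ ^ 2 := by
      rw [← Complex.ofReal_inj, h1]
      push_cast
      refine Finset.sum_congr rfl fun i _ => ?_
      rw [norm_mul, Complex.ofReal_mul, mul_pow, Complex.norm_real, Real.norm_eq_abs,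
        ← Complex.ofReal_pow |s i|, sq_abs, Complex.ofReal_pow, Complex.conj_mul']
    change ‖(WithLp.toLp 2 fun i => (s i : ℂ) * f (x i) : EuclideanSpace ℂ ι)‖ = ‖f‖
    rw [EuclideanSpace.norm_eq, ← h2, Real.sqrt_sq (norm_nonneg _)]

theorem exists_lp_pointMeasure (hs : ∀ i, s i ≠ 0) (hx : Function.Injective x) (c : ι → ℂ) :
    ∃ f : Lp ℂ 2 (pointMeasure s x), ∀ i, f (x i) = c i := by
  classical
  have hm : ∀ i, MemLp (({x i} : Set X).indicator fun _ => c i) 2 (pointMeasure s x) := fun i =>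
    (memLp_const (c i)).indicator (measurableSet_singleton _)
  have hm2 := memLp_finsetSum (Finset.univ : Finset ι) fun i _ => hm i
  refine ⟨hm2.toLp _, fun i => ?_⟩
  rw [(ae_pointMeasure_iff hs).1 hm2.coeFn_toLp i]
  beta_reduce
  rw [Finset.sum_eq_single i]
  · simp
  · intro j _ hj
    rw [indicator_of_notMem]
    exact fun h => hj (hx (mem_singleton_iff.1 h)).symm
  · simp

/-- Coordinates identify `L²` of a finite sum of distinct point masses with Euclidean space. -/
def pointEquiv (hs : ∀ i, s i ≠ 0) (hx : Function.Injective x) :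
    Lp ℂ 2 (pointMeasure s x) ≃ₗᵢ[ℂ] EuclideanSpace ℂ ι :=
  LinearIsometryEquiv.ofSurjective (pointIsometry hs) fun c => by
    obtain ⟨f, hf⟩ := exists_lp_pointMeasure hs hx fun i => (s i : ℂ)⁻¹ * c i
    refine ⟨f, ?_⟩
    ext i
    change (s i : ℂ) * f (x i) = c i
    have : (s i : ℂ) ≠ 0 := by exact_mod_cast hs i
    rw [hf, mul_inv_cancel_left₀ this]

theorem pointEquiv_apply (hs : ∀ i, s i ≠ 0) (hx : Function.Injective x)
    (f : Lp ℂ 2 (pointMeasure s x)) (i : ι) : pointEquiv hs hx f i = (s i : ℂ) * f (x i) := rfl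

/-- A measure carried by finitely many distinct points is determined by its masses. -/
theorem eq_pointMeasure {ν : Measure X} (hx : Function.Injective x)
    (hν : ∀ᵐ y ∂ν, ∃ i, y = x i) (h : ∀ i, ν {x i} = ENNReal.ofReal (s i ^ 2)) :
    ν = pointMeasure s x := by
  ext S hS
  have h1 : ν S = ν (⋃ i, S ∩ {x i}) := by
    refine measure_congr ?_
    filter_upwards [hν] with y ⟨i, hi⟩
    refine propext ⟨fun hy => mem_iUnion.2 ⟨i, hy, hi⟩, fun hy => ?_⟩
    obtain ⟨j, hj⟩ := mem_iUnion.1 hy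
    exact hj.1
  rw [h1, measure_iUnion, tsum_fintype, pointMeasure_eq_sum, Measure.finsetSum_apply]
  · refine Finset.sum_congr rfl fun i _ => ?_
    rw [Measure.smul_apply, Measure.dirac_apply' _ hS, smul_eq_mul]
    by_cases hi : x i ∈ S
    · rw [inter_eq_self_of_subset_right (singleton_subset_iff.2 hi), h, indicator_of_mem hi,
        Pi.one_apply, mul_one]
    · rw [inter_singleton_eq_empty.2 hi, measure_empty, indicator_of_notMem hi, mul_zero]
  · intro i j hij
    refine (disjoint_singleton.2 (hx.ne hij)).mono inter_subset_right inter_subset_right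
  · exact fun i => hS.inter (measurableSet_singleton _)

end PointMeasure

section Discrete

/-! ### The spectral measure of the difference operator -/

variable {ℓ : ℕ} {α αh : ℕ → ℝ} {δ : Fin ℓ → ℝ} {Y : Matrix (Fin ℓ) (Fin ℓ) ℝ}

theorem nodeMeasure_eq (hαh : ∀ j, 1 ≤ j → j ≤ ℓ → 0 < αh j) :
    nodeMeasure ℓ αh = pointMeasure (fun p : Fin ℓ => √(αh (p + 1))) id := by
  rw [nodeMeasure, pointMeasure]
  congr 1; ext1 p
  rw [Real.sq_sqrt (hαh (p + 1) (by omega) (by omega)).le]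
  rfl

theorem sqrt_node_ne_zero (hαh : ∀ j, 1 ≤ j → j ≤ ℓ → 0 < αh j) (p : Fin ℓ) :
    √(αh (p + 1)) ≠ 0 := (Real.sqrt_pos.2 (hαh (p + 1) (by omega) (by omega))).ne'

theorem integral_nodeMeasure (hαh : ∀ j, 1 ≤ j → j ≤ ℓ → 0 < αh j) (f : Fin ℓ → ℂ) :
    ∫ p, f p ∂(nodeMeasure ℓ αh) = ∑ p : Fin ℓ, (αh (p + 1) : ℂ) * f p := by
  rw [nodeMeasure_eq hαh, integral_pointMeasure]
  refine Finset.sum_congr rfl fun p _ => ?_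
  rw [← Complex.ofReal_pow, Real.sq_sqrt (hαh (p + 1) (by omega) (by omega)).le]
  rfl

theorem forall_of_ae_nodeMeasure (hαh : ∀ j, 1 ≤ j → j ≤ ℓ → 0 < αh j) {P : Fin ℓ → Prop}
    (h : ∀ᵐ p ∂(nodeMeasure ℓ αh), P p) : ∀ p, P p := by
  rw [nodeMeasure_eq hαh] at h
  exact (ae_pointMeasure_iff (sqrt_node_ne_zero hαh)).1 h

/-- The coefficient of a vector with respect to the `j`-th eigenvector. -/
def nodeCoeff (αh : ℕ → ℝ) (Y : Matrix (Fin ℓ) (Fin ℓ) ℝ) (d : Fin ℓ → ℂ) (j : Fin ℓ) : ℂ :=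
  ∑ p : Fin ℓ, (αh (p + 1) : ℂ) * Y p j * d p

namespace IsWeightedEigenbasis

variable (hY : IsWeightedEigenbasis ℓ α αh δ Y)
include hY

theorem nodeCoeff_self (i j : Fin ℓ) :
    nodeCoeff αh Y (fun p => (Y p i : ℂ)) j = if j = i then 1 else 0 := by
  have := hY.2 j i
  rw [nodeCoeff]
  split_ifs at this ⊢ <;> exact_mod_cast this

/-- Orthonormality says that a square matrix has a left inverse. That inverse is then also a right
inverse, which is completeness of the eigenvectors. -/
theorem sum_mul_nodeCoeff (d : Fin ℓ → ℂ) (q : Fin ℓ) :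
    ∑ j, (Y q j : ℂ) * nodeCoeff αh Y d j = d q := by
  have h1 : (Matrix.of fun i p : Fin ℓ => αh (p + 1) * Y p i) * Y = 1 := by
    ext i j
    rw [Matrix.mul_apply, Matrix.one_apply, ← hY.2 i j]
    rfl
  have h2 := mul_eq_one_comm.1 h1
  have h3 : ∀ p : Fin ℓ, ∑ j, (Y q j : ℂ) * ((αh (p + 1) : ℂ) * Y p j) = if q = p then 1 else 0 := by
    intro p
    have := congrFun (congrFun h2 q) p
    rw [Matrix.mul_apply, Matrix.one_apply] at this
    simp only [Matrix.of_apply] at this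
    split_ifs at this ⊢ <;> exact_mod_cast this
  simp only [nodeCoeff, Finset.mul_sum]
  rw [Finset.sum_comm]
  simp only [← mul_assoc, ← Finset.sum_mul] at h3 ⊢
  simp [h3]

theorem ext_nodeCoeff {d e : Fin ℓ → ℂ} (h : ∀ j, nodeCoeff αh Y d j = nodeCoeff αh Y e j) :
    d = e := by
  ext q
  rw [← hY.sum_mul_nodeCoeff d, ← hY.sum_mul_nodeCoeff e]
  simp only [h]

/-- Weighted symmetry moves the matrix onto the eigenvector. -/
theorem nodeCoeff_jacobiA (hα : ∀ j, j ≤ ℓ → 0 < α j) (hαh : ∀ j, 1 ≤ j → j ≤ ℓ → 0 < αh j)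
    (d : Fin ℓ → ℂ) (j : Fin ℓ) :
    nodeCoeff αh Y (fun p => ∑ q : Fin ℓ, (jacobiA ℓ α αh p q : ℂ) * d q) j
      = ((-(δ j ^ 2) : ℝ) : ℂ) * nodeCoeff αh Y d j := by
  simp only [nodeCoeff, Finset.mul_sum]
  rw [Finset.sum_comm]
  refine Finset.sum_congr rfl fun q _ => ?_
  have h1 := congrFun (hY.1 j) q
  rw [Matrix.mulVec, dotProduct, Pi.smul_apply, smul_eq_mul] at h1
  have h2 : ∑ p : Fin ℓ, αh (p + 1) * Y p j * jacobiA ℓ α αh p q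
      = αh (q + 1) * (-(δ j ^ 2) * Y q j) := by
    rw [← h1, Finset.mul_sum]
    refine Finset.sum_congr rfl fun p _ => ?_
    linear_combination Y p j * jacobiA_mul_comm hα hαh p q
  simp only [← mul_assoc]
  rw [← Finset.sum_mul]
  have h3 : ∑ p : Fin ℓ, (αh (p + 1) : ℂ) * Y p j * jacobiA ℓ α αh p q
      = αh (q + 1) * (((-(δ j ^ 2) : ℝ) : ℂ) * Y q j) := by exact_mod_cast h2
  rw [h3]
  ring

theorem first_ne_zero (hα : ∀ j, j ≤ ℓ → 0 < α j) (hαh : ∀ j, 1 ≤ j → j ≤ ℓ → 0 < αh j)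
    (hℓ : 0 < ℓ) (j : Fin ℓ) : Y ⟨0, hℓ⟩ j ≠ 0 := by
  refine eigenvector_first_ne_zero hα hαh hℓ (hY.1 j) fun h => ?_
  have := hY.2 j j
  have h' : ∀ p, Y p j = 0 := fun p => congrFun h p
  simp [h'] at this

theorem diffSol_eq (hα : ∀ j, j ≤ ℓ → 0 < α j) (hαh : ∀ j, 1 ≤ j → j ≤ ℓ → 0 < αh j)
    (hℓ : 0 < ℓ) (j p : Fin ℓ) :
    diffSol α αh (-(δ j ^ 2)) (p + 1) = (Y ⟨0, hℓ⟩ j : ℂ)⁻¹ * Y p j := by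
  have h := (eigenvector_eq_mul_diffSol hα hαh hℓ (hY.1 j)).1 p
  have h0 : (Y ⟨0, hℓ⟩ j : ℂ) ≠ 0 := by exact_mod_cast hY.first_ne_zero hα hαh hℓ j
  rw [h, inv_mul_cancel_left₀ h0]

/-- The eigenvectors as an orthonormal basis. -/
theorem exists_orthonormalBasis (hαh : ∀ j, 1 ≤ j → j ≤ ℓ → 0 < αh j) :
    ∃ b : OrthonormalBasis (Fin ℓ) ℂ (EuclideanSpace ℂ (Fin ℓ)),
      ∀ (c : EuclideanSpace ℂ (Fin ℓ)) j, b.repr c j = ∑ p : Fin ℓ, (√(αh (p + 1)) : ℂ) * Y p j * c p := by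
  set v : Fin ℓ → EuclideanSpace ℂ (Fin ℓ) := fun j =>
    WithLp.toLp 2 fun p => (√(αh (p + 1)) : ℂ) * Y p j with hv
  have hin : ∀ j (c : EuclideanSpace ℂ (Fin ℓ)),
      ⟪v j, c⟫_ℂ = ∑ p : Fin ℓ, (√(αh (p + 1)) : ℂ) * Y p j * c p := by
    intro j c
    rw [PiLp.inner_apply]
    refine Finset.sum_congr rfl fun p _ => ?_
    rw [RCLike.inner_apply]
    simp only [hv, map_mul, Complex.conj_ofReal]
    ring
  have ho : Orthonormal ℂ v := by
    rw [orthonormal_iff_ite]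
    intro i j
    rw [hin]
    have : ∀ p : Fin ℓ, (√(αh (p + 1)) : ℂ) * Y p i * v j p = (αh (p + 1) : ℂ) * Y p i * Y p j := by
      intro p
      have h2 : (αh (p + 1) : ℂ) = (√(αh (p + 1)) : ℂ) * √(αh (p + 1)) := by
        rw [← Complex.ofReal_mul, Real.mul_self_sqrt (hαh (p + 1) (by omega) (by omega)).le]
      simp only [hv]
      rw [h2]; ring
    simp only [this]
    have := hY.2 i j
    split_ifs at this ⊢ <;> exact_mod_cast this
  have hcard : Fintype.card (Fin ℓ) = Module.finrank ℂ (EuclideanSpace ℂ (Fin ℓ)) := by simp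
  have hspan : ⊤ ≤ Submodule.span ℂ (range v) :=
    (ho.linearIndependent.span_eq_top_of_card_eq_finrank' hcard).ge
  refine ⟨OrthonormalBasis.mk ho hspan, fun c j => ?_⟩
  rw [OrthonormalBasis.repr_apply_apply, OrthonormalBasis.coe_mk, hin]

/-- The change to eigenvector coordinates is unitary. The factor `Y_{1,j}⁻¹` offsets the mass
`Y_{1,j}²` and also normalizes the eigenvector to be the fundamental solution at `-δ_j²`. -/
theorem exists_unitary (hα : ∀ j, j ≤ ℓ → 0 < α j) (hαh : ∀ j, 1 ≤ j → j ≤ ℓ → 0 < αh j)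
    (hℓ : 0 < ℓ) (hδ : Function.Injective fun j => -(δ j ^ 2)) :
    ∃ U : Lp ℂ 2 (nodeMeasure ℓ αh) ≃ₗᵢ[ℂ] Lp ℂ 2 (discreteMeasure ℓ hℓ δ Y),
      ∀ h j, U h (-(δ j ^ 2)) = (Y ⟨0, hℓ⟩ j : ℂ)⁻¹ * nodeCoeff αh Y h j := by
  obtain ⟨b, hb⟩ := hY.exists_orthonormalBasis hαh
  have hY0 := hY.first_ne_zero hα hαh hℓ
  rw [nodeMeasure_eq hαh]
  let E₁ := pointEquiv (sqrt_node_ne_zero hαh) (Function.injective_id (α := Fin ℓ))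
  let E₂ := pointEquiv hY0 hδ
  refine ⟨(E₁.trans b.repr).trans E₂.symm, fun h j => ?_⟩
  have h0 : (Y ⟨0, hℓ⟩ j : ℂ) ≠ 0 := by exact_mod_cast hY0 j
  rw [eq_inv_mul_iff_mul_eq₀ h0]
  have h1 := pointEquiv_apply hY0 hδ (((E₁.trans b.repr).trans E₂.symm) h) j
  refine h1.symm.trans ?_
  have h2 : pointEquiv hY0 hδ (((E₁.trans b.repr).trans E₂.symm) h) = b.repr (E₁ h) :=
    E₂.apply_symm_apply _
  rw [h2, hb, nodeCoeff]
  refine Finset.sum_congr rfl fun p _ => ?_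
  have h3 : (αh (p + 1) : ℂ) = (√(αh (p + 1)) : ℂ) * √(αh (p + 1)) := by
    rw [← Complex.ofReal_mul, Real.mul_self_sqrt (hαh (p + 1) (by omega) (by omega)).le]
  rw [pointEquiv_apply, h3]
  simp only [id]
  ring

theorem isDiffSpectralMeasure (hα : ∀ j, j ≤ ℓ → 0 < α j) (hαh : ∀ j, 1 ≤ j → j ≤ ℓ → 0 < αh j)
    (hℓ : 0 < ℓ) (hδ : Function.Injective fun j => -(δ j ^ 2)) :
    IsDiffSpectralMeasure ℓ α αh (discreteMeasure ℓ hℓ δ Y) := by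
  have hY0 := hY.first_ne_zero hα hαh hℓ
  obtain ⟨U, hU⟩ := hY.exists_unitary hα hαh hℓ hδ
  have hfin : IsFiniteMeasure (discreteMeasure ℓ hℓ δ Y) :=
    isFiniteMeasure_pointMeasure (s := Y ⟨0, hℓ⟩) (x := fun j => -(δ j ^ 2))
  have hae : ∀ P : ℝ → Prop, (∀ᵐ t ∂(discreteMeasure ℓ hℓ δ Y), P t) ↔ ∀ j, P (-(δ j ^ 2)) :=
    fun P => ae_pointMeasure_iff (s := Y ⟨0, hℓ⟩) (x := fun j => -(δ j ^ 2)) hY0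
  refine ⟨inferInstance, ?_, fun t p => diffSol α αh t (p + 1), U, fun t => ?_, ?_, fun v g => ?_⟩
  · have := (hae fun t => t ≤ 0).2 fun j => by nlinarith [sq_nonneg (δ j)]
    simpa [ae_iff] using! this
  · exact ⟨diffSol α αh t, diffSol_zero t, diffSol_one t, diffOp_diffSol hα hαh t, fun p => rfl⟩
  · intro K _ h _
    refine (hae _).2 fun j => ?_
    simp only [hU, integral_nodeMeasure hαh]
    rw [nodeCoeff, Finset.mul_sum]
    refine Finset.sum_congr rfl fun p _ => ?_
    rw [hY.diffSol_eq hα hαh hℓ]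
    ring
  · rw [mem_diffGraph_iff hα hαh hℓ, EventuallyEq, hae]
    have h1 : ∀ j, U g (-(δ j ^ 2)) = ((-(δ j ^ 2) : ℝ) : ℂ) * U v (-(δ j ^ 2)) ↔
        nodeCoeff αh Y g j
          = nodeCoeff αh Y (fun p => ∑ q : Fin ℓ, (jacobiA ℓ α αh p q : ℂ) * v q) j := by
      intro j
      have h0 : (Y ⟨0, hℓ⟩ j : ℂ)⁻¹ ≠ 0 := inv_ne_zero (by exact_mod_cast hY0 j)
      rw [hU, hU, hY.nodeCoeff_jacobiA hα hαh, mul_left_comm, mul_right_inj' h0]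
    simp only [h1]
    exact ⟨fun h j => by rw [show (g : Fin ℓ → ℂ) = _ from funext h],
      fun h p => congrFun (hY.ext_nodeCoeff h) p⟩

/-- Each eigenvector is transformed to a function living at its eigenvalue. The normalized unit mass
at the first node is transformed to the constant `1`, so the measure lives on the eigenvalues.
Unitarity on each eigenvector then fixes the mass of each point. -/
theorem eq_discreteMeasure (hα : ∀ j, j ≤ ℓ → 0 < α j) (hαh : ∀ j, 1 ≤ j → j ≤ ℓ → 0 < αh j)
    (hℓ : 0 < ℓ) (hδ : Function.Injective fun j => -(δ j ^ 2)) {μ : Measure ℝ}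
    (hμ : IsDiffSpectralMeasure ℓ α αh μ) : μ = discreteMeasure ℓ hℓ δ Y := by
  have hY0 := hY.first_ne_zero hα hαh hℓ
  obtain ⟨hlf, hnp, Φ, U, hΦ, hU, hg⟩ := hμ
  have hfun : ∀ c : Fin ℓ → ℂ, ∃ f : Lp ℂ 2 (nodeMeasure ℓ αh), ∀ p, f p = c p := by
    rw [nodeMeasure_eq hαh]
    exact exists_lp_pointMeasure (sqrt_node_ne_zero hαh) Function.injective_id
  have hΦe : ∀ t p, Φ t p = diffSol α αh t (p + 1) := by
    intro t p
    obtain ⟨V, h0, h1, h2, h3⟩ := hΦ t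
    rw [h3 p]
    exact eq_of_diffOp_eq hα hαh h2 (diffOp_diffSol hα hαh t) h0 h1 _ (by omega)
  have hUe : ∀ h : Lp ℂ 2 (nodeMeasure ℓ αh), U h =ᵐ[μ] fun t =>
      ∑ p : Fin ℓ, (αh (p + 1) : ℂ) * (h p * diffSol α αh t (p + 1)) := by
    intro h
    refine (hU univ rfl h (ae_of_all _ fun x hx => absurd (mem_univ x) hx)).trans
      (ae_of_all _ fun t => ?_)
    simp only [integral_nodeMeasure hαh, hΦe]
  choose y hy using fun j : Fin ℓ => hfun fun p => (Y p j : ℂ)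
  -- The weight `αh 1` in the transform cancels the inverse, leaving the value `1` of the
  -- fundamental solution at the first node.
  obtain ⟨e, he⟩ := hfun fun p => if p = ⟨0, hℓ⟩ then (αh 1 : ℂ)⁻¹ else 0
  have hα1 : (αh 1 : ℂ) ≠ 0 := by exact_mod_cast (hαh 1 le_rfl hℓ).ne'
  have hUee : U e =ᵐ[μ] fun _ => 1 := by
    filter_upwards [hUe e] with t ht
    rw [ht, Finset.sum_eq_single ⟨0, hℓ⟩]
    · rw [he, if_pos rfl]
      simp only [zero_add]
      rw [diffSol_one, mul_one, mul_inv_cancel₀ hα1]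
    · intro p _ hp
      rw [he, if_neg hp, zero_mul, mul_zero]
    · simp
  have heY : U e =ᵐ[μ] fun t => ∑ j, (Y ⟨0, hℓ⟩ j : ℂ) * U (y j) t := by
    have h1 := eventually_all.2 fun j => hUe (y j)
    filter_upwards [hUe e, h1] with t h2 h3
    rw [h2]
    simp only [h3, Finset.mul_sum]
    rw [Finset.sum_comm]
    refine Finset.sum_congr rfl fun p _ => ?_
    have h4 := hY.sum_mul_nodeCoeff (fun p => e p) p
    have h5 : ∀ j, nodeCoeff αh Y (fun p => e p) j = Y ⟨0, hℓ⟩ j := by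
      intro j
      rw [nodeCoeff, Finset.sum_eq_single ⟨0, hℓ⟩]
      · rw [he, if_pos rfl]
        simp only [zero_add]
        field_simp
      · intro p _ hp
        rw [he, if_neg hp, mul_zero]
      · simp
    rw [← h4]
    simp only [h5, hy]
    rw [Finset.sum_mul, Finset.mul_sum]
    refine Finset.sum_congr rfl fun j _ => ?_
    ring
  have hUy : ∀ j, ∀ᵐ t ∂μ, t ≠ -(δ j ^ 2) → U (y j) t = 0 := by
    intro j
    have h1 : (y j, ((-(δ j ^ 2) : ℝ) : ℂ) • y j) ∈ diffGraph ℓ α αh := by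
      rw [mem_diffGraph_iff hα hαh hℓ]
      intro p
      rw [forall_of_ae_nodeMeasure hαh (Lp.coeFn_smul ((-(δ j ^ 2) : ℝ) : ℂ) (y j)) p,
        Pi.smul_apply]
      simp only [hy, smul_eq_mul]
      have := congrFun (hY.1 j) p
      rw [Matrix.mulVec, dotProduct, Pi.smul_apply, smul_eq_mul] at this
      exact_mod_cast this.symm
    have h2 := (hg _ _).1 h1
    rw [map_smul] at h2
    filter_upwards [h2, Lp.coeFn_smul ((-(δ j ^ 2) : ℝ) : ℂ) (U (y j))] with t h3 h4 h5
    rw [h4, Pi.smul_apply, smul_eq_mul, ← sub_eq_zero, ← sub_mul, ← Complex.ofReal_sub] at h3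
    refine (mul_eq_zero.1 h3).resolve_left ?_
    exact_mod_cast sub_ne_zero.2 h5.symm
  refine eq_pointMeasure (s := Y ⟨0, hℓ⟩) hδ ?_ fun j => ?_
  · have h1 := eventually_all.2 hUy
    filter_upwards [hUee, heY, h1] with t h2 h3 h4
    by_contra hne
    push Not at hne
    rw [h2] at h3
    refine one_ne_zero (h3.trans (Finset.sum_eq_zero fun j _ => ?_))
    rw [h4 j (hne j), mul_zero]
  -- At its eigenvalue the transform of the `j`-th eigenvector is `Y_{1,j}⁻¹`, so `1 = ‖y j‖² = μ
  -- {-δ_j²} * Y_{1,j}⁻²`.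
  · have hpt : ∀ᵐ t ∂μ, conj (U (y j) t) * U (y j) t
        = ({-(δ j ^ 2)} : Set ℝ).indicator (fun _ => ((((Y ⟨0, hℓ⟩ j) ^ 2)⁻¹ : ℝ) : ℂ)) t := by
      filter_upwards [hUe (y j), hUy j] with t h1 h2
      by_cases ht : t = -(δ j ^ 2)
      · rw [indicator_of_mem (mem_singleton_iff.2 ht), h1, ht]
        have h3 : ∑ p : Fin ℓ, (αh (p + 1) : ℂ) * (y j p * diffSol α αh (-(δ j ^ 2)) (p + 1))
            = (Y ⟨0, hℓ⟩ j : ℂ)⁻¹ := by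
          have h4 := hY.nodeCoeff_self j j
          rw [if_pos rfl, nodeCoeff] at h4
          rw [← mul_one (Y ⟨0, hℓ⟩ j : ℂ)⁻¹, ← h4, Finset.mul_sum]
          refine Finset.sum_congr rfl fun p _ => ?_
          rw [hy, hY.diffSol_eq hα hαh hℓ]
          ring
        rw [h3, map_inv₀, Complex.conj_ofReal]
        push_cast
        rw [sq, mul_inv]
      · rw [indicator_of_notMem (fun h => ht (mem_singleton_iff.1 h)), h2 ht, mul_zero]
    have h1 : ⟪U (y j), U (y j)⟫_ℂ = 1 := by
      rw [U.inner_map_map, L2.inner_def]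
      have h2 := hY.nodeCoeff_self j j
      rw [if_pos rfl, nodeCoeff] at h2
      rw [integral_nodeMeasure hαh, ← h2]
      refine Finset.sum_congr rfl fun p _ => ?_
      rw [RCLike.inner_apply, hy, Complex.conj_ofReal]
      ring
    rw [inner_Lp_eq, integral_congr_ae hpt, integral_indicator (measurableSet_singleton _),
      setIntegral_const, Complex.real_smul, ← Complex.ofReal_mul, Complex.ofReal_eq_one] at h1
    have h2 : 0 < (Y ⟨0, hℓ⟩ j) ^ 2 := by have := hY0 j; positivity
    rw [mul_inv_eq_one₀ h2.ne'] at h1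
    rw [← h1, ofReal_measureReal isCompact_singleton.measure_lt_top.ne]

/-- The Neumann-to-Dirichlet function of the difference equation. -/
theorem isDiscreteNtDValue_iff (hα : ∀ j, j ≤ ℓ → 0 < α j) (hαh : ∀ j, 1 ≤ j → j ≤ ℓ → 0 < αh j)
    (hℓ : 0 < ℓ) {lam : ℂ} (hlam : lam ∈ Complex.slitPlane) (F : ℂ) :
    IsDiscreteNtDValue ℓ α αh lam F ↔
      F = ∑ j : Fin ℓ, ((Y ⟨0, hℓ⟩ j : ℝ) : ℂ) ^ 2 / (lam + ((δ j : ℝ) : ℂ) ^ 2) := by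
  have hne : ∀ j, lam + (δ j : ℂ) ^ 2 ≠ 0 := by
    intro j
    have := sub_ofReal_ne_zero_of_mem_slitPlane hlam (t := -(δ j ^ 2)) (by nlinarith [sq_nonneg (δ j)])
    push_cast at this
    rwa [sub_neg_eq_add] at this
  have hα0 : (α 0 : ℂ) ≠ 0 := by exact_mod_cast (hα 0 (Nat.zero_le _)).ne'
  have hα1 : (αh 1 : ℂ) ≠ 0 := by exact_mod_cast (hαh 1 le_rfl hℓ).ne'
  have hfirst : ∀ (x : ℂ) (j : Fin ℓ), nodeCoeff αh Y
      (fun p => if (p : ℕ) = 0 then x / (αh 1 : ℂ) else 0) j = Y ⟨0, hℓ⟩ j * x := by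
    intro x j
    rw [nodeCoeff, Finset.sum_eq_single ⟨0, hℓ⟩]
    · simp only [if_true, zero_add]
      field_simp
    · intro p _ hp
      rw [if_neg (fun h => hp (Fin.ext h)), mul_zero]
    · simp
  have hadd : ∀ (d e : Fin ℓ → ℂ) j, nodeCoeff αh Y (fun p => d p + e p) j
      = nodeCoeff αh Y d j + nodeCoeff αh Y e j := fun d e j => by
    simp only [nodeCoeff, mul_add, Finset.sum_add_distrib]
  have hmul : ∀ (x : ℂ) (d : Fin ℓ → ℂ) j, nodeCoeff αh Y (fun p => x * d p) j
      = x * nodeCoeff αh Y d j := fun x d j => by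
    simp only [nodeCoeff, Finset.mul_sum]
    exact Finset.sum_congr rfl fun p _ => by ring
  constructor
  · rintro ⟨V, φ, hV, hφ, hl, hφ0, rfl⟩
    have hb : (V 0 - V 1) / (α 0 : ℂ) = φ := by rw [← hφ]; ring
    have h1 : (fun p : Fin ℓ => (∑ q : Fin ℓ, (jacobiA ℓ α αh p q : ℂ) * V (q + 1))
        + if (p : ℕ) = 0 then φ / (αh 1 : ℂ) else 0) = fun p : Fin ℓ => lam * V (p + 1) := by
      ext p
      rw [← hb, ← diffOp_eq_sum hα hαh V hl]
      exact sub_eq_zero.1 (hV (p + 1) (by omega) (by omega))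
    -- The flux enters as a source at the first node, with coefficient `Y_{1,j} φ`; the equation is
    -- diagonal in the eigenvectors and is solved coefficientwise.
    have h2 : ∀ j, nodeCoeff αh Y (fun p => V (p + 1)) j
        = Y ⟨0, hℓ⟩ j * φ / (lam + (δ j : ℂ) ^ 2) := by
      intro j
      have h3 : nodeCoeff αh Y _ j = nodeCoeff αh Y _ j :=
        congrArg (fun d => nodeCoeff αh Y d j) h1
      rw [hadd, hY.nodeCoeff_jacobiA hα hαh (fun q => V (q + 1)), hfirst, hmul] at h3
      rw [eq_div_iff (hne j)]
      push_cast at h3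
      linear_combination -h3
    have h4 := hY.sum_mul_nodeCoeff (fun p => V (p + 1)) ⟨0, hℓ⟩
    simp only [zero_add] at h4
    rw [← h4, Finset.sum_div]
    refine Finset.sum_congr rfl fun j _ => ?_
    rw [h2]
    have := hne j
    field_simp
  · rintro rfl
    set x : Fin ℓ → ℂ := fun p => ∑ j, (Y p j : ℂ) * (Y ⟨0, hℓ⟩ j / (lam + (δ j : ℂ) ^ 2)) with hx
    have hxj : ∀ j, nodeCoeff αh Y x j = Y ⟨0, hℓ⟩ j / (lam + (δ j : ℂ) ^ 2) := by
      intro j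
      have : nodeCoeff αh Y x j = ∑ i, nodeCoeff αh Y (fun p => (Y p i : ℂ)) j
          * (Y ⟨0, hℓ⟩ i / (lam + (δ i : ℂ) ^ 2)) := by
        simp only [nodeCoeff, hx, Finset.mul_sum, Finset.sum_mul]
        rw [Finset.sum_comm]
        exact Finset.sum_congr rfl fun i _ => Finset.sum_congr rfl fun p _ => by ring
      rw [this]
      simp [hY.nodeCoeff_self]
    have hsol : (fun p : Fin ℓ => (∑ q : Fin ℓ, (jacobiA ℓ α αh p q : ℂ) * x q)
        + if (p : ℕ) = 0 then 1 / (αh 1 : ℂ) else 0) = fun p => lam * x p := by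
      refine hY.ext_nodeCoeff fun j => ?_
      rw [hadd, hY.nodeCoeff_jacobiA hα hαh, hfirst, hmul, hxj]
      have := hne j
      push_cast
      field_simp
      ring
    -- The value at node `0` exceeds the first entry by `α 0`, which produces unit flux.
    refine ⟨nodeExtend (x ⟨0, hℓ⟩ + α 0) x, 1, fun j hj hj' => ?_, ?_, nodeExtend_last _ _,
      one_ne_zero, ?_⟩
    · obtain ⟨p, rfl⟩ : ∃ p : Fin ℓ, j = p + 1 := ⟨⟨j - 1, by omega⟩, by simp; omega⟩
      rw [diffOp_eq_sum hα hαh _ (nodeExtend_last _ _), nodeExtend_zero, nodeExtend_one hℓ,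
        add_sub_cancel_left, div_self hα0]
      simp only [nodeExtend_succ]
      rw [sub_eq_zero]
      exact congrFun hsol p
    · rw [nodeExtend_zero, nodeExtend_one hℓ]
      field_simp
      ring
    · rw [nodeExtend_one hℓ, div_one]
      refine Finset.sum_congr rfl fun j _ => ?_
      ring

omit hY in
theorem _root_.integral_discreteMeasure (hℓ : 0 < ℓ) (f : ℝ → ℂ) :
    ∫ t, f t ∂(discreteMeasure ℓ hℓ δ Y)
      = ∑ j : Fin ℓ, ((Y ⟨0, hℓ⟩ j : ℝ) : ℂ) ^ 2 * f (-(δ j ^ 2)) :=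
  integral_pointMeasure (s := Y ⟨0, hℓ⟩) (x := fun j => -(δ j ^ 2)) f

theorem isDiscreteNtDValue_iff_integral (hα : ∀ j, j ≤ ℓ → 0 < α j)
    (hαh : ∀ j, 1 ≤ j → j ≤ ℓ → 0 < αh j) (hℓ : 0 < ℓ) {lam : ℂ} (hlam : lam ∈ Complex.slitPlane) :
    IntegrableOn (fun t : ℝ => 1 / (lam - (t : ℂ))) (Iic 0) (discreteMeasure ℓ hℓ δ Y) ∧
    ∀ F : ℂ, IsDiscreteNtDValue ℓ α αh lam F ↔
      F = ∫ t in Iic (0 : ℝ), 1 / (lam - (t : ℂ)) ∂(discreteMeasure ℓ hℓ δ Y) := by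
  have hae : ∀ P : ℝ → Prop, (∀ j, P (-(δ j ^ 2))) → ∀ᵐ t ∂(discreteMeasure ℓ hℓ δ Y), P t :=
    fun P => (ae_pointMeasure_iff (s := Y ⟨0, hℓ⟩) (x := fun j => -(δ j ^ 2))
      (hY.first_ne_zero hα hαh hℓ)).2
  have hfin : IsFiniteMeasure (discreteMeasure ℓ hℓ δ Y) :=
    isFiniteMeasure_pointMeasure (s := Y ⟨0, hℓ⟩) (x := fun j => -(δ j ^ 2))
  have hr : (discreteMeasure ℓ hℓ δ Y).restrict (Iic 0) = discreteMeasure ℓ hℓ δ Y :=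
    Measure.restrict_eq_self_of_ae_mem (hae (· ∈ Iic 0) fun j => by
      simp only [mem_Iic]; nlinarith [sq_nonneg (δ j)])
  rw [IntegrableOn, hr]
  refine ⟨Integrable.of_bound (measurable_one_div_sub lam).aestronglyMeasurable
    (∑ j, ‖1 / (lam - ((-(δ j ^ 2) : ℝ) : ℂ))‖) (hae _ fun j => ?_), fun F => ?_⟩
  · exact Finset.single_le_sum (f := fun j => ‖1 / (lam - ((-(δ j ^ 2) : ℝ) : ℂ))‖)
      (fun _ _ => norm_nonneg _) (Finset.mem_univ j)
  · rw [hY.isDiscreteNtDValue_iff hα hαh hℓ hlam, integral_discreteMeasure]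
    refine Eq.congr_right (Finset.sum_congr rfl fun j _ => ?_)
    push_cast
    rw [sub_neg_eq_add, mul_one_div]

end IsWeightedEigenbasis

end Discrete

end

/-! ### Assembly of the discrete and continuum statements. -/

section

theorem discrete_spectral_representation {ℓ : ℕ} (hℓ : 0 < ℓ) {α αh : ℕ → ℝ}
    (hα : ∀ j, j ≤ ℓ → 0 < α j) (hαh : ∀ j, 1 ≤ j → j ≤ ℓ → 0 < αh j) :
    (∃! μF : Measure ℝ, IsDiffSpectralMeasure ℓ α αh μF) ∧
      (∀ μF : Measure ℝ, IsDiffSpectralMeasure ℓ α αh μF → ∀ lam ∈ Complex.slitPlane,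
        IntegrableOn (fun t : ℝ => 1 / (lam - (t : ℂ))) (Iic 0) μF ∧
        ∀ F : ℂ, IsDiscreteNtDValue ℓ α αh lam F ↔
          F = ∫ t in Iic (0 : ℝ), 1 / (lam - (t : ℂ)) ∂μF) ∧
      ∃ δ : Fin ℓ → ℝ, (∀ j, 0 < δ j) ∧ StrictMono δ ∧
        (jacobiA ℓ α αh).charpoly = ∏ j, (Polynomial.X + Polynomial.C ((δ j) ^ 2)) ∧
        (∃ Y : Matrix (Fin ℓ) (Fin ℓ) ℝ, IsWeightedEigenbasis ℓ α αh δ Y) ∧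
        ∀ Y : Matrix (Fin ℓ) (Fin ℓ) ℝ, IsWeightedEigenbasis ℓ α αh δ Y →
          IsDiffSpectralMeasure ℓ α αh (discreteMeasure ℓ hℓ δ Y) ∧
          ∀ lam ∈ Complex.slitPlane, ∀ F : ℂ, IsDiscreteNtDValue ℓ α αh lam F ↔
            F = ∑ j : Fin ℓ, ((Y ⟨0, hℓ⟩ j : ℝ) : ℂ) ^ 2 / (lam + ((δ j : ℝ) : ℂ) ^ 2) := by
  obtain ⟨δ, hδ, hmono, hchar, Y, hY⟩ := exists_isWeightedEigenbasis hα hαh hℓ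
  have hinj : Function.Injective fun j => -(δ j ^ 2) := fun i j hij =>
    hmono.injective ((sq_eq_sq₀ (hδ i).le (hδ j).le).1 (neg_injective hij))
  refine ⟨⟨_, hY.isDiffSpectralMeasure hα hαh hℓ hinj,
    fun ν hν => hY.eq_discreteMeasure hα hαh hℓ hinj hν⟩, fun μ hμ lam hlam => ?_,
    δ, hδ, hmono, hchar, ⟨Y, hY⟩, fun Z hZ => ⟨hZ.isDiffSpectralMeasure hα hαh hℓ hinj,
    fun lam hlam F => hZ.isDiscreteNtDValue_iff hα hαh hℓ hlam F⟩⟩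
  rw [hY.eq_discreteMeasure hα hαh hℓ hinj hμ]
  exact hY.isDiscreteNtDValue_iff_integral hα hαh hℓ hlam

end

end

end

theorem lemma1
    (σ : ℝ → ℝ) (hσm : Measurable σ) (c C : ℝ) (hc : 0 < c)
    (hσ : ∀ᵐ r ∂(MeasureTheory.volume.restrict (Set.Ioc (0 : ℝ) 1)), c ≤ σ r ∧ σ r ≤ C)
    (ℓ : ℕ) (hℓ : 0 < ℓ) (α αh : ℕ → ℝ)
    (hα : ∀ j, j ≤ ℓ → 0 < α j) (hαh : ∀ j, 1 ≤ j → j ≤ ℓ → 0 < αh j) :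
    -- the continuum problem
    ((∃! μ : MeasureTheory.Measure ℝ, IsStringSpectralMeasure σ μ) ∧
      ∀ μ : MeasureTheory.Measure ℝ, IsStringSpectralMeasure σ μ → ∀ lam ∈ Complex.slitPlane,
        MeasureTheory.IntegrableOn (fun t : ℝ => 1 / (lam - (t : ℂ))) (Set.Iic 0) μ ∧
        ∀ f : ℂ, IsNtDValue σ lam f ↔ f = ∫ t in Set.Iic (0 : ℝ), 1 / (lam - (t : ℂ)) ∂μ) ∧
    -- the discrete problem
    ((∃! μF : MeasureTheory.Measure ℝ, IsDiffSpectralMeasure ℓ α αh μF) ∧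
      (∀ μF : MeasureTheory.Measure ℝ, IsDiffSpectralMeasure ℓ α αh μF →
        ∀ lam ∈ Complex.slitPlane,
          MeasureTheory.IntegrableOn (fun t : ℝ => 1 / (lam - (t : ℂ))) (Set.Iic 0) μF ∧
          ∀ F : ℂ, IsDiscreteNtDValue ℓ α αh lam F ↔
            F = ∫ t in Set.Iic (0 : ℝ), 1 / (lam - (t : ℂ)) ∂μF) ∧
      ∃ δ : Fin ℓ → ℝ, (∀ j, 0 < δ j) ∧ StrictMono δ ∧
        (jacobiA ℓ α αh).charpoly = ∏ j, (Polynomial.X + Polynomial.C ((δ j) ^ 2)) ∧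
        (∃ Y : Matrix (Fin ℓ) (Fin ℓ) ℝ, IsWeightedEigenbasis ℓ α αh δ Y) ∧
        ∀ Y : Matrix (Fin ℓ) (Fin ℓ) ℝ, IsWeightedEigenbasis ℓ α αh δ Y →
          IsDiffSpectralMeasure ℓ α αh (discreteMeasure ℓ hℓ δ Y) ∧
          ∀ lam ∈ Complex.slitPlane, ∀ F : ℂ, IsDiscreteNtDValue ℓ α αh lam F ↔
            F = ∑ j : Fin ℓ, ((Y ⟨0, hℓ⟩ j : ℝ) : ℂ) ^ 2 / (lam + ((δ j : ℝ) : ℂ) ^ 2)) := by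
  exact ⟨⟨existsUnique_isStringSpectralMeasure hc hσ,
    fun _ hμ _ hlam => isNtDValue_iff_integral hc hσ hμ hlam⟩,
    discrete_spectral_representation hℓ hα hαh⟩
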